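/- Let $n\ge 1$ and $0<\gamma\le 1$. There is a constant $C$ depending only on $n$ and $\gamma$ such that the following holds. **Setting.** Let $\widetilde{\mathcal M}$ be a von Neumann algebra on a Hilbert space, with a normal semifinite faithful trace $\tau$, and let $\mathcal M\subseteq\widetilde{\mathcal M}$ be a von Neumann subalgebra on which $\tau$ is semifinite. $L_2(\widetilde{\mathcal M})$ is the completion of $\{x\in\widetilde{\mathcal M}:\tau(x^*x)<\infty\}$ for $\|x\|_2=\tau(x^*x)^{1/2}$, and $L_2(\mathcal M)\subseteq L_2(\widetilde{\mathcal M})$ is the closure of $\{x\in\mathcal M:\tau(x^*x)<\infty\}$. Let $\mathcal N=\mathcal M\,\overline\otimes\,L_\infty(\mathbb R^n)$ and $\widetilde{\mathcal N}=\widetilde{\mathcal M}\,\overline\otimes\,L_\infty(\mathbb R^n)$, so that $L_2(\mathcal N)=L_2(\mathbb R^n;L_2(\mathcal M))$ and $L_2(\widetilde{\mathcal N})=L_2(\mathbb R^n;L_2(\widetilde{\mathcal M}))$. Write $|x|=\max_i|x_i|$ on $\mathbb R^n$. **The operator.** Let $K:\mathbb R^n\times\mathbb R^n\to\mathcal M'\cap\widetilde{\mathcal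 M}$ satisfy $\|K(x,y)\|\le|x-y|^{-n}$ for $x\ne y$ and, whenever $|x-z|\le\frac12|y-z|$, $$\|K(x,y)-K(z,y)\|\le\frac{|x-z|^\gamma}{|y-z|^{n+\gamma}},\qquad \|K(y,x)-K(y,z)\|\le\frac{|x-z|^\gamma}{|y-z|^{n+\gamma}}.$$ Let $T:L_2(\mathcal N)\to L_2(\widetilde{\mathcal N})$ be a bounded operator, of arbitrary norm, associated with the kernel $K$: $T$ is an $\mathcal M$-bimodule map, that is $T(af)=aT(f)$ and $T(fa)=T(f)a$ for all $a\in\mathcal M$, and for every $f\in L_2(\mathcal N)$ that vanishes almost everywhere outside a compact set $S$, $Tf(x)=\int K(x,y)f(y)\,dy$ for almost every $x\notin S$. **The projections.** Let $\mathcal Q_k$ be the set of the dyadic cubes of edge length $2^{-k}$. Let $\mathcal E_k f(x)$ be the average of $f$ over the cube of $\mathcal Q_k$ that contains $x$, and let $df_k=\mathcal E_kf-\mathcal E_{k-1}f$. Let $f\in L_2(\mathcal N)$ and $s\in\mathbb N=\{0,1,2,\dots\}$. For each $k\in\mathbb Z$ let $A_k=\sum_{Q\in\mathcal Q_k}A_Q\mathbf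 1_Q$ and $B_k=\sum_{Q\in\mathcal Q_k}B_Q\mathbf 1_Q$, with projections $A_Q,B_Q\in\mathcal M$, be such that $A_k^\perp\,df_{k+s}=0=df_{k+s}\,B_k^\perp$, where $p^\perp=1-p$. Put $$5A_k=\bigvee_{Q\in\mathcal Q_k}A_Q\mathbf 1_{5Q},\quad A_{f,s}=\bigvee_{k\in\mathbb Z}5A_k,\qquad 5B_k=\bigvee_{Q\in\mathcal Q_k}B_Q\mathbf 1_{5Q},\quad B_{f,s}=\bigvee_{k\in\mathbb Z}5B_k,$$ where $5Q$ is the image of $Q$ under the homothety of ratio $5$ around the centre of $Q$. **Conclusion.** $A_{f,s}^\perp\,Tf$ and $(Tf)\,B_{f,s}^\perp$ belong to $L_2(\widetilde{\mathcal N})$, and $$\|A_{f,s}^\perp\,Tf\|_2\le C\,2^{-\gamma s/2}\|f\|_2,\qquad \|(Tf)\,B_{f,s}^\perp\|_2\le C\,2^{-\gamma s/2}\|f\|_2 .$$ -/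

import Mathlib

open MeasureTheory
open scoped ENNReal NNReal

universe u

namespace NCInt

noncomputable section

variable {H : Type u} [NormedAddCommGroup H] [InnerProductSpace ℂ H] [CompleteSpace H]

/-- A weight `φ` is semifinite on `M` if every nonzero positive element of `M` dominates a nonzero
positive element of `M` on which `φ` is finite. The order is the Loewner order of operators. -/
def IsSemifiniteOn (φ : (H →L[ℂ] H) → ℝ≥0∞) (M : VonNeumannAlgebra H) : Prop :=
  ∀ x ∈ M, 0 ≤ x → x ≠ 0 → ∃ y ∈ M, 0 ≤ y ∧ y ≤ x ∧ y ≠ 0 ∧ φ y < ∞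

/-- A normal semifinite faithful trace on the positive cone of the von Neumann algebra `M`.
Only the values of `toFun` on positive elements of `M` have a meaning. -/
structure NSFTrace (M : VonNeumannAlgebra H) where
  toFun : (H →L[ℂ] H) → ℝ≥0∞
  map_add : ∀ x ∈ M, ∀ y ∈ M, 0 ≤ x → 0 ≤ y → toFun (x + y) = toFun x + toFun y
  map_smul : ∀ (c : ℝ≥0), ∀ x ∈ M, 0 ≤ x → toFun (((c : ℝ) : ℂ) • x) = c * toFun x
  tracial : ∀ x ∈ M, toFun (star x * x) = toFun (x * star x)
  faithful : ∀ x ∈ M, 0 ≤ x → toFun x = 0 → x = 0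
  normal : ∀ (S : Set (H →L[ℂ] H)) (x : H →L[ℂ] H), S.Nonempty → DirectedOn (· ≤ ·) S →
    (∀ y ∈ S, y ∈ M ∧ 0 ≤ y) → x ∈ M → IsLUB S x → toFun x = ⨆ y ∈ S, toFun y
  semifinite : IsSemifiniteOn toFun M

variable {M : VonNeumannAlgebra H}

lemma smul_mem (c : ℂ) {x : H →L[ℂ] H} (hx : x ∈ M) : c • x ∈ M :=
  M.toStarSubalgebra.toSubalgebra.smul_mem hx c

namespace NSFTrace

variable (τ : NSFTrace M)

lemma mono {x y : H →L[ℂ] H} (hx : x ∈ M) (hy : y ∈ M) (h0 : 0 ≤ x) (hxy : x ≤ y) :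
    τ.toFun x ≤ τ.toFun y := by
  have h := τ.map_add x hx (y - x) (sub_mem hy hx) h0 (sub_nonneg.2 hxy)
  rw [add_sub_cancel] at h
  rw [h]
  exact le_self_add

/-- The square `τ(|x|²)` of the `L₂`-norm. -/
def sq (x : H →L[ℂ] H) : ℝ≥0∞ := τ.toFun (star x * x)

lemma star_mul_self_mem {x : H →L[ℂ] H} (hx : x ∈ M) : star x * x ∈ M :=
  mul_mem (star_mem hx) hx

lemma sq_smul (c : ℂ) {x : H →L[ℂ] H} (hx : x ∈ M) : τ.sq (c • x) = (‖c‖₊ ^ 2 : ℝ≥0) * τ.sq x := by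
  rw [sq, sq, ← τ.map_smul _ _ (star_mul_self_mem hx) (star_mul_self_nonneg x)]
  congr 1
  rw [star_smul, smul_mul_smul_comm]
  congr 1
  rw [Complex.star_def, ← Complex.normSq_eq_conj_mul_self, Complex.normSq_eq_norm_sq]
  simp

lemma sq_zero : τ.sq 0 = 0 := by
  simpa using τ.sq_smul 0 (x := 0) (zero_mem M)

lemma sq_add_le (r : ℝ) (hr : 0 < r) {x y : H →L[ℂ] H} (hx : x ∈ M) (hy : y ∈ M) :
    τ.sq (x + y) ≤ ENNReal.ofReal (1 + r ^ 2) * τ.sq x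
      + ENNReal.ofReal (1 + r⁻¹ ^ 2) * τ.sq y := by
  set w : H →L[ℂ] H := (r : ℂ) • x - ((r⁻¹ : ℝ) : ℂ) • y with hw
  have hwM : w ∈ M := sub_mem (smul_mem _ hx) (smul_mem _ hy)
  have hc : (r : ℂ) ≠ 0 := by exact_mod_cast hr.ne'
  have e1 := τ.map_smul ⟨1 + r ^ 2, by positivity⟩ _ (star_mul_self_mem hx)
    (star_mul_self_nonneg x)
  have e2 := τ.map_smul ⟨1 + r⁻¹ ^ 2, by positivity⟩ _ (star_mul_self_mem hy)
    (star_mul_self_nonneg y)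
  have key : star (x + y) * (x + y) + star w * w =
      ((1 + r ^ 2 : ℝ) : ℂ) • (star x * x) + ((1 + r⁻¹ ^ 2 : ℝ) : ℂ) • (star y * y) := by
    simp only [hw, star_add, star_sub, star_smul, add_mul, mul_add, sub_mul, mul_sub,
      smul_mul_smul_comm, Complex.star_def, Complex.conj_ofReal]
    push_cast
    rw [mul_inv_cancel₀ hc, inv_mul_cancel₀ hc]
    module
  have hp : ∀ (c : ℝ≥0) (z : H →L[ℂ] H), 0 ≤ (((c : ℝ) : ℂ) • (star z * z)) := by
    intro c z
    have : (((c : ℝ) : ℂ) • (star z * z)) =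
        star ((((Real.sqrt c : ℝ)) : ℂ) • z) * ((((Real.sqrt c : ℝ)) : ℂ) • z) := by
      rw [star_smul, smul_mul_smul_comm, Complex.star_def, Complex.conj_ofReal,
        ← Complex.ofReal_mul]
      congr 2
      exact (Real.mul_self_sqrt c.2).symm
    rw [this]
    exact star_mul_self_nonneg _
  have h1 := τ.map_add _ (star_mul_self_mem (add_mem hx hy)) _ (star_mul_self_mem hwM)
    (star_mul_self_nonneg _) (star_mul_self_nonneg _)
  have h2 := τ.map_add _ (smul_mem ((1 + r ^ 2 : ℝ) : ℂ) (star_mul_self_mem hx)) _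
    (smul_mem ((1 + r⁻¹ ^ 2 : ℝ) : ℂ) (star_mul_self_mem hy))
    (hp ⟨1 + r ^ 2, by positivity⟩ x) (hp ⟨1 + r⁻¹ ^ 2, by positivity⟩ y)
  rw [key, h2] at h1
  have o1 : ENNReal.ofReal (1 + r ^ 2) = ENNReal.ofNNReal ⟨1 + r ^ 2, by positivity⟩ :=
    ENNReal.ofReal_eq_coe_nnreal _
  have o2 : ENNReal.ofReal (1 + r⁻¹ ^ 2) = ENNReal.ofNNReal ⟨1 + r⁻¹ ^ 2, by positivity⟩ :=
    ENNReal.ofReal_eq_coe_nnreal _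
  simp only [sq]
  rw [o1, o2, ← e1, ← e2]
  exact le_self_add.trans h1.symm.le

/-- The subspace `{x ∈ M : ‖x‖₂ < ∞}` of `M`. -/
def S2sub : Submodule ℂ (H →L[ℂ] H) where
  carrier := {x | x ∈ M ∧ τ.sq x < ∞}
  zero_mem' := ⟨zero_mem M, by rw [sq_zero]; exact ENNReal.zero_lt_top⟩
  add_mem' := by
    rintro x y ⟨hx, hx'⟩ ⟨hy, hy'⟩
    refine ⟨add_mem hx hy, (τ.sq_add_le 1 one_pos hx hy).trans_lt ?_⟩
    exact ENNReal.add_lt_top.2 ⟨ENNReal.mul_lt_top ENNReal.ofReal_lt_top hx',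
      ENNReal.mul_lt_top ENNReal.ofReal_lt_top hy'⟩
  smul_mem' := by
    rintro c x ⟨hx, hx'⟩
    refine ⟨smul_mem c hx, ?_⟩
    rw [τ.sq_smul c hx]
    exact ENNReal.mul_lt_top ENNReal.coe_lt_top hx'

/-- The space `{x ∈ M : ‖x‖₂ < ∞}` (a copy, which carries the `L₂`-norm and not the operator norm). -/
def S2 : Type u := ↥(τ.S2sub)

instance : AddCommGroup τ.S2 := inferInstanceAs (AddCommGroup ↥(τ.S2sub))
instance : Module ℂ τ.S2 := inferInstanceAs (Module ℂ ↥(τ.S2sub))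

variable {τ}

/-- The inclusion of `{x ∈ M : ‖x‖₂ < ∞}` into the bounded operators. -/
def S2.val : τ.S2 →ₗ[ℂ] (H →L[ℂ] H) := τ.S2sub.subtype

lemma S2.mem (x : τ.S2) : S2.val x ∈ M := (show ↥(τ.S2sub) from x).2.1

lemma S2.sq_lt_top (x : τ.S2) : τ.sq (S2.val x) < ∞ := (show ↥(τ.S2sub) from x).2.2

lemma S2.val_injective : Function.Injective (S2.val (τ := τ)) := Subtype.val_injective

variable (τ)

/-- The norm `‖x‖₂ = τ(|x|²)^{1/2}`. -/
def norm2 (x : τ.S2) : ℝ := Real.sqrt (τ.sq (S2.val x)).toReal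

lemma norm2_sq (x : τ.S2) : τ.norm2 x ^ 2 = (τ.sq (S2.val x)).toReal :=
  Real.sq_sqrt ENNReal.toReal_nonneg

lemma norm2_smul (c : ℂ) (x : τ.S2) : τ.norm2 (c • x) = ‖c‖ * τ.norm2 x := by
  rw [norm2, _root_.map_smul, τ.sq_smul c x.mem, ENNReal.toReal_mul, norm2,
    Real.sqrt_mul ENNReal.toReal_nonneg]
  simp

lemma norm2_add_le (x y : τ.S2) : τ.norm2 (x + y) ≤ τ.norm2 x + τ.norm2 y := by
  refine le_of_forall_pos_le_add fun ε hε => ?_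
  have ha : 0 ≤ τ.norm2 x := Real.sqrt_nonneg _
  have hb : 0 ≤ τ.norm2 y := Real.sqrt_nonneg _
  set a := τ.norm2 x with hadef
  set b := τ.norm2 y with hbdef
  have hR : ∀ R : ℝ, 0 < R → τ.norm2 (x + y) ^ 2 ≤ (1 + R) * a ^ 2 + (1 + R⁻¹) * b ^ 2 := by
    intro R hR
    have h := τ.sq_add_le (Real.sqrt R) (Real.sqrt_pos.2 hR) x.mem y.mem
    rw [Real.sq_sqrt hR.le, inv_pow, Real.sq_sqrt hR.le] at h
    have h' := ENNReal.toReal_mono (ENNReal.add_lt_top.2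
      ⟨ENNReal.mul_lt_top ENNReal.ofReal_lt_top x.sq_lt_top,
      ENNReal.mul_lt_top ENNReal.ofReal_lt_top y.sq_lt_top⟩).ne h
    rw [ENNReal.toReal_add (ENNReal.mul_lt_top ENNReal.ofReal_lt_top x.sq_lt_top).ne
      (ENNReal.mul_lt_top ENNReal.ofReal_lt_top y.sq_lt_top).ne, ENNReal.toReal_mul,
      ENNReal.toReal_mul, ENNReal.toReal_ofReal (by positivity),
      ENNReal.toReal_ofReal (by positivity), ← norm2_sq, ← norm2_sq, ← _root_.map_add,
      ← norm2_sq] at h'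
    exact h'
  have hA : 0 < a + ε / 2 := by positivity
  have hB : 0 < b + ε / 2 := by positivity
  have h := hR ((b + ε / 2) / (a + ε / 2)) (by positivity)
  have hle : (1 + (b + ε / 2) / (a + ε / 2)) * a ^ 2 + (1 + ((b + ε / 2) / (a + ε / 2))⁻¹) * b ^ 2
      ≤ (1 + (b + ε / 2) / (a + ε / 2)) * (a + ε / 2) ^ 2
        + (1 + ((b + ε / 2) / (a + ε / 2))⁻¹) * (b + ε / 2) ^ 2 := by
    gcongr <;> linarith
  have heq : (1 + (b + ε / 2) / (a + ε / 2)) * (a + ε / 2) ^ 2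
        + (1 + ((b + ε / 2) / (a + ε / 2))⁻¹) * (b + ε / 2) ^ 2 = (a + b + ε) ^ 2 := by
    field_simp
    ring
  exact (abs_le_of_sq_le_sq' ((h.trans hle).trans heq.le) (by positivity)).2

/-- The `L₂`-norm as a norm on the additive group `{x ∈ M : ‖x‖₂ < ∞}`. -/
def groupNorm : AddGroupNorm τ.S2 where
  toFun := τ.norm2
  map_zero' := by simpa using τ.norm2_smul 0 0
  add_le' := τ.norm2_add_le
  neg' x := by simpa using τ.norm2_smul (-1) x
  eq_zero_of_map_eq_zero' x hx := by
    have h1 : (τ.sq (S2.val x)).toReal = 0 := by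
      rw [← norm2_sq, hx]
      norm_num
    have h2 : τ.sq (S2.val x) = 0 := by
      rcases (ENNReal.toReal_eq_zero_iff _).1 h1 with h | h
      · exact h
      · exact absurd h x.sq_lt_top.ne
    have h3 := τ.faithful _ (star_mul_self_mem x.mem) (star_mul_self_nonneg _) h2
    apply S2.val_injective
    rw [_root_.map_zero]
    exact (CStarRing.star_mul_self_eq_zero_iff _).1 h3

instance : NormedAddCommGroup τ.S2 := τ.groupNorm.toNormedAddCommGroup

lemma norm_def (x : τ.S2) : ‖x‖ = τ.norm2 x := rfl

instance : NormedSpace ℂ τ.S2 where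
  norm_smul_le c x := (τ.norm2_smul c x).le

/-- The noncommutative space `L₂(M, τ)`, the completion of `{x ∈ M : ‖x‖₂ < ∞}` for `‖·‖₂`. -/
abbrev L2 : Type u := UniformSpace.Completion τ.S2

lemma norm2_le_of_sq_le {x y : τ.S2} {c : ℝ≥0}
    (h : τ.sq (S2.val x) ≤ (c ^ 2 : ℝ≥0) * τ.sq (S2.val y)) : ‖x‖ ≤ c * ‖y‖ := by
  rw [norm_def, norm_def]
  have h' := ENNReal.toReal_mono (ENNReal.mul_lt_top ENNReal.coe_lt_top y.sq_lt_top).ne h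
  rw [ENNReal.toReal_mul, ← norm2_sq, ← norm2_sq] at h'
  refine (abs_le_of_sq_le_sq' (h'.trans (le_of_eq ?_))
    (mul_nonneg c.2 (Real.sqrt_nonneg _))).2
  rw [mul_pow, ENNReal.coe_toReal, NNReal.coe_pow]
  rfl

lemma star_mul_mul_le (a x : H →L[ℂ] H) :
    star x * (star a * a) * x ≤ (((‖a‖₊ ^ 2 : ℝ≥0) : ℝ) : ℂ) • (star x * x) := by
  have h := CStarAlgebra.star_mul_le_algebraMap_norm_sq (a := a)
  have h2 := star_left_conjugate_le_conjugate h x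
  refine h2.trans (le_of_eq ?_)
  rw [Algebra.algebraMap_eq_smul_one, mul_smul_comm, smul_mul_assoc, mul_one]
  ext v
  simp only [_root_.smul_apply, ← Complex.coe_smul]
  simp

lemma sq_left_mul_le {a x : H →L[ℂ] H} (ha : a ∈ M) (hx : x ∈ M) :
    τ.sq (a * x) ≤ (‖a‖₊ ^ 2 : ℝ≥0) * τ.sq x := by
  have h := star_mul_mul_le a x
  rw [sq, sq, ← τ.map_smul _ _ (star_mul_self_mem hx) (star_mul_self_nonneg x)]
  refine τ.mono (star_mul_self_mem (mul_mem ha hx)) (smul_mem _ (star_mul_self_mem hx))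
    (star_mul_self_nonneg _) ?_
  rw [star_mul, mul_assoc, ← mul_assoc (star a), ← mul_assoc]
  exact h

lemma sq_star {x : H →L[ℂ] H} (hx : x ∈ M) : τ.sq (star x) = τ.sq x := by
  rw [sq, sq, star_star, τ.tracial x hx]

lemma sq_right_mul_le {a x : H →L[ℂ] H} (ha : a ∈ M) (hx : x ∈ M) :
    τ.sq (x * a) ≤ (‖a‖₊ ^ 2 : ℝ≥0) * τ.sq x := by
  have h := τ.sq_left_mul_le (star_mem ha) (star_mem hx)
  rwa [← star_mul, τ.sq_star (mul_mem hx ha), τ.sq_star hx, nnnorm_star] at h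

/-- Left multiplication by `a ∈ M` on `{x ∈ M : ‖x‖₂ < ∞}`. -/
def lmulS2 (a : M) : τ.S2 →L[ℂ] τ.S2 :=
  LinearMap.mkContinuous
    { toFun := fun x => (⟨a * S2.val x, mul_mem a.2 x.mem,
        (τ.sq_left_mul_le a.2 x.mem).trans_lt (ENNReal.mul_lt_top ENNReal.coe_lt_top x.sq_lt_top)⟩ :
        ↥(τ.S2sub))
      map_add' := fun x y => Subtype.ext (by simp [mul_add]; rfl)
      map_smul' := fun c x => Subtype.ext (by simp; rfl) }
    ‖(a : H →L[ℂ] H)‖₊ (fun x => τ.norm2_le_of_sq_le (τ.sq_left_mul_le a.2 x.mem))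

/-- Right multiplication by `a ∈ M` on `{x ∈ M : ‖x‖₂ < ∞}`. -/
def rmulS2 (a : M) : τ.S2 →L[ℂ] τ.S2 :=
  LinearMap.mkContinuous
    { toFun := fun x => (⟨S2.val x * a, mul_mem x.mem a.2,
        (τ.sq_right_mul_le a.2 x.mem).trans_lt
          (ENNReal.mul_lt_top ENNReal.coe_lt_top x.sq_lt_top)⟩ : ↥(τ.S2sub))
      map_add' := fun x y => Subtype.ext (by simp [add_mul]; rfl)
      map_smul' := fun c x => Subtype.ext (by simp; rfl) }
    ‖(a : H →L[ℂ] H)‖₊ (fun x => τ.norm2_le_of_sq_le (τ.sq_right_mul_le a.2 x.mem))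

/-- Left multiplication `ξ ↦ a ξ` by `a ∈ M` on `L₂(M, τ)`. -/
def lmul (a : M) : τ.L2 →L[ℂ] τ.L2 :=
  (UniformSpace.Completion.toComplL.comp (τ.lmulS2 a)).extend UniformSpace.Completion.toComplL

/-- Right multiplication `ξ ↦ ξ a` by `a ∈ M` on `L₂(M, τ)`. -/
def rmul (a : M) : τ.L2 →L[ℂ] τ.L2 :=
  (UniformSpace.Completion.toComplL.comp (τ.rmulS2 a)).extend UniformSpace.Completion.toComplL

/-- For a von Neumann subalgebra `N` of `M`, the space `L₂(N)` as the closed subspace of `L₂(M)`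
generated by the elements of `N` of finite `L₂`-norm. -/
def L2sub (N : VonNeumannAlgebra H) : Submodule ℂ τ.L2 :=
  (((Subalgebra.toSubmodule N.toStarSubalgebra.toSubalgebra).comap S2.val).map
    (UniformSpace.Completion.toComplL (𝕜 := ℂ) (E := τ.S2)).toLinearMap).topologicalClosure

end NSFTrace

/-- The inclusion of a von Neumann subalgebra. -/
def incl {N M : VonNeumannAlgebra H} (h : N ≤ M) (a : N) : M := ⟨a, h a.2⟩

/-- The orthogonal projections of the von Neumann algebra `M`. -/
def Proj (M : VonNeumannAlgebra H) : Type u := {p : H →L[ℂ] H // p ∈ M ∧ IsStarProjection p}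

/-- The complement `1 - p` of a projection. -/
def Proj.perp (p : Proj M) : M := ⟨1 - p.1, sub_mem (one_mem M) p.2.1⟩

/-- The supremum of a family of projections of `M`, which is the orthogonal projection onto the
closed linear span of their ranges. -/
def Proj.sup {ι : Type*} (P : ι → Proj M) : Proj M :=
  ⟨(⨆ i, (P i).1.range).topologicalClosure.starProjection, by
    refine ⟨?_, isStarProjection_starProjection⟩
    rw [VonNeumannAlgebra.IsStarProjection.mem_iff isStarProjection_starProjection]
    intro y hy
    rw [Submodule.range_starProjection]
    have h1 : (⨆ i, (P i).1.range) ≤ (⨆ i, (P i).1.range).comap (y : H →ₗ[ℂ] H) := by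
      refine iSup_le fun i => ?_
      have h2 := (VonNeumannAlgebra.IsStarProjection.mem_iff (P i).2.2 M).1 (P i).2.1 y hy
      intro v hv
      exact (le_iSup (fun i => (P i).1.range) i) (h2 hv)
    intro v hv
    exact map_mem_closure y.continuous hv h1⟩

/-! ### Dyadic cubes in `ℝⁿ` -/

variable {n : ℕ}

/-- The dyadic cube of edge length `2^{-k}` and lower corner `2^{-k} m`. -/
def cube (k : ℤ) (m : Fin n → ℤ) : Set (Fin n → ℝ) :=
  {x | ∀ i, (2 : ℝ) ^ (-k) * m i ≤ x i ∧ x i < (2 : ℝ) ^ (-k) * (m i + 1)}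

/-- The centre of a dyadic cube. -/
def center (k : ℤ) (m : Fin n → ℤ) : Fin n → ℝ := fun i => (2 : ℝ) ^ (-k) * (m i + 1 / 2)

/-- The image of a dyadic cube under the homothety of ratio `d` around its centre. -/
def dilate (d : ℕ) (k : ℤ) (m : Fin n → ℤ) : Set (Fin n → ℝ) :=
  (fun x => center k m + (d : ℝ) • (x - center k m)) '' cube k m

/-- The index of the dyadic cube of edge length `2^{-k}` that contains `x`. -/
def cubeIndex (k : ℤ) (x : Fin n → ℝ) : Fin n → ℤ := fun i => ⌊(2 : ℝ) ^ k * x i⌋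

/-- The dyadic conditional expectation `E_k f`, the average of `f` over the cube containing `x`. -/
def condAvg {E : Type*} [NormedAddCommGroup E] [NormedSpace ℝ E]
    (k : ℤ) (f : (Fin n → ℝ) → E) (x : Fin n → ℝ) : E :=
  ⨍ y in cube k (cubeIndex k x), f y

/-- The dyadic martingale difference `df_k = E_k f - E_{k-1} f`. -/
def mdiff {E : Type*} [NormedAddCommGroup E] [NormedSpace ℝ E]
    (k : ℤ) (f : (Fin n → ℝ) → E) (x : Fin n → ℝ) : E :=
  condAvg k f x - condAvg (k - 1) f x

/-- For `A = ∑ A_Q 1_Q`, the sum over the cubes of edge length `2^{-k}`, this is the value at `x` of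
`dA = ⋁ A_Q 1_{dQ}`. -/
def dilateProj (d : ℕ) (k : ℤ) (A : (Fin n → ℤ) → Proj M) (x : Fin n → ℝ) : Proj M :=
  Proj.sup fun m : {m : Fin n → ℤ // x ∈ dilate d k m} => A m

/-- The value at `x` of `⋁_k 5A_k`. -/
def bigProj (A : ℤ → (Fin n → ℤ) → Proj M) (x : Fin n → ℝ) : Proj M :=
  Proj.sup fun k : ℤ => dilateProj 5 k (A k) x

/-! ### Calderón-Zygmund operators -/

/-- `T` is a Calderón-Zygmund operator from `L₂(ℝⁿ; L₂(M))` to `L₂(ℝⁿ; L₂(N))` with kernel `K`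
taking its values in `M' ∩ N` and with Lipschitz parameter `γ`, satisfying the size condition.
The norm of `Fin n → ℝ` is the maximum norm. The last three fields express that `T` is given by
left multiplication by the kernel `K`, which commutes with `M`: `T` is a bimodule map over `M`, and
`(T f)(x) = ∫ K(x, y) f(y) dy` for almost all `x` outside a compact set that carries `f`. -/
structure IsCalderonZygmund {M N : VonNeumannAlgebra H} (hMN : M ≤ N) (τ : NSFTrace N) (γ : ℝ)
    (K : (Fin n → ℝ) → (Fin n → ℝ) → N)
    (T : Lp (τ.L2sub M) 2 (volume : Measure (Fin n → ℝ)) →L[ℂ]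
      Lp τ.L2 2 (volume : Measure (Fin n → ℝ))) : Prop where
  commutes : ∀ x y, (K x y : H →L[ℂ] H) ∈ M.commutant
  size : ∀ x y, x ≠ y → ‖(K x y : H →L[ℂ] H)‖ ≤ 1 / ‖x - y‖ ^ n
  smooth_fst : ∀ x y z, ‖x - z‖ ≤ 1 / 2 * ‖y - z‖ →
    ‖(K x y : H →L[ℂ] H) - K z y‖ ≤ ‖x - z‖ ^ γ / ‖y - z‖ ^ ((n : ℝ) + γ)
  smooth_snd : ∀ x y z, ‖x - z‖ ≤ 1 / 2 * ‖y - z‖ →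
    ‖(K y x : H →L[ℂ] H) - K y z‖ ≤ ‖x - z‖ ^ γ / ‖y - z‖ ^ ((n : ℝ) + γ)
  left_modular : ∀ (a : M) (f g : Lp (τ.L2sub M) 2 (volume : Measure (Fin n → ℝ))),
    (∀ᵐ x, (g x : τ.L2) = τ.lmul (incl hMN a) (f x)) →
    ∀ᵐ x, T g x = τ.lmul (incl hMN a) (T f x)
  right_modular : ∀ (a : M) (f g : Lp (τ.L2sub M) 2 (volume : Measure (Fin n → ℝ))),
    (∀ᵐ x, (g x : τ.L2) = τ.rmul (incl hMN a) (f x)) →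
    ∀ᵐ x, T g x = τ.rmul (incl hMN a) (T f x)
  kernel : ∀ (S : Set (Fin n → ℝ)) (f : Lp (τ.L2sub M) 2 (volume : Measure (Fin n → ℝ))),
    IsCompact S → (∀ᵐ y, y ∉ S → f y = 0) →
    ∀ᵐ x, x ∉ S → T f x = ∫ y, τ.lmul (K x y) (f y : τ.L2)

end

end NCInt

/-!
# Localisation of noncommutative Calderón-Zygmund operators

Left and right multiplication are treated at once, through `IsSideAction`; write `L` for either of
them and `p = L(q^⊥)` for the multiplication by the complement of the big projection `q`.

**Reduction to pieces on one scale.** Assume `s ≥ 1` and put `t = s - 1`. For a starting level `-J`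
let `e_k` be the supremum of the `A_j`, `-J ≤ j ≤ k`, and `Δ_k = e_k - e_{k-1}`. These increments
(`increment`) are projections that are constant on the cubes of level `k` and mutually orthogonal at
each point. The function `f` is approximated by `f_J`, the sum of the martingale differences
`df_{j+s}`, `-J ≤ j < J`, cut off to a large cube (`levelPart`, `tendsto_levelPart`). Then
`f_J = ∑ g_k` with `g_k = Δ_k f_J`, and since `Δ_k` annihilates `df_{j+s}` for `j < k`, the piece
`g_k` has mean zero on each cube of level `k + t`. For `s = 0` the projections are replaced by their
suprema over the children of each cube, which satisfy the hypothesis for `s = 1`.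

**Truncated kernels.** The projection `q` dominates `Δ_k(y)` on the double of the cube of level `k`
that contains `y`. By the modularity of `T`, the function `p T g_k` is therefore given by the kernel
`K` off this double, and the mean zero property allows for the subtraction of its value at the
centre of the small cube that contains `y`. The resulting kernel `truncKer` is bounded by
a constant times `2^{-γ t / 2}` times `2^{-kγ} / (2^{-k} + |x - y|)^{n + γ}`, and it is smooth in `x`
across scales below `2^{-k}` (`IsScaleKernel`, `isScaleKernel_truncKer`). The norm of `T` plays no
role.

**Almost orthogonality.** Let `U_k` be the image of `g_k` under the truncated kernel. Subtracting
from `U_k` the average `V_k = E_k(b_k g_k)`, where `b_k(y)` is the integral of the truncated kernel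
in its first variable, gives functions `W_k` whose martingale differences `D_l W_k` decay
exponentially in `|l - k|`: for `l > k` by the smoothness, for `l ≤ k` because `V_k` has the same
mass as `U_k` on large scales. A Schur test then bounds `‖∑ W_k‖²` by `∑ ‖g_k‖²`. As the kernel
commutes with `Δ_k`, the values of the `V_k` lie in the ranges of the `Δ_k`, so that the `V_k` are
mutually orthogonal, like the `g_k` themselves (`eLpNorm_sum_scale_le`, `eLpNorm_apply_le_of_sum`).
-/


namespace NCInt

/-! ### Dyadic cubes -/

section Cubes

variable {n : ℕ}

lemma mem_cube_iff {k : ℤ} {m : Fin n → ℤ} {x : Fin n → ℝ} :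
    x ∈ cube k m ↔ cubeIndex k x = m := by
  have h2 : (0 : ℝ) < 2 ^ k := by positivity
  have e : (2 : ℝ) ^ (-k) = (2 ^ k)⁻¹ := zpow_neg _ _
  simp only [cube, Set.mem_ofPred_eq, funext_iff, cubeIndex, Int.floor_eq_iff, e]
  refine forall_congr' fun i => and_congr ?_ ?_
  · rw [inv_mul_le_iff₀ h2]
  · rw [lt_inv_mul_iff₀ h2]

lemma mem_cube_cubeIndex (k : ℤ) (x : Fin n → ℝ) : x ∈ cube k (cubeIndex k x) :=
  mem_cube_iff.2 rfl

lemma measurable_cubeIndex (k : ℤ) : Measurable (cubeIndex (n := n) k) :=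
  measurable_pi_lambda _ fun i =>
    Int.measurable_floor.comp ((measurable_pi_apply i).const_mul _)

lemma cube_eq_preimage (k : ℤ) (m : Fin n → ℤ) : cube k m = cubeIndex k ⁻¹' {m} := by
  ext x; simp [mem_cube_iff]

lemma measurableSet_cube (k : ℤ) (m : Fin n → ℤ) : MeasurableSet (cube k m) := by
  rw [cube_eq_preimage]
  exact measurable_cubeIndex k (measurableSet_singleton m)

lemma cube_eq_pi (k : ℤ) (m : Fin n → ℤ) :
    cube k m = Set.univ.pi fun i => Set.Ico ((2 : ℝ) ^ (-k) * m i) (2 ^ (-k) * (m i + 1)) := by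
  ext x; simp [cube, Set.mem_pi]

lemma volume_cube (k : ℤ) (m : Fin n → ℤ) :
    volume (cube k m) = ENNReal.ofReal (2 ^ (-k)) ^ n := by
  rw [cube_eq_pi, volume_pi_pi]
  simp only [Real.volume_Ico]
  rw [Finset.prod_congr rfl (g := fun _ => ENNReal.ofReal (2 ^ (-k)))]
  · simp
  · intro i _
    congr 1
    ring

lemma volume_cube_ne_zero (k : ℤ) (m : Fin n → ℤ) : volume (cube k m) ≠ 0 := by
  rw [volume_cube]
  have : (0 : ℝ) < 2 ^ (-k) := by positivity
  exact pow_ne_zero _ (by simpa using this)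

lemma volume_cube_ne_top (k : ℤ) (m : Fin n → ℤ) : volume (cube k m) ≠ ∞ := by
  rw [volume_cube]
  exact ENNReal.pow_ne_top ENNReal.ofReal_ne_top

lemma pairwise_disjoint_cube (k : ℤ) :
    Pairwise (Function.onFun Disjoint (cube (n := n) k)) := by
  intro m m' h
  rw [Function.onFun, Set.disjoint_left]
  intro x hx hx'
  exact h ((mem_cube_iff.1 hx).symm.trans (mem_cube_iff.1 hx'))

lemma iUnion_cube (k : ℤ) : ⋃ m, cube (n := n) k m = Set.univ :=
  Set.eq_univ_of_forall fun x => Set.mem_iUnion.2 ⟨_, mem_cube_cubeIndex k x⟩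

lemma cubeIndex_of_le {l k : ℤ} (h : l ≤ k) (x : Fin n → ℝ) (i : Fin n) :
    cubeIndex l x i = cubeIndex k x i / ((2 ^ (k - l).toNat : ℕ) : ℤ) := by
  simp only [cubeIndex]
  rw [← Int.floor_div_natCast]
  congr 1
  have : (((2 ^ (k - l).toNat : ℕ) : ℕ) : ℝ) = (2 : ℝ) ^ (k - l) := by
    push_cast
    rw [← zpow_natCast, Int.toNat_of_nonneg (by lia)]
  rw [this, zpow_sub₀ two_ne_zero]
  field_simp

lemma cubeIndex_eq_of_le {l k : ℤ} (h : l ≤ k) {x y : Fin n → ℝ}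
    (hxy : cubeIndex k x = cubeIndex k y) : cubeIndex l x = cubeIndex l y := by
  funext i
  rw [cubeIndex_of_le h, cubeIndex_of_le h, hxy]

/-- Two points of a dyadic cube are at a distance less than its edge length. -/
lemma norm_sub_le_of_cubeIndex_eq {k : ℤ} {x y : Fin n → ℝ}
    (h : cubeIndex k x = cubeIndex k y) : ‖x - y‖ ≤ 2 ^ (-k) := by
  have hk : (0 : ℝ) < 2 ^ (-k) := by positivity
  refine (pi_norm_le_iff_of_nonneg hk.le).2 fun i => ?_
  have h1 := (mem_cube_iff.2 h) i
  have h2 := (mem_cube_cubeIndex k y) i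
  rw [Pi.sub_apply, Real.norm_eq_abs, abs_le]
  constructor <;> nlinarith [h1.1, h1.2, h2.1, h2.2]

lemma lintegral_eq_tsum_cube (k : ℤ) (f : (Fin n → ℝ) → ℝ≥0∞) :
    ∫⁻ x, f x = ∑' m, ∫⁻ x in cube k m, f x := by
  rw [← lintegral_iUnion (measurableSet_cube k) (pairwise_disjoint_cube k), iUnion_cube,
    setLIntegral_univ]

/-- A function whose integral vanishes over every cube of a given size has integral zero over each
union of such cubes. -/
lemma setIntegral_eq_zero_of_cube {E : Type*} [NormedAddCommGroup E] [NormedSpace ℝ E] (k : ℤ)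
    {f : (Fin n → ℝ) → E} {S : Set (Fin n → ℝ)} (hS : MeasurableSet S)
    (hSk : ∀ x y, cubeIndex k x = cubeIndex k y → x ∈ S → y ∈ S) (hf : IntegrableOn f S)
    (h : ∀ x ∈ S, ∫ y in cube k (cubeIndex k x), f y = 0) : ∫ x in S, f x = 0 := by
  have hU : ⋃ m, S ∩ cube k m = S := by rw [← Set.inter_iUnion, iUnion_cube, Set.inter_univ]
  rw [← hU, integral_iUnion (fun m => hS.inter (measurableSet_cube k m))
    (fun m m' hm => (pairwise_disjoint_cube k hm).mono Set.inter_subset_right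
      Set.inter_subset_right) (by rwa [hU])]
  refine (tsum_congr fun m => ?_).trans tsum_zero
  rcases Set.eq_empty_or_nonempty (S ∩ cube k m) with h0 | ⟨x, hxS, hxm⟩
  · simp [h0]
  · have hm := mem_cube_iff.1 hxm
    have : S ∩ cube k m = cube k m := Set.inter_eq_right.2 fun y hy =>
      hSk x y (hm.trans (mem_cube_iff.1 hy).symm) hxS
    rw [this, ← hm]
    exact h x hxS

end Cubes

/-! ### Dyadic averages -/

section Averages

variable {n : ℕ} {E : Type*} [NormedAddCommGroup E] [NormedSpace ℝ E]

lemma condAvg_congr (k : ℤ) (f : (Fin n → ℝ) → E) {x y : Fin n → ℝ}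
    (h : cubeIndex k x = cubeIndex k y) : condAvg k f x = condAvg k f y := by
  rw [condAvg, condAvg, h]

lemma stronglyMeasurable_comp_cubeIndex {F : Type*} [TopologicalSpace F] (k : ℤ)
    (φ : (Fin n → ℤ) → F) : StronglyMeasurable fun x => φ (cubeIndex k x) :=
  (StronglyMeasurable.of_discrete (f := φ)).comp_measurable (measurable_cubeIndex k)

lemma stronglyMeasurable_condAvg (k : ℤ) (f : (Fin n → ℝ) → E) :
    StronglyMeasurable (condAvg k f) :=
  stronglyMeasurable_comp_cubeIndex k fun m => ⨍ y in cube k m, f y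

omit [NormedSpace ℝ E] in
lemma integrableOn_of_memLp {f : (Fin n → ℝ) → E} (hf : MemLp f 2) {S : Set (Fin n → ℝ)}
    (hS : volume S ≠ ∞) : IntegrableOn f S := by
  have : IsFiniteMeasure (volume.restrict S) := isFiniteMeasure_restrict.2 hS
  exact (hf.restrict S).integrable (by norm_num)

omit [NormedSpace ℝ E] in
lemma integrableOn_cube {f : (Fin n → ℝ) → E} (hf : MemLp f 2) (k : ℤ) (m : Fin n → ℤ) :
    IntegrableOn f (cube k m) :=
  integrableOn_of_memLp hf (volume_cube_ne_top k m)

lemma condAvg_add (k : ℤ) {f g : (Fin n → ℝ) → E} (hf : MemLp f 2) (hg : MemLp g 2) :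
    condAvg k (f + g) = condAvg k f + condAvg k g := by
  funext x
  simp only [condAvg, setAverage_eq, Pi.add_apply]
  rw [integral_add (integrableOn_cube hf _ _) (integrableOn_cube hg _ _), smul_add]

lemma condAvg_sub (k : ℤ) {f g : (Fin n → ℝ) → E} (hf : MemLp f 2) (hg : MemLp g 2) :
    condAvg k (f - g) = condAvg k f - condAvg k g := by
  funext x
  simp only [condAvg, setAverage_eq, Pi.sub_apply]
  rw [integral_sub (integrableOn_cube hf _ _) (integrableOn_cube hg _ _), smul_sub]

lemma measureReal_cube_pos (k : ℤ) (m : Fin n → ℤ) : 0 < volume.real (cube k m) :=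
  ENNReal.toReal_pos (volume_cube_ne_zero k m) (volume_cube_ne_top k m)

variable [CompleteSpace E]

/-- The average of a function that is constant on the cubes is the function. -/
lemma condAvg_of_const (k : ℤ) {f : (Fin n → ℝ) → E}
    (h : ∀ x y, cubeIndex k x = cubeIndex k y → f x = f y) : condAvg k f = f := by
  funext x
  rw [condAvg, setAverage_congr_fun (measurableSet_cube _ _)
    (g := fun _ => f x) (Filter.Eventually.of_forall fun y hy => h y x (mem_cube_iff.1 hy))]
  exact setAverage_const (volume_cube_ne_zero _ _) (volume_cube_ne_top _ _) _

lemma setIntegral_condAvg (k : ℤ) (f : (Fin n → ℝ) → E) (m : Fin n → ℤ) :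
    ∫ y in cube k m, condAvg k f y = ∫ y in cube k m, f y := by
  have h : ∀ y ∈ cube k m, condAvg k f y = ⨍ z in cube k m, f z := fun y hy => by
    rw [condAvg, mem_cube_iff.1 hy]
  rw [setIntegral_congr_fun (measurableSet_cube k m) h]
  rw [setIntegral_const, setAverage_eq, smul_smul, mul_inv_cancel₀ (measureReal_cube_pos k m).ne',
    one_smul]

end Averages

section Pythagoras

variable {n : ℕ} {E : Type*} [NormedAddCommGroup E] [InnerProductSpace ℝ E] [CompleteSpace E]

lemma eLpNorm_two_sq {α F : Type*} [MeasurableSpace α] {μ : Measure α} [ENorm F] (f : α → F) :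
    eLpNorm f 2 μ ^ 2 = ∫⁻ x, ‖f x‖ₑ ^ 2 ∂μ := by
  have h := eLpNorm_nnreal_pow_eq_lintegral (μ := μ) (f := f) (p := 2) two_ne_zero
  simpa using h

/-- The conditional variance identity on one cube. -/
lemma setLIntegral_cube_sq (k : ℤ) {f : (Fin n → ℝ) → E} (hf : MemLp f 2) (m : Fin n → ℤ) :
    ∫⁻ x in cube k m, ‖f x‖ₑ ^ 2 = (∫⁻ x in cube k m, ‖condAvg k f x‖ₑ ^ 2)
      + ∫⁻ x in cube k m, ‖f x - condAvg k f x‖ₑ ^ 2 := by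
  have : IsFiniteMeasure (volume.restrict (cube k m)) :=
    isFiniteMeasure_restrict.2 (volume_cube_ne_top k m)
  set c := ⨍ z in cube k m, f z with hc
  have h : ∀ y ∈ cube k m, condAvg k f y = c := fun y hy => by
    rw [condAvg, mem_cube_iff.1 hy]
  have hfm : MemLp f 2 (volume.restrict (cube k m)) := hf.restrict _
  have hcm : MemLp (fun _ => c) 2 (volume.restrict (cube k m)) := memLp_const c
  have hdm : MemLp (fun x => f x - c) 2 (volume.restrict (cube k m)) := hfm.sub hcm
  have e1 : ∫⁻ x in cube k m, ‖condAvg k f x‖ₑ ^ 2 = ∫⁻ x in cube k m, ‖c‖ₑ ^ 2 :=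
    setLIntegral_congr_fun (measurableSet_cube k m) fun y hy => by simp only [h y hy]
  have e2 : ∫⁻ x in cube k m, ‖f x - condAvg k f x‖ₑ ^ 2 = ∫⁻ x in cube k m, ‖f x - c‖ₑ ^ 2 :=
    setLIntegral_congr_fun (measurableSet_cube k m) fun y hy => by simp only [h y hy]
  have conv : ∀ {g : (Fin n → ℝ) → E}, MemLp g 2 (volume.restrict (cube k m)) →
      ∫⁻ x in cube k m, ‖g x‖ₑ ^ 2 = ENNReal.ofReal (∫ x in cube k m, ‖g x‖ ^ 2) := by
    intro g hg
    rw [ofReal_integral_eq_lintegral_ofReal (hg.integrable_norm_pow two_ne_zero)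
      (Filter.Eventually.of_forall fun x => by positivity)]
    refine lintegral_congr fun x => ?_
    rw [ENNReal.ofReal_pow (norm_nonneg _), ofReal_norm]
  rw [e1, e2, conv hfm, conv hcm, conv hdm, ← ENNReal.ofReal_add (by positivity) (by positivity)]
  congr 1
  have h0 : ∫ x in cube k m, (f x - c) = 0 := by
    rw [integral_sub (integrableOn_cube hf k m) (integrable_const c), setIntegral_const, hc,
      setAverage_eq, smul_smul, mul_inv_cancel₀ (measureReal_cube_pos k m).ne', one_smul, sub_self]
  have h1 : ∫ x in cube k m, inner ℝ c (f x - c) = 0 := by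
    rw [integral_inner (hdm.integrable (by norm_num)), h0, inner_zero_right]
  have hi : Integrable (fun x => inner ℝ c (f x - c)) (volume.restrict (cube k m)) :=
    (hdm.integrable (by norm_num)).const_inner c
  calc ∫ x in cube k m, ‖f x‖ ^ 2
      = ∫ x in cube k m, (‖c‖ ^ 2 + 2 * inner ℝ c (f x - c) + ‖f x - c‖ ^ 2) := by
        refine integral_congr_ae (Filter.Eventually.of_forall fun x => ?_)
        have := norm_add_sq_real c (f x - c)
        rw [add_sub_cancel] at this
        exact this
    _ = _ := by
        have hi' : Integrable (fun x => ‖c‖ ^ 2 + 2 * inner ℝ c (f x - c))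
            (volume.restrict (cube k m)) := (integrable_const _).add (hi.const_mul 2)
        rw [integral_add hi'
          (hdm.integrable_norm_pow two_ne_zero), integral_add (integrable_const _) (hi.const_mul 2),
          integral_const_mul, h1]
        ring

/-- The conditional variance identity `‖f‖² = ‖E_k f‖² + ‖f - E_k f‖²`. -/
lemma eLpNorm_sq_eq_condAvg (k : ℤ) {f : (Fin n → ℝ) → E} (hf : MemLp f 2) :
    eLpNorm f 2 volume ^ 2
      = eLpNorm (condAvg k f) 2 volume ^ 2 + eLpNorm (f - condAvg k f) 2 volume ^ 2 := by
  simp only [eLpNorm_two_sq]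
  rw [lintegral_eq_tsum_cube k, lintegral_eq_tsum_cube k (fun x => ‖condAvg k f x‖ₑ ^ 2),
    lintegral_eq_tsum_cube k (fun x => ‖(f - condAvg k f) x‖ₑ ^ 2), ← ENNReal.tsum_add]
  exact tsum_congr fun m => setLIntegral_cube_sq k hf m

lemma eLpNorm_condAvg_le (k : ℤ) {f : (Fin n → ℝ) → E} (hf : MemLp f 2) :
    eLpNorm (condAvg k f) 2 volume ≤ eLpNorm f 2 volume := by
  refine (ENNReal.pow_le_pow_left_iff two_ne_zero).1 ?_
  rw [eLpNorm_sq_eq_condAvg k hf]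
  exact le_self_add

lemma memLp_condAvg (k : ℤ) {f : (Fin n → ℝ) → E} (hf : MemLp f 2) :
    MemLp (condAvg k f) 2 :=
  ⟨(stronglyMeasurable_condAvg k f).aestronglyMeasurable,
    (eLpNorm_condAvg_le k hf).trans_lt hf.2⟩

/-- The tower property of the dyadic averages. -/
lemma condAvg_condAvg {l k : ℤ} (h : l ≤ k) {f : (Fin n → ℝ) → E} (hf : MemLp f 2) :
    condAvg l (condAvg k f) = condAvg l f := by
  rw [← sub_eq_zero, ← condAvg_sub l (memLp_condAvg k hf) hf]
  funext x
  rw [condAvg, setAverage_eq, setIntegral_eq_zero_of_cube k (measurableSet_cube _ _), smul_zero]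
  · rfl
  · intro y z hyz hy
    rw [mem_cube_iff] at hy ⊢
    rw [← cubeIndex_eq_of_le h hyz, hy]
  · exact integrableOn_cube ((memLp_condAvg k hf).sub hf) _ _
  · intro y _
    simp only [Pi.sub_apply]
    rw [integral_sub (integrableOn_cube (memLp_condAvg k hf) _ _) (integrableOn_cube hf _ _),
      setIntegral_condAvg, sub_self]

lemma condAvg_condAvg' {l k : ℤ} (h : l ≤ k) (f : (Fin n → ℝ) → E) :
    condAvg k (condAvg l f) = condAvg l f :=
  condAvg_of_const k fun _ _ hxy => condAvg_congr l f (cubeIndex_eq_of_le h hxy)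

lemma memLp_mdiff (k : ℤ) {f : (Fin n → ℝ) → E} (hf : MemLp f 2) : MemLp (mdiff k f) 2 :=
  (memLp_condAvg k hf).sub (memLp_condAvg (k - 1) hf)

/-- Orthogonality of the martingale differences. -/
lemma eLpNorm_condAvg_sq_eq_sum (f : (Fin n → ℝ) → E) (hf : MemLp f 2) (a : ℤ) (N : ℕ) :
    eLpNorm (condAvg (a + N) f) 2 volume ^ 2 = eLpNorm (condAvg a f) 2 volume ^ 2
      + ∑ j ∈ Finset.range N, eLpNorm (mdiff (a + j + 1) f) 2 volume ^ 2 := by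
  induction N with
  | zero => simp
  | succ N ih =>
    rw [Finset.sum_range_succ, ← add_assoc, ← ih,
      eLpNorm_sq_eq_condAvg (a + N) (memLp_condAvg (a + (N + 1 : ℕ)) hf),
      condAvg_condAvg (by push_cast; lia) hf]
    congr 3
    funext x
    simp only [mdiff, Pi.sub_apply]
    rw [add_sub_cancel_right]
    push_cast
    rw [add_assoc]

end Pythagoras


section Convergence

variable {n : ℕ} {E : Type*} [NormedAddCommGroup E] [InnerProductSpace ℝ E] [CompleteSpace E]

omit [CompleteSpace E] in
lemma enorm_setAverage_cube_le (k : ℤ) (m : Fin n → ℤ) (f : (Fin n → ℝ) → E) :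
    ‖⨍ y in cube k m, f y‖ₑ ≤ (volume (cube k m))⁻¹ * ∫⁻ y in cube k m, ‖f y‖ₑ := by
  rw [setAverage_eq, enorm_smul]
  gcongr
  · rw [Real.enorm_eq_ofReal (by positivity), ENNReal.ofReal_inv_of_pos (measureReal_cube_pos k m),
      measureReal_def, ENNReal.ofReal_toReal (volume_cube_ne_top k m)]
  · exact enorm_integral_le_lintegral_enorm _

omit [CompleteSpace E] in
lemma lintegral_enorm_condAvg_le (k : ℤ) (f : (Fin n → ℝ) → E) :
    ∫⁻ x, ‖condAvg k f x‖ₑ ≤ ∫⁻ x, ‖f x‖ₑ := by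
  rw [lintegral_eq_tsum_cube k, lintegral_eq_tsum_cube k (fun x => ‖f x‖ₑ)]
  refine ENNReal.tsum_le_tsum fun m => ?_
  rw [setLIntegral_congr_fun (g := fun _ => ‖⨍ y in cube k m, f y‖ₑ) (measurableSet_cube k m)
    (fun x hx => by simp only [condAvg, mem_cube_iff.1 hx]), setLIntegral_const]
  refine (mul_le_mul_left (enorm_setAverage_cube_le k m f) _).trans (le_of_eq ?_)
  rw [mul_right_comm, ENNReal.inv_mul_cancel (volume_cube_ne_zero k m) (volume_cube_ne_top k m),
    one_mul]

/-- The averages over large cubes of a square integrable function tend to zero in `L₂`: for an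
integrable function `‖E_k g‖₂² ≤ ‖E_k g‖_∞ ‖E_k g‖₁ ≤ 2^{kn} ‖g‖₁²`. -/
lemma tendsto_condAvg_neg (hn : 0 < n) {f : (Fin n → ℝ) → E} (hf : MemLp f 2) (c : ℤ) :
    Filter.Tendsto (fun j : ℕ => eLpNorm (condAvg (c - j) f) 2 volume) Filter.atTop (nhds 0) := by
  refine ENNReal.tendsto_atTop_zero.2 fun ε hε => ?_
  have hε2 : ε / 2 ≠ 0 := (ENNReal.half_pos hε.ne').ne'
  obtain ⟨g, hgc, hfg, hgcont, hg⟩ := hf.exists_hasCompactSupport_eLpNorm_sub_le (by norm_num) hε2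
  have hg1 : ∫⁻ x, ‖g x‖ₑ ≠ ∞ := (hgcont.integrable_of_hasCompactSupport hgc).2.ne
  set B := ∫⁻ x, ‖g x‖ₑ with hB
  have key : ∀ k : ℤ, eLpNorm (condAvg k g) 2 volume ^ 2
      ≤ (ENNReal.ofReal (2 ^ (-k)) ^ n)⁻¹ * B ^ 2 := by
    intro k
    rw [eLpNorm_two_sq]
    have hp : ∀ x, ‖condAvg k g x‖ₑ ≤ (ENNReal.ofReal (2 ^ (-k)) ^ n)⁻¹ * B := fun x => by
      refine (enorm_setAverage_cube_le k (cubeIndex k x) g).trans ?_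
      rw [volume_cube]
      gcongr
      exact setLIntegral_le_lintegral _ _
    calc ∫⁻ x, ‖condAvg k g x‖ₑ ^ 2
        ≤ ∫⁻ x, ((ENNReal.ofReal (2 ^ (-k)) ^ n)⁻¹ * B) * ‖condAvg k g x‖ₑ := by
          refine lintegral_mono fun x => ?_
          simp only [sq]
          gcongr
          exact hp x
      _ = ((ENNReal.ofReal (2 ^ (-k)) ^ n)⁻¹ * B) * ∫⁻ x, ‖condAvg k g x‖ₑ :=
          lintegral_const_mul _ (stronglyMeasurable_condAvg k g).enorm
      _ ≤ ((ENNReal.ofReal (2 ^ (-k)) ^ n)⁻¹ * B) * B := by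
          gcongr
          exact lintegral_enorm_condAvg_le k g
      _ = _ := by ring
  have hlim : Filter.Tendsto (fun j : ℕ => (ENNReal.ofReal (2 ^ (-(c - j : ℤ))) ^ n)⁻¹ * B ^ 2)
      Filter.atTop (nhds 0) := by
    have h1 : Filter.Tendsto (fun j : ℕ => (2 : ℝ) ^ (-(c - j : ℤ))) Filter.atTop
        Filter.atTop := by
      have : (fun j : ℕ => (2 : ℝ) ^ (-(c - j : ℤ))) = fun j : ℕ => (2 : ℝ) ^ (-c) * 2 ^ j := by
        funext j
        rw [neg_sub, sub_eq_add_neg, zpow_add₀ two_ne_zero, mul_comm, zpow_natCast]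
      rw [this]
      exact (tendsto_pow_atTop_atTop_of_one_lt one_lt_two).const_mul_atTop (by positivity)
    have h2 : Filter.Tendsto (fun j : ℕ => (ENNReal.ofReal (2 ^ (-(c - j : ℤ))) ^ n)⁻¹)
        Filter.atTop (nhds 0) := by
      rw [← ENNReal.inv_top]
      refine Filter.Tendsto.inv ?_
      simp only [← ENNReal.ofReal_pow (zpow_nonneg (zero_le_two (α := ℝ)) _)]
      exact ENNReal.tendsto_ofReal_atTop.comp ((Filter.tendsto_pow_atTop hn.ne').comp h1)
    have h3 := ENNReal.Tendsto.mul_const (b := B ^ 2) h2 (Or.inr (ENNReal.pow_ne_top hg1))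
    rwa [zero_mul] at h3
  obtain ⟨J, hJ⟩ := ENNReal.tendsto_atTop_zero.1 hlim ((ε / 2) ^ 2)
    (by have := ENNReal.half_pos hε.ne'; positivity)
  refine ⟨J, fun j hj => ?_⟩
  have e : condAvg (c - j) f = condAvg (c - j) (f - g) + condAvg (c - j) g := by
    rw [← condAvg_add _ (hf.sub hg) hg, sub_add_cancel]
  rw [e]
  refine (eLpNorm_add_le (stronglyMeasurable_condAvg _ _).aestronglyMeasurable
    (stronglyMeasurable_condAvg _ _).aestronglyMeasurable (by norm_num)).trans ?_
  rw [← ENNReal.add_halves ε]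
  gcongr
  · exact (eLpNorm_condAvg_le _ (hf.sub hg)).trans hfg
  · exact (ENNReal.pow_le_pow_left_iff two_ne_zero).1 ((key _).trans (hJ j hj))

/-- The averages over small cubes of a square integrable function tend to it in `L₂`. -/
lemma tendsto_condAvg {f : (Fin n → ℝ) → E} (hf : MemLp f 2) (c : ℤ) :
    Filter.Tendsto (fun j : ℕ => eLpNorm (condAvg (c + j) f - f) 2 volume) Filter.atTop
      (nhds 0) := by
  refine ENNReal.tendsto_atTop_zero.2 fun ε hε => ?_
  have hε3 : ε / 3 ≠ 0 := (ENNReal.div_pos hε.ne' (by norm_num)).ne'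
  obtain ⟨g, hgc, hfg, hgcont, hg⟩ := hf.exists_hasCompactSupport_eLpNorm_sub_le (by norm_num) hε3
  have huc : UniformContinuous g := hgc.uniformContinuous_of_continuous hgcont
  set S := Metric.cthickening 1 (tsupport g) with hS
  have hSc : IsCompact S := hgc.isCompact.cthickening
  have hSv : volume S ≠ ∞ := hSc.measure_lt_top.ne
  obtain ⟨ω, hω0, hω⟩ : ∃ ω : ℝ, 0 < ω ∧ ENNReal.ofReal ω ^ 2 * volume S ≤ (ε / 3) ^ 2 := by
    have h1 : Filter.Tendsto (fun ω : ℝ => ENNReal.ofReal ω ^ 2 * volume S) (nhds 0) (nhds 0) := by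
      have := ENNReal.Tendsto.mul_const (b := volume S)
        (((ENNReal.continuous_pow 2).comp ENNReal.continuous_ofReal).tendsto 0) (Or.inr hSv)
      simpa using this
    have h2 := (h1.mono_left (nhdsWithin_le_nhds (s := Set.Ioi 0))).eventually
      (Iic_mem_nhds (show (0 : ℝ≥0∞) < (ε / 3) ^ 2 from pos_iff_ne_zero.2 (pow_ne_zero 2 hε3)))
    obtain ⟨ω, h3, h4⟩ := (h2.and self_mem_nhdsWithin).exists
    exact ⟨ω, h4, h3⟩
  obtain ⟨δ, hδ0, hδ⟩ := Metric.uniformContinuous_iff.1 huc ω hω0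
  have h2 : Filter.Tendsto (fun j : ℕ => (2 : ℝ) ^ (-(c + j : ℤ))) Filter.atTop (nhds 0) := by
    have : (fun j : ℕ => (2 : ℝ) ^ (-(c + j : ℤ))) = fun j : ℕ => (2 : ℝ) ^ (-c) * (1 / 2) ^ j := by
      funext j
      rw [neg_add, zpow_add₀ two_ne_zero, zpow_neg 2 (j : ℤ), zpow_natCast, one_div, inv_pow]
    rw [this]
    simpa using (tendsto_pow_atTop_nhds_zero_of_lt_one (by norm_num : (0 : ℝ) ≤ 1 / 2)
      (by norm_num)).const_mul ((2 : ℝ) ^ (-c))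
  obtain ⟨J, hJ⟩ := (h2.eventually (gt_mem_nhds (lt_min hδ0 one_pos))).exists_forall_of_atTop
  refine ⟨J, fun j hj => ?_⟩
  have hj2 := hJ j hj
  set k := c + (j : ℤ)
  have hgap : eLpNorm (condAvg k g - g) 2 volume ≤ ε / 3 := by
    refine (ENNReal.pow_le_pow_left_iff two_ne_zero).1 (le_trans ?_ hω)
    rw [eLpNorm_two_sq, ← lintegral_indicator_const hSc.measurableSet]
    refine lintegral_mono fun x => ?_
    by_cases hx : x ∈ S
    · rw [Set.indicator_of_mem hx]
      gcongr
      have hmem : condAvg k g x ∈ Metric.closedBall (g x) ω := by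
        refine (convex_closedBall (g x) ω).set_average_mem Metric.isClosed_closedBall
          (volume_cube_ne_zero _ _) (volume_cube_ne_top _ _) ?_ (integrableOn_cube hg _ _)
        refine (ae_restrict_iff' (measurableSet_cube _ _)).2 (Filter.Eventually.of_forall ?_)
        intro y hy
        refine (hδ ?_).le
        rw [dist_eq_norm]
        exact (norm_sub_le_of_cubeIndex_eq (mem_cube_iff.1 hy)).trans_lt
          (hj2.trans_le (min_le_left _ _))
      rw [← ofReal_norm]
      refine ENNReal.ofReal_le_ofReal ?_
      rw [Pi.sub_apply, ← dist_eq_norm]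
      exact Metric.mem_closedBall.1 hmem
    · have hz : ∀ y ∈ cube k (cubeIndex k x), g y = 0 := by
        intro y hy
        by_contra h0
        refine hx (Metric.mem_cthickening_of_dist_le x y 1 _ (subset_tsupport g h0) ?_)
        rw [dist_comm, dist_eq_norm]
        exact (norm_sub_le_of_cubeIndex_eq (mem_cube_iff.1 hy)).trans
          (hj2.trans_le (min_le_right _ _)).le
      have h0 : condAvg k g x = 0 := by
        rw [condAvg, setAverage_eq, setIntegral_congr_fun (measurableSet_cube _ _) hz]
        simp
      simp [h0, hz x (mem_cube_cubeIndex k x)]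
  have e : condAvg k f - f = condAvg k (f - g) + ((condAvg k g - g) + (g - f)) := by
    rw [condAvg_sub _ hf hg]
    abel
  rw [e, ← ENNReal.add_thirds ε, add_assoc]
  refine (eLpNorm_add_le (stronglyMeasurable_condAvg _ _).aestronglyMeasurable
    (((memLp_condAvg k hg).sub hg).add (hg.sub hf)).1 (by norm_num)).trans ?_
  gcongr
  · exact (eLpNorm_condAvg_le _ (hf.sub hg)).trans hfg
  · refine (eLpNorm_add_le ((memLp_condAvg k hg).sub hg).1 (hg.sub hf).1 (by norm_num)).trans ?_
    gcongr
    rw [eLpNorm_sub_comm]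
    exact hfg

/-- Completeness of the martingale differences in `L₂`. -/
lemma eLpNorm_sq_le_tsum_mdiff (hn : 0 < n) {f : (Fin n → ℝ) → E} (hf : MemLp f 2) :
    eLpNorm f 2 volume ^ 2 ≤ ∑' l : ℤ, eLpNorm (mdiff l f) 2 volume ^ 2 := by
  have h1 : ∀ j : ℕ, eLpNorm (condAvg (0 + j) f) 2 volume ^ 2
      ≤ eLpNorm (condAvg (0 - j) f) 2 volume ^ 2
        + ∑' l : ℤ, eLpNorm (mdiff l f) 2 volume ^ 2 := by
    intro j
    have h := eLpNorm_condAvg_sq_eq_sum f hf (0 - j) (2 * j)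
    have e : (0 - j : ℤ) + ((2 * j : ℕ) : ℤ) = 0 + j := by push_cast; ring
    rw [e] at h
    rw [h]
    gcongr
    have hinj : Function.Injective fun i : ℕ => (0 - j : ℤ) + i + 1 := fun a b hab => by
      simpa using hab
    calc _ = ∑ l ∈ (Finset.range (2 * j)).map ⟨_, hinj⟩, eLpNorm (mdiff l f) 2 volume ^ 2 := by
          rw [Finset.sum_map]
          rfl
      _ ≤ _ := ENNReal.sum_le_tsum _
  have h2 : Filter.Tendsto (fun j : ℕ => eLpNorm (condAvg (0 + j) f) 2 volume
      + eLpNorm (condAvg (0 + j) f - f) 2 volume) Filter.atTop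
      (nhds (eLpNorm f 2 volume)) := by
    have ht := tendsto_condAvg hf 0
    refine tendsto_of_tendsto_of_tendsto_of_le_of_le tendsto_const_nhds
      (h := fun j : ℕ => eLpNorm f 2 volume + eLpNorm (condAvg (0 + j) f - f) 2 volume)
      (by simpa using ht.const_add (eLpNorm f 2 volume)) (fun j => ?_) (fun j => ?_)
    · have : f = condAvg (0 + j) f - (condAvg (0 + j) f - f) := by abel
      conv_lhs => rw [this]
      exact eLpNorm_sub_le (memLp_condAvg _ hf).1 ((memLp_condAvg _ hf).sub hf).1 (by norm_num)
    · dsimp only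
      gcongr
      exact eLpNorm_condAvg_le _ hf
  have h3 : Filter.Tendsto (fun j : ℕ => eLpNorm (condAvg (0 + j) f) 2 volume) Filter.atTop
      (nhds (eLpNorm f 2 volume)) := by
    have ht := tendsto_condAvg hf 0
    have := ENNReal.Tendsto.sub h2 ht (Or.inl hf.2.ne)
    rw [tsub_zero] at this
    refine this.congr fun j => ENNReal.add_sub_cancel_right ?_
    exact ((memLp_condAvg _ hf).sub hf).2.ne
  have h4 := ((ENNReal.continuous_pow 2).tendsto _).comp (tendsto_condAvg_neg hn hf 0)
  have h5 := h4.add_const (∑' l : ℤ, eLpNorm (mdiff l f) 2 volume ^ 2)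
  simp only [zero_pow two_ne_zero, zero_add] at h5
  exact le_of_tendsto_of_tendsto' (((ENNReal.continuous_pow 2).tendsto _).comp h3)
    (by simpa using h5) (fun j => by simpa using h1 j)

end Convergence

/-! ### Schur estimates -/

section Schur

/-- The Cauchy-Schwarz inequality for a weight. -/
lemma lintegral_mul_sq_le {α : Type*} [MeasurableSpace α] {μ : Measure α} {w φ : α → ℝ≥0∞}
    (hw : AEMeasurable w μ) (hφ : AEMeasurable φ μ) :
    (∫⁻ x, w x * φ x ∂μ) ^ 2 ≤ (∫⁻ x, w x ∂μ) * ∫⁻ x, w x * φ x ^ 2 ∂μ := by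
  have h := ENNReal.lintegral_mul_le_Lp_mul_Lq μ (p := 2) (q := 2)
    Real.HolderConjugate.two_two (f := fun x => w x ^ (1 / 2 : ℝ))
    (g := fun x => w x ^ (1 / 2 : ℝ) * φ x) (hw.pow_const _) ((hw.pow_const _).mul hφ)
  have e : ∀ a : ℝ≥0∞, a ^ (1 / 2 : ℝ) * a ^ (1 / 2 : ℝ) = a := fun a => by
    rw [← ENNReal.rpow_add_of_nonneg _ _ (by norm_num) (by norm_num)]
    norm_num
  have e2 : ∀ a : ℝ≥0∞, (a ^ (1 / 2 : ℝ)) ^ (2 : ℝ) = a := fun a => by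
    rw [← ENNReal.rpow_mul]
    norm_num
  have e3 : ∀ a : ℝ≥0∞, (a ^ (1 / 2 : ℝ)) ^ (2 : ℕ) = a := fun a => by
    rw [← ENNReal.rpow_natCast]
    exact e2 a
  simp only [Pi.mul_apply, ← mul_assoc, e, e2, ENNReal.mul_rpow_of_nonneg _ _ zero_le_two,
    ENNReal.rpow_two] at h
  refine (pow_le_pow_left' h 2).trans (le_of_eq ?_)
  rw [mul_pow, e3, e3]

/-- Schur's test for a convolution on the integers. -/
lemma tsum_sum_mul_sq_le (ε : ℤ → ℝ≥0∞) (S : Finset ℤ) (c : ℤ → ℝ≥0∞) :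
    ∑' l : ℤ, (∑ k ∈ S, ε (l - k) * c k) ^ 2 ≤ (∑' j, ε j) ^ 2 * ∑ k ∈ S, c k ^ 2 := by
  have h1 : ∀ l : ℤ, (∑ k ∈ S, ε (l - k) * c k) ^ 2
      ≤ (∑' j, ε j) * ∑ k ∈ S, ε (l - k) * c k ^ 2 := by
    intro l
    have h := lintegral_mul_sq_le (μ := Measure.count.restrict (S : Set ℤ))
      (w := fun k => ε (l - k)) (φ := c) (Measurable.of_discrete).aemeasurable
      (Measurable.of_discrete).aemeasurable
    have e : ∀ f : ℤ → ℝ≥0∞, ∫⁻ x in (S : Set ℤ), f x ∂Measure.count = ∑ k ∈ S, f k := by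
      intro f
      rw [lintegral_finset]
      simp
    simp only [e] at h
    refine h.trans ?_
    gcongr
    calc ∑ k ∈ S, ε (l - k) ≤ ∑' k, ε (l - k) := ENNReal.sum_le_tsum _
      _ = ∑' j, ε j := (Equiv.subLeft l).tsum_eq ε
  calc ∑' l : ℤ, (∑ k ∈ S, ε (l - k) * c k) ^ 2
      ≤ ∑' l : ℤ, (∑' j, ε j) * ∑ k ∈ S, ε (l - k) * c k ^ 2 := ENNReal.tsum_le_tsum h1
    _ = (∑' j, ε j) * ∑ k ∈ S, ∑' l : ℤ, ε (l - k) * c k ^ 2 := by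
        rw [ENNReal.tsum_mul_left, Summable.tsum_finsetSum fun _ _ => ENNReal.summable]
    _ = (∑' j, ε j) * ∑ k ∈ S, (∑' j, ε j) * c k ^ 2 := by
        congr 1
        refine Finset.sum_congr rfl fun k _ => ?_
        rw [ENNReal.tsum_mul_right]
        congr 1
        exact (Equiv.subRight k).tsum_eq ε
    _ = _ := by rw [← Finset.mul_sum]; ring

end Schur

/-! ### The majorizing kernel -/

section Kernel

variable {n : ℕ}

/-- The `L₁`-normalized kernel `h^γ / (h + |u|)^{n+γ}` at scale `h`. -/
noncomputable def ker (γ h : ℝ) (u : Fin n → ℝ) : ℝ≥0∞ :=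
  ENNReal.ofReal (h ^ γ / (h + ‖u‖) ^ ((n : ℝ) + γ))

variable (n) in
/-- The integral of `(1 + |u|)^{-n-γ}` over `ℝⁿ`. -/
noncomputable def tail (γ : ℝ) : ℝ≥0∞ := ∫⁻ u : Fin n → ℝ, ker γ 1 u

lemma tail_ne_top {γ : ℝ} (hγ : 0 < γ) : tail n γ ≠ ∞ := by
  have h : Integrable (fun u : Fin n → ℝ => (1 + ‖u‖) ^ (-((n : ℝ) + γ))) :=
    integrable_one_add_norm (by simpa using hγ)
  have h2 := h.lintegral_lt_top
  refine (lt_of_le_of_lt (lintegral_mono fun u => ?_) h2).ne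
  rw [ker, Real.one_rpow, one_div, Real.rpow_neg (by positivity)]

lemma measurable_ker (γ h : ℝ) : Measurable (ker (n := n) γ h) := by
  unfold ker
  fun_prop

lemma ker_sub_comm (γ h : ℝ) (x y : Fin n → ℝ) : ker γ h (x - y) = ker γ h (y - x) := by
  rw [ker, ker, norm_sub_rev]

lemma ker_eq_smul (γ : ℝ) {h : ℝ} (hh : 0 < h) (u : Fin n → ℝ) :
    ker γ h u = ENNReal.ofReal (h⁻¹ ^ n) * ker γ 1 (h⁻¹ • u) := by
  rw [ker, ker, ← ENNReal.ofReal_mul (by positivity)]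
  congr 1
  have h1 : 1 + ‖h⁻¹ • u‖ = h⁻¹ * (h + ‖u‖) := by
    rw [norm_smul, Real.norm_of_nonneg (by positivity), mul_add, inv_mul_cancel₀ hh.ne']
  have h2 : 0 < h + ‖u‖ := by positivity
  rw [h1, Real.mul_rpow (by positivity) h2.le, Real.one_rpow,
    Real.rpow_add (by positivity : 0 < h⁻¹), Real.rpow_natCast, Real.inv_rpow hh.le]
  field_simp

lemma lintegral_ker (γ : ℝ) {h : ℝ} (hh : 0 < h) :
    ∫⁻ u : Fin n → ℝ, ker γ h u = tail n γ := by
  simp only [ker_eq_smul γ hh]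
  have hms : Measurable fun u : Fin n → ℝ => ker γ 1 (h⁻¹ • u) :=
    (measurable_ker γ 1).comp (measurable_const_smul _)
  rw [lintegral_const_mul _ hms]
  have e : ∫⁻ u : Fin n → ℝ, ker γ 1 (h⁻¹ • u)
      = ∫⁻ u, ker γ 1 u ∂(Measure.map (h⁻¹ • · : (Fin n → ℝ) → Fin n → ℝ) volume) :=
    (lintegral_map (measurable_ker γ 1) (measurable_const_smul _)).symm
  rw [e, Measure.map_addHaar_smul _ (inv_ne_zero hh.ne'), lintegral_smul_measure, ← tail,
    smul_eq_mul, ← mul_assoc, ← ENNReal.ofReal_mul (by positivity), Module.finrank_fin_fun,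
    abs_of_pos (by positivity), mul_inv_cancel₀ (by positivity), ENNReal.ofReal_one, one_mul]

lemma lintegral_ker_sub (γ : ℝ) {h : ℝ} (hh : 0 < h) (x : Fin n → ℝ) :
    ∫⁻ y, ker γ h (x - y) = tail n γ := by
  rw [lintegral_sub_left_eq_self (ker γ h) x, lintegral_ker γ hh]

lemma lintegral_ker_sub' (γ : ℝ) {h : ℝ} (hh : 0 < h) (y : Fin n → ℝ) :
    ∫⁻ x, ker γ h (x - y) = tail n γ := by
  rw [lintegral_sub_right_eq_self (ker γ h) y, lintegral_ker γ hh]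

lemma ker_le {γ h : ℝ} (hγ : 0 < γ) (hh : 0 < h) (u : Fin n → ℝ) :
    ker γ h u ≤ ENNReal.ofReal (h ^ γ / h ^ ((n : ℝ) + γ)) := by
  unfold ker
  gcongr
  simp

lemma measurable_ker_sub (γ h : ℝ) :
    Measurable fun p : (Fin n → ℝ) × (Fin n → ℝ) => ker γ h (p.1 - p.2) :=
  (measurable_ker γ h).comp (measurable_fst.sub measurable_snd)

/-- The convolution of `ker` with a square integrable function, pointwise. -/
lemma lintegral_ker_mul_sq_le (γ : ℝ) {h : ℝ} (hh : 0 < h) {φ : (Fin n → ℝ) → ℝ≥0∞}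
    (hφ : Measurable φ) (x : Fin n → ℝ) :
    (∫⁻ y, ker γ h (x - y) * φ y) ^ 2 ≤ tail n γ * ∫⁻ y, ker γ h (x - y) * φ y ^ 2 := by
  refine (lintegral_mul_sq_le ?_ hφ.aemeasurable).trans_eq ?_
  · exact ((measurable_ker γ h).comp (measurable_const.sub measurable_id)).aemeasurable
  · rw [lintegral_ker_sub γ hh]

lemma lintegral_ker_mul_lt_top {γ : ℝ} (hγ : 0 < γ) {h : ℝ} (hh : 0 < h)
    {φ : (Fin n → ℝ) → ℝ≥0∞} (hφ : Measurable φ) (hφ2 : ∫⁻ y, φ y ^ 2 < ∞) (x : Fin n → ℝ) :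
    ∫⁻ y, ker γ h (x - y) * φ y < ∞ := by
  have h1 := lintegral_ker_mul_sq_le γ hh hφ x
  have h2 : ∫⁻ y, ker γ h (x - y) * φ y ^ 2
      ≤ ENNReal.ofReal (h ^ γ / h ^ ((n : ℝ) + γ)) * ∫⁻ y, φ y ^ 2 := by
    rw [← lintegral_const_mul _ (hφ.pow_const 2)]
    exact lintegral_mono fun y => mul_le_mul_left (ker_le hγ hh _) _
  have h3 : (∫⁻ y, ker γ h (x - y) * φ y) ^ 2 < ∞ :=
    h1.trans_lt (ENNReal.mul_lt_top (tail_ne_top hγ).lt_top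
      (h2.trans_lt (ENNReal.mul_lt_top ENNReal.ofReal_lt_top hφ2)))
  by_contra h4
  rw [not_lt, top_le_iff] at h4
  rw [h4] at h3
  simp at h3

lemma lintegral_lintegral_ker_mul (γ : ℝ) {h : ℝ} (hh : 0 < h) {ψ : (Fin n → ℝ) → ℝ≥0∞}
    (hψ : Measurable ψ) :
    ∫⁻ x, ∫⁻ y, ker γ h (x - y) * ψ y = tail n γ * ∫⁻ y, ψ y := by
  rw [lintegral_lintegral_swap ((measurable_ker_sub γ h).mul
    (hψ.comp measurable_snd)).aemeasurable, ← lintegral_const_mul _ hψ]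
  refine lintegral_congr fun y => ?_
  have hms : Measurable fun x : Fin n → ℝ => ker γ h (x - y) :=
    (measurable_ker γ h).comp (measurable_id.sub measurable_const)
  rw [lintegral_mul_const _ hms, lintegral_ker_sub' γ hh]

/-- Young's inequality for the convolution with `ker`. -/
lemma lintegral_sq_lintegral_ker_mul_le (γ : ℝ) {h : ℝ} (hh : 0 < h)
    {φ : (Fin n → ℝ) → ℝ≥0∞} (hφ : Measurable φ) :
    ∫⁻ x, (∫⁻ y, ker γ h (x - y) * φ y) ^ 2 ≤ tail n γ ^ 2 * ∫⁻ y, φ y ^ 2 := by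
  refine (lintegral_mono fun x => lintegral_ker_mul_sq_le γ hh hφ x).trans ?_
  rw [lintegral_const_mul _ ?_, lintegral_lintegral_ker_mul γ hh (hφ.pow_const 2), ← mul_assoc, sq]
  exact ((measurable_ker_sub γ h).mul ((hφ.pow_const 2).comp measurable_snd)).lintegral_prod_right'

/-- The part of a cube which a translation by `u` moves out of the cube. -/
lemma volume_cube_translate_le (l : ℤ) (m : Fin n → ℤ) (u : Fin n → ℝ) :
    volume {y | y ∈ cube l m ∧ y + u ∉ cube l m}
      ≤ ENNReal.ofReal (min 1 (n * (‖u‖ / 2 ^ (-l)))) * volume (cube l m) := by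
  have hL : (0 : ℝ) < 2 ^ (-l) := by positivity
  rcases le_total 1 (n * (‖u‖ / 2 ^ (-l))) with h | h
  · rw [min_eq_left h, ENNReal.ofReal_one, one_mul]
    exact measure_mono fun y hy => hy.1
  rw [min_eq_right h]
  set L : ℝ := 2 ^ (-l) with hLdef
  let a : Fin n → ℝ := fun i => L * m i
  -- The set is covered by `n` slabs of width at most `|u|`.
  let s : Fin n → Set (Fin n → ℝ) := fun i => Set.univ.pi fun j =>
    if j = i then Set.Ico (a j) (a j + L) \ Set.Ico (a j - u j) (a j + L - u j)
    else Set.Ico (a j) (a j + L)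
  have hsub : {y | y ∈ cube l m ∧ y + u ∉ cube l m} ⊆ ⋃ i, s i := by
    rintro y ⟨hy, hyu⟩
    have hy' : ∀ j, y j ∈ Set.Ico (a j) (a j + L) := fun j => by
      have := hy j
      refine ⟨this.1, ?_⟩
      have h2 := this.2
      rw [mul_add, mul_one] at h2
      exact h2
    have : ∃ i, ¬ (L * m i ≤ y i + u i ∧ y i + u i < L * (m i + 1)) := by
      by_contra hc
      push Not at hc
      exact hyu hc
    obtain ⟨i, hi⟩ := this
    refine Set.mem_iUnion.2 ⟨i, fun j _ => ?_⟩
    by_cases hj : j = i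
    · subst hj
      dsimp only
      rw [if_pos rfl]
      refine ⟨hy' j, fun hc => hi ⟨?_, ?_⟩⟩
      · linarith [hc.1]
      · rw [mul_add, mul_one]
        linarith [hc.2]
    · dsimp only
      rw [if_neg hj]
      exact hy' j
  have hs : ∀ i, volume (s i) ≤ ENNReal.ofReal (‖u‖ / L) * volume (cube l m) := by
    intro i
    have hi : volume (Set.Ico (a i) (a i + L) \ Set.Ico (a i - u i) (a i + L - u i))
        ≤ ENNReal.ofReal ‖u‖ := by
      have hui : |u i| ≤ ‖u‖ := norm_le_pi_norm u i
      rcases le_total 0 (u i) with h0 | h0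
      · calc _ ≤ volume (Set.Ico (a i + L - u i) (a i + L)) := by
              refine measure_mono fun t ht => ⟨?_, ht.1.2⟩
              by_contra hc
              exact ht.2 ⟨by linarith [ht.1.1], by linarith⟩
          _ ≤ _ := by
              rw [Real.volume_Ico]
              refine ENNReal.ofReal_le_ofReal ?_
              linarith [le_abs_self (u i)]
      · calc _ ≤ volume (Set.Ico (a i) (a i - u i)) := by
              refine measure_mono fun t ht => ⟨ht.1.1, ?_⟩
              by_contra hc
              exact ht.2 ⟨by linarith, by linarith [ht.1.2]⟩
          _ ≤ _ := by
              rw [Real.volume_Ico]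
              refine ENNReal.ofReal_le_ofReal ?_
              linarith [neg_abs_le (u i)]
    rw [volume_pi_pi, ← Finset.mul_prod_erase _ _ (Finset.mem_univ i), if_pos rfl,
      Finset.prod_congr rfl (g := fun _ => ENNReal.ofReal L), Finset.prod_const,
      Finset.card_erase_of_mem (Finset.mem_univ i), Finset.card_univ, Fintype.card_fin,
      volume_cube]
    · refine (mul_le_mul_left hi _).trans (le_of_eq ?_)
      have hn : 0 < n := i.pos
      have hpow : (ENNReal.ofReal L) ^ n = ENNReal.ofReal L * ENNReal.ofReal L ^ (n - 1) := by
        rw [← pow_succ', Nat.sub_add_cancel hn]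
      rw [hpow, ← mul_assoc, ← ENNReal.ofReal_mul (by positivity), div_mul_cancel₀ _ hL.ne']
    · intro j hj
      rw [if_neg (Finset.ne_of_mem_erase hj), Real.volume_Ico]
      congr 1
      ring
  calc _ ≤ volume (⋃ i, s i) := measure_mono hsub
    _ ≤ ∑ i, volume (s i) := measure_iUnion_fintype_le _ _
    _ ≤ ∑ _i : Fin n, ENNReal.ofReal (‖u‖ / L) * volume (cube l m) :=
        Finset.sum_le_sum fun i _ => hs i
    _ = _ := by
        rw [Finset.sum_const, Finset.card_univ, Fintype.card_fin, nsmul_eq_mul, ← mul_assoc,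
          ENNReal.ofReal_mul (by positivity), ENNReal.ofReal_natCast]

lemma ker_mul_min_le {γ : ℝ} (hγ : 0 < γ) (hγ1 : γ ≤ 1) {h L : ℝ} (hh : 0 < h) (hL : 0 < L)
    (hn : 0 < n) (u : Fin n → ℝ) :
    ker γ h u * ENNReal.ofReal (min 1 (n * (‖u‖ / L)))
      ≤ ENNReal.ofReal (n * (h / L) ^ (γ / 2)) * ker (γ / 2) h u := by
  rw [ker, ker, ← ENNReal.ofReal_mul (by positivity), ← ENNReal.ofReal_mul (by positivity)]
  refine ENNReal.ofReal_le_ofReal ?_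
  have hp : 0 < h + ‖u‖ := by positivity
  have hn1 : (1 : ℝ) ≤ n := by exact_mod_cast hn
  set t := (h + ‖u‖) / L with ht
  have ht0 : 0 < t := by positivity
  have hmin : min 1 (n * (‖u‖ / L)) ≤ n * t ^ (γ / 2) := by
    have hle : ‖u‖ / L ≤ t := by
      rw [ht]
      gcongr
      linarith
    rcases le_total t 1 with h1 | h1
    · refine (min_le_right _ _).trans ?_
      gcongr
      refine hle.trans ?_
      calc t = t ^ (1 : ℝ) := (Real.rpow_one t).symm
        _ ≤ t ^ (γ / 2) := Real.rpow_le_rpow_of_exponent_ge ht0 h1 (by linarith)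
    · refine (min_le_left _ _).trans ?_
      have := Real.one_le_rpow h1 (by positivity : 0 ≤ γ / 2)
      nlinarith
  calc _ ≤ h ^ γ / (h + ‖u‖) ^ ((n : ℝ) + γ) * (n * t ^ (γ / 2)) := by gcongr
    _ = _ := by
      rw [ht, Real.div_rpow hp.le hL.le, Real.div_rpow hh.le hL.le]
      have e1 : (n : ℝ) + γ = (n + γ / 2) + γ / 2 := by ring
      have e2 : h ^ γ = h ^ (γ / 2) * h ^ (γ / 2) := by
        rw [← Real.rpow_add hh]; congr 1; ring
      rw [e1, Real.rpow_add hp, e2]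
      have : (h + ‖u‖) ^ (γ / 2) ≠ 0 := (Real.rpow_pos_of_pos hp _).ne'
      field_simp

/-- The interaction of a cube with its complement through the kernel `ker` at a finer scale `h` is
small: a translation by `u` moves only a small part of the cube out of it. -/
lemma lintegral_cube_compl_ker_le {γ : ℝ} (hγ : 0 < γ) (hγ1 : γ ≤ 1) {h : ℝ} (hh : 0 < h)
    (hn : 0 < n) (l : ℤ) (m : Fin n → ℤ) :
    ∫⁻ y in cube l m, ∫⁻ z in (cube l m)ᶜ, ker γ h (z - y)
      ≤ ENNReal.ofReal (n * (h / 2 ^ (-l)) ^ (γ / 2)) * tail n (γ / 2) * volume (cube l m) := by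
  have hQ := measurableSet_cube l m
  have e1 : ∀ y, ∫⁻ z in (cube l m)ᶜ, ker γ h (z - y)
      = ∫⁻ u, ker γ h u * (cube l m)ᶜ.indicator 1 (y + u) := by
    intro y
    rw [← lintegral_indicator hQ.compl, ← lintegral_add_left_eq_self _ y]
    refine lintegral_congr fun u => ?_
    by_cases hu : y + u ∈ (cube l m)ᶜ <;> simp [hu]
  simp only [e1]
  rw [lintegral_lintegral_swap]
  · calc _ = ∫⁻ u : Fin n → ℝ, ker γ h u * volume {y | y ∈ cube l m ∧ y + u ∉ cube l m} := by
          refine lintegral_congr fun u => ?_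
          have hm : Measurable fun y : Fin n → ℝ =>
              (cube l m)ᶜ.indicator (1 : (Fin n → ℝ) → ℝ≥0∞) (y + u) :=
            (measurable_one.indicator hQ.compl).comp (measurable_add_const u)
          rw [lintegral_const_mul _ hm]
          congr 1
          have e2 : (fun y : Fin n → ℝ => (cube l m)ᶜ.indicator (1 : (Fin n → ℝ) → ℝ≥0∞) (y + u))
              = {y | y + u ∉ cube l m}.indicator 1 := by
            funext y
            by_cases hy : y + u ∈ cube l m <;> simp [hy]
          have hms : MeasurableSet {y : Fin n → ℝ | y + u ∉ cube l m} :=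
            (measurable_add_const u) hQ.compl
          rw [e2, lintegral_indicator_one hms, Measure.restrict_apply hms]
          congr 1
          ext y
          exact and_comm
      _ ≤ ∫⁻ u : Fin n → ℝ, (ENNReal.ofReal (n * (h / 2 ^ (-l)) ^ (γ / 2)) *
            volume (cube l m)) * ker (γ / 2) h u := by
          refine lintegral_mono fun u => ?_
          refine (mul_le_mul_right (volume_cube_translate_le l m u) _).trans ?_
          rw [← mul_assoc, mul_right_comm _ (volume _)]
          refine mul_le_mul_left ?_ _
          exact ker_mul_min_le hγ hγ1 hh (by positivity) hn u
      _ = _ := by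
          rw [lintegral_const_mul _ (measurable_ker _ _), lintegral_ker _ hh]
          ring
  · refine (Measurable.mul ((measurable_ker γ h).comp measurable_snd) ?_).aemeasurable
    exact (measurable_one.indicator hQ.compl).comp (measurable_fst.add measurable_snd)

lemma lintegral_compl_cube_ker_le {γ : ℝ} (hγ : 0 < γ) (hγ1 : γ ≤ 1) {h : ℝ} (hh : 0 < h)
    (hn : 0 < n) (l : ℤ) (m : Fin n → ℤ) :
    ∫⁻ y in (cube l m)ᶜ, ∫⁻ z in cube l m, ker γ h (z - y)
      ≤ ENNReal.ofReal (n * (h / 2 ^ (-l)) ^ (γ / 2)) * tail n (γ / 2) * volume (cube l m) := by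
  have hm : Measurable fun p : (Fin n → ℝ) × (Fin n → ℝ) => ker γ h (p.2 - p.1) :=
    (measurable_ker γ h).comp (measurable_snd.sub measurable_fst)
  rw [lintegral_lintegral_swap (f := fun y z => ker γ h (z - y)) hm.aemeasurable]
  refine le_trans (le_of_eq ?_) (lintegral_cube_compl_ker_le hγ hγ1 hh hn l m)
  refine lintegral_congr fun y => lintegral_congr fun z => ker_sub_comm _ _ _ _

end Kernel

/-! ### Almost orthogonality -/

section LittlewoodPaley

variable {n : ℕ} {E : Type*} [NormedAddCommGroup E] [InnerProductSpace ℝ E]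

/-- `G x y = κ(x, y) g(y)` for an operator valued kernel `κ` of size `a` at the scale `2^{-k}`, which
is smooth in `x` below this scale: on cubes of edge length `2^{-k-j}`, its oscillation is smaller than
its size by a factor `2^{-γ(j+1)/4}`. -/
structure IsScaleKernel (γ : ℝ) (a : ℝ≥0∞) (k : ℤ) (g : (Fin n → ℝ) → E)
    (G : (Fin n → ℝ) → (Fin n → ℝ) → E) : Prop where
  stronglyMeasurable : StronglyMeasurable (Function.uncurry G)
  stronglyMeasurable_right : StronglyMeasurable g
  memLp : MemLp g 2
  ne_top : a ≠ ∞
  size : ∀ x y, ‖G x y‖ₑ ≤ a * (ker γ (2 ^ (-k)) (x - y) * ‖g y‖ₑ)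
  smooth : ∀ (j : ℕ) (x z y), 2 ≤ j → cubeIndex (k + j) z = cubeIndex (k + j) x →
    ‖G z y - G x y‖ₑ ≤
      a * ENNReal.ofReal (2 ^ (-(γ / 4))) ^ (j + 1) * (ker γ (2 ^ (-k)) (x - y) * ‖g y‖ₑ)

namespace IsScaleKernel

variable {γ : ℝ} {a : ℝ≥0∞} {k : ℤ} {g : (Fin n → ℝ) → E} {G : (Fin n → ℝ) → (Fin n → ℝ) → E}

section

variable (h : IsScaleKernel γ a k g G)
include h

omit [InnerProductSpace ℝ E] in
lemma lintegral_sq : ∫⁻ y, ‖g y‖ₑ ^ 2 < ∞ := by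
  rw [← eLpNorm_two_sq]
  exact ENNReal.pow_lt_top h.memLp.2

omit [InnerProductSpace ℝ E] in
lemma measurable_enorm : Measurable fun y => ‖g y‖ₑ := h.stronglyMeasurable_right.enorm

omit [InnerProductSpace ℝ E] in
lemma integrable_right (hγ : 0 < γ) (x : Fin n → ℝ) : Integrable (G x) := by
  refine ⟨(h.stronglyMeasurable.of_uncurry_left (x := x)).aestronglyMeasurable, ?_⟩
  refine (lintegral_mono fun y => h.size x y).trans_lt ?_
  have h1 := lintegral_ker_mul_lt_top hγ (zpow_pos two_pos (-k)) h.measurable_enorm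
    h.lintegral_sq x
  rw [lintegral_const_mul' _ _ h.ne_top]
  exact ENNReal.mul_lt_top h.ne_top.lt_top h1

omit [InnerProductSpace ℝ E] in
lemma lintegral_enorm_left_le (y : Fin n → ℝ) :
    ∫⁻ x, ‖G x y‖ₑ ≤ a * tail n γ * ‖g y‖ₑ := by
  refine (lintegral_mono fun x => h.size x y).trans (le_of_eq ?_)
  have hm : Measurable fun x : Fin n → ℝ => ker γ (2 ^ (-k)) (x - y) :=
    (measurable_ker γ _).comp (measurable_id.sub measurable_const)
  rw [lintegral_const_mul' _ _ h.ne_top, lintegral_mul_const _ hm,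
    lintegral_ker_sub' γ (zpow_pos two_pos (-k)), mul_assoc]

lemma enorm_integral_left_le (y : Fin n → ℝ) :
    ‖∫ x, G x y‖ₑ ≤ a * tail n γ * ‖g y‖ₑ :=
  (enorm_integral_le_lintegral_enorm _).trans (h.lintegral_enorm_left_le y)

lemma eLpNorm_integral_left_le :
    eLpNorm (fun y => ∫ x, G x y) 2 volume ^ 2 ≤ (a * tail n γ) ^ 2 * eLpNorm g 2 volume ^ 2 := by
  rw [eLpNorm_two_sq, eLpNorm_two_sq, ← lintegral_const_mul _ (h.measurable_enorm.pow_const 2)]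
  refine lintegral_mono fun y => ?_
  rw [← mul_pow]
  exact pow_le_pow_left' (h.enorm_integral_left_le y) 2

lemma memLp_integral_left (hγ : 0 < γ) : MemLp (fun y => ∫ x, G x y) 2 := by
  refine ⟨?_, ?_⟩
  · exact (StronglyMeasurable.integral_prod_left (f := G)
      h.stronglyMeasurable).aestronglyMeasurable
  · have := h.eLpNorm_integral_left_le.trans_lt (ENNReal.mul_lt_top (ENNReal.pow_lt_top
      (ENNReal.mul_lt_top h.ne_top.lt_top (tail_ne_top hγ).lt_top)) (ENNReal.pow_lt_top h.memLp.2))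
    by_contra hc
    rw [not_lt, top_le_iff] at hc
    simp [hc] at this

lemma enorm_integral_right_le (x : Fin n → ℝ) :
    ‖∫ y, G x y‖ₑ ≤ a * ∫⁻ y, ker γ (2 ^ (-k)) (x - y) * ‖g y‖ₑ := by
  refine (enorm_integral_le_lintegral_enorm _).trans
    ((lintegral_mono fun y => h.size x y).trans (le_of_eq ?_))
  rw [lintegral_const_mul' _ _ h.ne_top]

lemma eLpNorm_integral_right_le :
    eLpNorm (fun x => ∫ y, G x y) 2 volume ^ 2
      ≤ (a * tail n γ) ^ 2 * eLpNorm g 2 volume ^ 2 := by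
  rw [eLpNorm_two_sq, eLpNorm_two_sq, mul_pow, mul_assoc]
  refine le_trans ?_ (mul_le_mul_right (lintegral_sq_lintegral_ker_mul_le γ
    (zpow_pos two_pos (-k)) h.measurable_enorm) _)
  rw [← lintegral_const_mul' _ _ (ENNReal.pow_ne_top h.ne_top)]
  refine lintegral_mono fun x => ?_
  rw [← mul_pow]
  exact pow_le_pow_left' (h.enorm_integral_right_le x) 2

lemma memLp_integral_right (hγ : 0 < γ) : MemLp (fun x => ∫ y, G x y) 2 := by
  refine ⟨?_, ?_⟩
  · exact (StronglyMeasurable.integral_prod_right (f := G)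
      h.stronglyMeasurable).aestronglyMeasurable
  · have := h.eLpNorm_integral_right_le.trans_lt (ENNReal.mul_lt_top (ENNReal.pow_lt_top
      (ENNReal.mul_lt_top h.ne_top.lt_top (tail_ne_top hγ).lt_top)) (ENNReal.pow_lt_top h.memLp.2))
    by_contra hc
    rw [not_lt, top_le_iff] at hc
    simp [hc] at this

variable [CompleteSpace E]

/-- The oscillation of `∫ G(·, y) dy` on cubes which are finer than the scale of the kernel. -/
lemma enorm_condAvg_sub_le (hγ : 0 < γ) {j : ℕ} (hj : 2 ≤ j) {l : ℤ} (hl : k + j ≤ l)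
    (x : Fin n → ℝ) :
    ‖condAvg l (fun x => ∫ y, G x y) x - ∫ y, G x y‖ₑ
      ≤ a * ENNReal.ofReal (2 ^ (-(γ / 4))) ^ (j + 1)
        * ∫⁻ y, ker γ (2 ^ (-k)) (x - y) * ‖g y‖ₑ := by
  have ha : a * ENNReal.ofReal (2 ^ (-(γ / 4))) ^ (j + 1) ≠ ∞ :=
    ENNReal.mul_ne_top h.ne_top (ENNReal.pow_ne_top ENNReal.ofReal_ne_top)
  set D := a * ENNReal.ofReal (2 ^ (-(γ / 4))) ^ (j + 1)
        * ∫⁻ y, ker γ (2 ^ (-k)) (x - y) * ‖g y‖ₑ with hD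
  have hDt : D ≠ ∞ := ENNReal.mul_ne_top ha (lintegral_ker_mul_lt_top hγ
    (zpow_pos two_pos (-k)) h.measurable_enorm h.lintegral_sq x).ne
  have hmem : condAvg l (fun x => ∫ y, G x y) x
      ∈ Metric.closedBall (∫ y, G x y) D.toReal := by
    refine (convex_closedBall _ _).set_average_mem Metric.isClosed_closedBall
      (volume_cube_ne_zero _ _) (volume_cube_ne_top _ _) ?_
      (integrableOn_cube (h.memLp_integral_right hγ) _ _)
    refine (ae_restrict_iff' (measurableSet_cube _ _)).2 (Filter.Eventually.of_forall ?_)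
    intro z hz
    have hzx : cubeIndex (k + j) z = cubeIndex (k + j) x :=
      cubeIndex_eq_of_le hl (mem_cube_iff.1 hz)
    rw [Metric.mem_closedBall, dist_eq_norm, ← toReal_enorm]
    refine ENNReal.toReal_mono hDt ?_
    rw [← integral_sub (h.integrable_right hγ z) (h.integrable_right hγ x)]
    refine (enorm_integral_le_lintegral_enorm _).trans
      ((lintegral_mono fun y => h.smooth j x z y hj hzx).trans (le_of_eq ?_))
    rw [lintegral_const_mul' _ _ ha]
  rw [Metric.mem_closedBall, dist_eq_norm] at hmem
  rw [← ofReal_norm]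
  exact ENNReal.ofReal_le_of_le_toReal hmem

lemma eLpNorm_mdiff_fine_le (hγ : 0 < γ) {j : ℕ} (hj : 2 ≤ j) :
    eLpNorm (mdiff (k + j + 1) fun x => ∫ y, G x y) 2 volume
      ≤ 2 * a * ENNReal.ofReal (2 ^ (-(γ / 4))) ^ (j + 1) * tail n γ * eLpNorm g 2 volume := by
  refine (ENNReal.pow_le_pow_left_iff two_ne_zero).1 ?_
  set r := ENNReal.ofReal (2 ^ (-(γ / 4))) with hr
  have hc : 2 * a * r ^ (j + 1) ≠ ∞ :=
    ENNReal.mul_ne_top (ENNReal.mul_ne_top (by norm_num) h.ne_top)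
      (ENNReal.pow_ne_top ENNReal.ofReal_ne_top)
  have hpt : ∀ x, ‖mdiff (k + j + 1) (fun x => ∫ y, G x y) x‖ₑ
      ≤ (2 * a * r ^ (j + 1)) * ∫⁻ y, ker γ (2 ^ (-k)) (x - y) * ‖g y‖ₑ := by
    intro x
    have h1 := h.enorm_condAvg_sub_le hγ hj (l := k + j + 1) (by lia) x
    have h2 := h.enorm_condAvg_sub_le hγ hj (l := k + j) le_rfl x
    rw [mdiff, add_sub_cancel_right, ← sub_sub_sub_cancel_right _ _ (∫ y, G x y)]
    refine enorm_sub_le.trans ((add_le_add h1 h2).trans (le_of_eq ?_))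
    ring
  rw [eLpNorm_two_sq, mul_assoc (2 * a * r ^ (j + 1)), mul_pow (2 * a * r ^ (j + 1)),
    mul_pow (tail n γ), eLpNorm_two_sq]
  refine le_trans ?_ (mul_le_mul_right (lintegral_sq_lintegral_ker_mul_le γ
    (zpow_pos two_pos (-k)) h.measurable_enorm) _)
  rw [← lintegral_const_mul' _ _ (ENNReal.pow_ne_top hc)]
  refine lintegral_mono fun x => ?_
  rw [← mul_pow]
  exact pow_le_pow_left' (hpt x) 2

omit [CompleteSpace E] in
/-- On a cube `Q`, the integrals of `∫ G(·, y) dy` and of `∫ G(z, ·) dz` differ by the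
interactions between `Q` and its complement. -/
lemma enorm_setIntegral_sub_le (hγ : 0 < γ) (l : ℤ) (m : Fin n → ℤ) :
    ‖(∫ z in cube l m, ∫ y, G z y) - ∫ y in cube l m, ∫ z, G z y‖ₑ
      ≤ (∫⁻ y in (cube l m)ᶜ, ∫⁻ z in cube l m, ‖G z y‖ₑ)
        + ∫⁻ y in cube l m, ∫⁻ z in (cube l m)ᶜ, ‖G z y‖ₑ := by
  set Q := cube l m with hQdef
  have hQ : MeasurableSet Q := measurableSet_cube l m
  set ν : Measure (Fin n → ℝ) := volume.restrict Q
  set ν' : Measure (Fin n → ℝ) := volume.restrict Qᶜ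
  have hsm := h.stronglyMeasurable
  have hfinleft : ∀ y, ∫⁻ x, ‖G x y‖ₑ < ∞ := fun y =>
    (h.lintegral_enorm_left_le y).trans_lt (ENNReal.mul_lt_top
      (ENNReal.mul_lt_top h.ne_top.lt_top (tail_ne_top hγ).lt_top) enorm_lt_top)
  have hintleft : ∀ y, Integrable (fun x => G x y) := fun y =>
    ⟨(hsm.comp_measurable measurable_prodMk_right).aestronglyMeasurable, hfinleft y⟩
  -- The double integral over `ℝⁿ × Q` is finite, and by Fubini so is the one over `Q × Q`.
  have hQX : ∫⁻ y in Q, ∫⁻ z, ‖G z y‖ₑ < ∞ := by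
    refine (lintegral_mono fun y => h.lintegral_enorm_left_le y).trans_lt ?_
    rw [lintegral_const_mul' _ _ (ENNReal.mul_ne_top h.ne_top (tail_ne_top hγ))]
    exact ENNReal.mul_lt_top (ENNReal.mul_lt_top h.ne_top.lt_top (tail_ne_top hγ).lt_top)
      (integrableOn_cube h.memLp l m).2
  have hswap : Integrable (Function.uncurry fun y z => G z y) (ν.prod volume) := by
    have hm : StronglyMeasurable (Function.uncurry fun y z => G z y) :=
      hsm.comp_measurable measurable_swap
    refine ⟨hm.aestronglyMeasurable, ?_⟩
    rw [hasFiniteIntegral_iff_enorm, lintegral_prod _ hm.enorm.aemeasurable]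
    exact hQX
  have hswapQ : Integrable (Function.uncurry fun y z => G z y) (ν.prod ν) :=
    hswap.mono_measure (Measure.prod_mono le_rfl Measure.restrict_le_self)
  have hswapQ' : Integrable (Function.uncurry fun y z => G z y) (ν.prod ν') :=
    hswap.mono_measure (Measure.prod_mono le_rfl Measure.restrict_le_self)
  have hQQ : Integrable (Function.uncurry G) (ν.prod ν) := hswapQ.swap
  have e2 : ∫ y in Q, ∫ z, G z y = (∫ y in Q, ∫ z in Q, G z y) + ∫ y in Q, ∫ z in Qᶜ, G z y := by
    have i1 : Integrable (fun y => ∫ z in Q, G z y) ν := hswapQ.integral_prod_left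
    have i2 : Integrable (fun y => ∫ z in Qᶜ, G z y) ν := hswapQ'.integral_prod_left
    rw [← integral_add i1 i2]
    exact integral_congr_ae (Filter.Eventually.of_forall fun y =>
      (integral_add_compl hQ (hintleft y)).symm)
  have hU : Integrable (fun z => ∫ y, G z y) ν :=
    integrableOn_cube (h.memLp_integral_right hγ) l m
  have eU : ∀ z, ∫ y in Qᶜ, G z y = (∫ y, G z y) - ∫ y in Q, G z y := fun z => by
    rw [← integral_add_compl hQ (h.integrable_right hγ z), add_sub_cancel_left]
  have e1 : ∫ z in Q, ∫ y, G z y = (∫ z in Q, ∫ y in Q, G z y) + ∫ z in Q, ∫ y in Qᶜ, G z y := by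
    have i1 : Integrable (fun z => ∫ y in Q, G z y) ν := hQQ.integral_prod_left
    simp only [eU]
    rw [integral_sub hU i1, add_sub_cancel]
  have e3 : ∫ z in Q, ∫ y in Q, G z y = ∫ y in Q, ∫ z in Q, G z y := integral_integral_swap hQQ
  rw [e1, e2, e3, add_sub_add_left_eq_sub]
  refine enorm_sub_le.trans (add_le_add ?_ ?_)
  · refine (enorm_integral_le_lintegral_enorm _).trans
      ((lintegral_mono fun z => enorm_integral_le_lintegral_enorm _).trans (le_of_eq ?_))
    exact lintegral_lintegral_swap (f := fun z y => ‖G z y‖ₑ) hsm.enorm.aemeasurable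
  · exact (enorm_integral_le_lintegral_enorm _).trans
      (lintegral_mono fun y => enorm_integral_le_lintegral_enorm _)

omit [InnerProductSpace ℝ E] [CompleteSpace E] in
lemma sq_lintegral_lintegral_le {S S' : Set (Fin n → ℝ)} {c : ℝ≥0∞}
    (hc : ∫⁻ y in S, ∫⁻ z in S', ker γ (2 ^ (-k)) (z - y) ≤ c) :
    (∫⁻ y in S, ∫⁻ z in S', ‖G z y‖ₑ) ^ 2
      ≤ a ^ 2 * c * ∫⁻ y in S, ∫⁻ z in S', ker γ (2 ^ (-k)) (z - y) * ‖g y‖ₑ ^ 2 := by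
  have hk : Measurable fun p : (Fin n → ℝ) × (Fin n → ℝ) => ker γ (2 ^ (-k)) (p.2 - p.1) :=
    (measurable_ker γ _).comp (measurable_snd.sub measurable_fst)
  have hφ : Measurable fun p : (Fin n → ℝ) × (Fin n → ℝ) => ‖g p.1‖ₑ :=
    h.measurable_enorm.comp measurable_fst
  have h1 : ∫⁻ y in S, ∫⁻ z in S', ‖G z y‖ₑ
      ≤ a * ∫⁻ y in S, ∫⁻ z in S', ker γ (2 ^ (-k)) (z - y) * ‖g y‖ₑ := by
    rw [← lintegral_const_mul' _ _ h.ne_top]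
    refine lintegral_mono fun y => ?_
    rw [← lintegral_const_mul' _ _ h.ne_top]
    exact lintegral_mono fun z => h.size z y
  refine (pow_le_pow_left' h1 2).trans ?_
  rw [mul_pow, mul_assoc]
  gcongr
  have h2 := lintegral_mul_sq_le
    (μ := (volume.restrict S).prod (volume.restrict S')) hk.aemeasurable hφ.aemeasurable
  have m1 : Measurable fun p : (Fin n → ℝ) × (Fin n → ℝ) =>
    ker γ (2 ^ (-k)) (p.2 - p.1) * ‖g p.1‖ₑ := hk.mul hφ
  have m2 : Measurable fun p : (Fin n → ℝ) × (Fin n → ℝ) =>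
    ker γ (2 ^ (-k)) (p.2 - p.1) * ‖g p.1‖ₑ ^ 2 := hk.mul (hφ.pow_const 2)
  rw [lintegral_prod _ hk.aemeasurable, lintegral_prod _ m1.aemeasurable,
    lintegral_prod _ m2.aemeasurable] at h2
  exact h2.trans (mul_le_mul_left hc _)

omit [CompleteSpace E] in
/-- The averages over large cubes do not distinguish `∫ G(·, y) dy` from `∫ G(z, ·) dz`. -/
lemma eLpNorm_condAvg_sub_sq_le (hγ : 0 < γ) (hγ1 : γ ≤ 1) (hn : 0 < n) (l : ℤ) :
    eLpNorm (condAvg l (fun x => ∫ y, G x y) - condAvg l (fun y => ∫ z, G z y)) 2 volume ^ 2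
      ≤ 4 * a ^ 2 * (ENNReal.ofReal (n * (2 ^ (-k) / 2 ^ (-l)) ^ (γ / 2)) * tail n (γ / 2))
        * tail n γ * eLpNorm g 2 volume ^ 2 := by
  have hh : (0 : ℝ) < 2 ^ (-k) := zpow_pos two_pos (-k)
  set β := ENNReal.ofReal (n * (2 ^ (-k) / 2 ^ (-l)) ^ (γ / 2)) * tail n (γ / 2) with hβ
  have hβt : β ≠ ∞ := ENNReal.mul_ne_top ENNReal.ofReal_ne_top (tail_ne_top (by positivity))
  set k2 : (Fin n → ℝ) → (Fin n → ℝ) → ℝ≥0∞ :=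
    fun y z => ker γ (2 ^ (-k)) (z - y) * ‖g y‖ₑ ^ 2 with hk2
  have hk2m : Measurable (Function.uncurry k2) :=
    ((measurable_ker γ _).comp (measurable_snd.sub measurable_fst)).mul
      ((h.measurable_enorm.comp measurable_fst).pow_const 2)
  have hcube : ∀ m, ∫⁻ x in cube l m, ‖(condAvg l (fun x => ∫ y, G x y)
      - condAvg l (fun y => ∫ z, G z y)) x‖ₑ ^ 2
      ≤ (2 * a ^ 2 * β) * ((∫⁻ z in cube l m, ∫⁻ y, k2 y z)
        + ∫⁻ y in cube l m, ∫⁻ z, k2 y z) := by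
    intro m
    set Q := cube l m with hQdef
    set v := volume Q with hv
    have hv0 : v ≠ 0 := volume_cube_ne_zero l m
    have hvt : v ≠ ∞ := volume_cube_ne_top l m
    have hval : ∀ x ∈ Q, ‖(condAvg l (fun x => ∫ y, G x y)
        - condAvg l (fun y => ∫ z, G z y)) x‖ₑ
        = v⁻¹ * ‖(∫ z in Q, ∫ y, G z y) - ∫ y in Q, ∫ z, G z y‖ₑ := by
      intro x hx
      rw [Pi.sub_apply, condAvg, condAvg, mem_cube_iff.1 hx, setAverage_eq, setAverage_eq,
        ← smul_sub, enorm_smul, Real.enorm_eq_ofReal (by positivity),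
        ENNReal.ofReal_inv_of_pos (measureReal_cube_pos l m), measureReal_def,
        ENNReal.ofReal_toReal hvt]
    rw [setLIntegral_congr_fun (measurableSet_cube l m)
      (fun x hx => congrArg (· ^ 2) (hval x hx)), setLIntegral_const]
    have hA := h.sq_lintegral_lintegral_le (lintegral_compl_cube_ker_le hγ hγ1 hh hn l m)
    have hB := h.sq_lintegral_lintegral_le (lintegral_cube_compl_ker_le hγ hγ1 hh hn l m)
    have hA' : ∫⁻ y in Qᶜ, ∫⁻ z in Q, k2 y z ≤ ∫⁻ z in Q, ∫⁻ y, k2 y z := by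
      rw [lintegral_lintegral_swap hk2m.aemeasurable]
      exact lintegral_mono fun z => setLIntegral_le_lintegral _ _
    have hB' : ∫⁻ y in Q, ∫⁻ z in Qᶜ, k2 y z ≤ ∫⁻ y in Q, ∫⁻ z, k2 y z :=
      lintegral_mono fun y => setLIntegral_le_lintegral _ _
    have hsq : ∀ p q : ℝ≥0∞, (p + q) ^ 2 ≤ 2 * (p ^ 2 + q ^ 2) := fun p q => by
      have := ENNReal.rpow_add_le_mul_rpow_add_rpow p q (p := 2) (by norm_num)
      simpa [show (2 : ℝ) - 1 = 1 by norm_num] using this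
    calc (v⁻¹ * ‖(∫ z in Q, ∫ y, G z y) - ∫ y in Q, ∫ z, G z y‖ₑ) ^ 2 * v
        ≤ (v⁻¹ * ((∫⁻ y in Qᶜ, ∫⁻ z in Q, ‖G z y‖ₑ)
          + ∫⁻ y in Q, ∫⁻ z in Qᶜ, ‖G z y‖ₑ)) ^ 2 * v := by
          gcongr
          exact h.enorm_setIntegral_sub_le hγ l m
      _ ≤ v⁻¹ ^ 2 * (2 * (a ^ 2 * (β * v) * (∫⁻ z in Q, ∫⁻ y, k2 y z)
          + a ^ 2 * (β * v) * ∫⁻ y in Q, ∫⁻ z, k2 y z)) * v := by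
          rw [mul_pow]
          gcongr
          refine (hsq _ _).trans ?_
          gcongr
          · exact hA.trans (mul_le_mul_right hA' _)
          · exact hB.trans (mul_le_mul_right hB' _)
      _ = (v⁻¹ * v) ^ 2 * ((2 * a ^ 2 * β) * ((∫⁻ z in Q, ∫⁻ y, k2 y z)
          + ∫⁻ y in Q, ∫⁻ z, k2 y z)) := by ring
      _ = _ := by rw [ENNReal.inv_mul_cancel hv0 hvt, one_pow, one_mul]
  have hT1 : ∫⁻ z, ∫⁻ y, k2 y z = tail n γ * ∫⁻ y, ‖g y‖ₑ ^ 2 :=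
    lintegral_lintegral_ker_mul γ hh (h.measurable_enorm.pow_const 2)
  have hT2 : ∫⁻ y, ∫⁻ z, k2 y z = tail n γ * ∫⁻ y, ‖g y‖ₑ ^ 2 := by
    rw [lintegral_lintegral_swap hk2m.aemeasurable, hT1]
  rw [eLpNorm_two_sq, lintegral_eq_tsum_cube l]
  refine (ENNReal.tsum_le_tsum hcube).trans (le_of_eq ?_)
  rw [ENNReal.tsum_mul_left, ENNReal.tsum_add, ← lintegral_eq_tsum_cube l,
    ← lintegral_eq_tsum_cube l, hT1, hT2, eLpNorm_two_sq]
  ring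

/-- The almost orthogonality estimate: `∫ G(·, y) dy - E_k ∫ G(z, ·) dz` is concentrated at the
frequency `2^k`. -/
lemma eLpNorm_mdiff_le (hγ : 0 < γ) (hγ1 : γ ≤ 1) (hn : 0 < n) (l : ℤ) :
    eLpNorm (mdiff l ((fun x => ∫ y, G x y) - condAvg k fun y => ∫ z, G z y)) 2 volume
      ≤ 16 * n * (tail n γ + tail n (γ / 2)) * ENNReal.ofReal (2 ^ (-(γ / 4))) ^ (l - k).natAbs
        * a * eLpNorm g 2 volume := by
  set r := ENNReal.ofReal (2 ^ (-(γ / 4))) with hr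
  set U : (Fin n → ℝ) → E := fun x => ∫ y, G x y with hUdef
  set B : (Fin n → ℝ) → E := fun y => ∫ z, G z y with hBdef
  set t := tail n γ with ht
  set t' := tail n (γ / 2) with ht'
  have hU : MemLp U 2 := h.memLp_integral_right hγ
  have hB : MemLp B 2 := h.memLp_integral_left hγ
  have hn1 : (1 : ℝ≥0∞) ≤ n := by exact_mod_cast hn
  have htt : t ≤ n * (t + t') := le_self_add.trans (le_mul_of_one_le_left' hn1)
  have hr1 : r ≤ 1 := by
    rw [hr, ← ENNReal.ofReal_one]
    exact ENNReal.ofReal_le_ofReal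
      (Real.rpow_le_one_of_one_le_of_nonpos one_le_two (by linarith))
  have hr2 : (1 : ℝ≥0∞) ≤ 2 * r := by
    rw [hr, ← ENNReal.ofReal_one, show (2 : ℝ≥0∞) = ENNReal.ofReal 2 by simp,
      ← ENNReal.ofReal_mul zero_le_two]
    refine ENNReal.ofReal_le_ofReal ?_
    have : (2 : ℝ) ^ (-1 : ℝ) ≤ 2 ^ (-(γ / 4)) :=
      Real.rpow_le_rpow_of_exponent_le one_le_two (by linarith)
    rw [Real.rpow_neg_one] at this
    linarith
  have hUn : eLpNorm U 2 volume ≤ a * t * eLpNorm g 2 volume := by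
    refine (ENNReal.pow_le_pow_left_iff two_ne_zero).1 ?_
    rw [mul_pow (a * t)]
    exact h.eLpNorm_integral_right_le
  have hBn : eLpNorm B 2 volume ≤ a * t * eLpNorm g 2 volume := by
    refine (ENNReal.pow_le_pow_left_iff two_ne_zero).1 ?_
    rw [mul_pow (a * t)]
    exact h.eLpNorm_integral_left_le
  have hW : MemLp (U - condAvg k B) 2 := hU.sub (memLp_condAvg k hB)
  have hmd : ∀ l', mdiff l' (U - condAvg k B)
      = condAvg l' (U - condAvg k B) - condAvg (l' - 1) (U - condAvg k B) := fun _ => rfl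
  -- The averages at the scales `2^{-l'}` with `l' ≤ k`.
  have hcoarse : ∀ j : ℕ, eLpNorm (condAvg (k - j) (U - condAvg k B)) 2 volume
      ≤ 2 * a * r ^ j * (n * (t + t')) * eLpNorm g 2 volume := by
    intro j
    refine (ENNReal.pow_le_pow_left_iff two_ne_zero).1 ?_
    rw [condAvg_sub _ hU (memLp_condAvg k hB), condAvg_condAvg (by lia) hB]
    refine (h.eLpNorm_condAvg_sub_sq_le hγ hγ1 hn (k - j)).trans ?_
    have e : ENNReal.ofReal (n * ((2 : ℝ) ^ (-k) / 2 ^ (-(k - j : ℤ))) ^ (γ / 2))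
        = n * r ^ (2 * j) := by
      rw [ENNReal.ofReal_mul (by positivity), ENNReal.ofReal_natCast, hr,
        ← ENNReal.ofReal_pow (by positivity)]
      congr 2
      rw [← zpow_sub₀ two_ne_zero, ← Real.rpow_natCast, ← Real.rpow_mul zero_le_two,
        ← Real.rpow_intCast, ← Real.rpow_mul zero_le_two]
      congr 1
      push_cast
      ring
    rw [e]
    calc 4 * a ^ 2 * (n * r ^ (2 * j) * t') * t * eLpNorm g 2 volume ^ 2
        = (2 * a * r ^ j) ^ 2 * (n * (t' * t)) * eLpNorm g 2 volume ^ 2 := by ring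
      _ ≤ (2 * a * r ^ j) ^ 2 * ((n * n) * ((t + t') * (t + t'))) * eLpNorm g 2 volume ^ 2 := by
          gcongr
          · exact le_mul_of_one_le_left' hn1
          · exact le_add_self
          · exact le_self_add
      _ = _ := by ring
  rcases le_total l k with hlk | hlk
  · obtain ⟨j, hj⟩ := Int.eq_ofNat_of_zero_le (sub_nonneg.2 hlk)
    have hl : l = k - j := by lia
    have hl' : l - 1 = k - (j + 1 : ℕ) := by push_cast; lia
    have hnat : (l - k).natAbs = j := by lia
    rw [hnat, hmd]
    refine (eLpNorm_sub_le (memLp_condAvg _ hW).1 (memLp_condAvg _ hW).1 (by norm_num)).trans ?_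
    rw [hl', hl]
    refine (add_le_add (hcoarse j) (hcoarse (j + 1))).trans ?_
    calc _ ≤ 2 * a * r ^ j * (n * (t + t')) * eLpNorm g 2 volume
          + 2 * a * (r ^ j * 1) * (n * (t + t')) * eLpNorm g 2 volume := by
          rw [pow_succ]
          gcongr
      _ = 4 * (n * (t + t') * r ^ j * a * eLpNorm g 2 volume) := by ring
      _ ≤ 16 * (n * (t + t') * r ^ j * a * eLpNorm g 2 volume) := by
          gcongr
          norm_num
      _ = _ := by ring
  · obtain ⟨j, hj⟩ := Int.eq_ofNat_of_zero_le (sub_nonneg.2 hlk)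
    have hnat : (l - k).natAbs = j := by lia
    rw [hnat]
    rcases Nat.lt_or_ge j 3 with hj3 | hj3
    · have hrj : 1 ≤ 4 * r ^ j := by
        calc (1 : ℝ≥0∞) ≤ (2 * r) ^ 2 := one_le_pow₀ hr2
          _ = 4 * r ^ 2 := by ring
          _ ≤ 4 * r ^ j := by
              gcongr 4 * ?_
              exact pow_le_pow_right_of_le_one' hr1 (by lia)
      rw [hmd]
      refine (eLpNorm_sub_le (memLp_condAvg _ hW).1 (memLp_condAvg _ hW).1 (by norm_num)).trans ?_
      have hWn : eLpNorm (U - condAvg k B) 2 volume ≤ 2 * (a * t * eLpNorm g 2 volume) := by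
        refine (eLpNorm_sub_le hU.1 (memLp_condAvg k hB).1 (by norm_num)).trans ?_
        rw [two_mul]
        exact add_le_add hUn ((eLpNorm_condAvg_le k hB).trans hBn)
      calc _ ≤ 2 * (a * t * eLpNorm g 2 volume) + 2 * (a * t * eLpNorm g 2 volume) :=
            add_le_add ((eLpNorm_condAvg_le _ hW).trans hWn) ((eLpNorm_condAvg_le _ hW).trans hWn)
        _ = 4 * a * t * eLpNorm g 2 volume * 1 := by ring
        _ ≤ 4 * a * (n * (t + t')) * eLpNorm g 2 volume * (4 * r ^ j) := by gcongr
        _ = _ := by ring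
    · obtain ⟨i, rfl⟩ : ∃ i, j = i + 1 := ⟨j - 1, by lia⟩
      have hl : l = k + i + 1 := by push_cast at hj; lia
      have e : mdiff l (U - condAvg k B) = mdiff (k + i + 1) U := by
        rw [hl]
        funext x
        simp only [mdiff, condAvg_sub _ hU (memLp_condAvg k hB)]
        rw [condAvg_condAvg' (by lia) B, condAvg_condAvg' (by lia) B]
        simp
      rw [e]
      refine (h.eLpNorm_mdiff_fine_le hγ (by lia)).trans ?_
      calc 2 * a * r ^ (i + 1) * t * eLpNorm g 2 volume
          ≤ 16 * a * r ^ (i + 1) * (n * (t + t')) * eLpNorm g 2 volume := by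
            gcongr
            norm_num
        _ = _ := by ring

end

end IsScaleKernel

/-- Pythagoras' theorem for a finite family of functions with pairwise orthogonal values. -/
lemma eLpNorm_sum_sq_of_orthogonal {ι : Type*} (S : Finset ι) {V : ι → (Fin n → ℝ) → E}
    (hV : ∀ i, AEStronglyMeasurable (V i))
    (h : ∀ x, ∀ i ∈ S, ∀ j ∈ S, i ≠ j → inner ℝ (V i x) (V j x) = 0) :
    eLpNorm (∑ i ∈ S, V i) 2 volume ^ 2 = ∑ i ∈ S, eLpNorm (V i) 2 volume ^ 2 := by
  simp only [eLpNorm_two_sq]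
  rw [← lintegral_finsetSum' _ fun i _ => (hV i).enorm.pow_const 2]
  refine lintegral_congr fun x => ?_
  have h1 : ‖∑ i ∈ S, V i x‖ ^ 2 = ∑ i ∈ S, ‖V i x‖ ^ 2 := by
    rw [← real_inner_self_eq_norm_sq, sum_inner]
    refine Finset.sum_congr rfl fun i hi => ?_
    rw [inner_sum, Finset.sum_eq_single i (fun j hj hji => h x i hi j hj hji.symm)
      (fun hc => absurd hi hc), real_inner_self_eq_norm_sq]
  rw [Finset.sum_apply]
  simp only [← ofReal_norm, ← ENNReal.ofReal_pow (norm_nonneg _)]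
  rw [h1, ENNReal.ofReal_sum_of_nonneg fun _ _ => by positivity]

variable (n) in
/-- The constant of the estimate for a sum over all scales. -/
noncomputable def scaleConst (γ : ℝ) : ℝ≥0∞ :=
  tail n γ + 16 * n * (tail n γ + tail n (γ / 2))
    * ∑' j : ℤ, ENNReal.ofReal (2 ^ (-(γ / 4))) ^ j.natAbs

lemma scaleConst_ne_top {γ : ℝ} (hγ : 0 < γ) : scaleConst n γ ≠ ∞ := by
  have h1 := tail_ne_top (n := n) hγ
  have h2 := tail_ne_top (n := n) (half_pos hγ)
  have hr : ENNReal.ofReal (2 ^ (-(γ / 4))) < 1 := by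
    rw [← ENNReal.ofReal_one]
    exact (ENNReal.ofReal_lt_ofReal_iff one_pos).2
      (Real.rpow_lt_one_of_one_lt_of_neg one_lt_two (by linarith))
  have hg : ∑' j : ℕ, ENNReal.ofReal (2 ^ (-(γ / 4))) ^ j ≠ ∞ := by
    rw [ENNReal.tsum_geometric]
    exact ENNReal.inv_ne_top.2 (tsub_pos_of_lt hr).ne'
  have h3 : ∑' j : ℤ, ENNReal.ofReal (2 ^ (-(γ / 4))) ^ j.natAbs ≠ ∞ := by
    rw [tsum_of_nat_of_neg_add_one ENNReal.summable ENNReal.summable]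
    refine ENNReal.add_ne_top.2 ⟨by simpa using hg, ?_⟩
    refine ne_top_of_le_ne_top hg (ENNReal.tsum_le_tsum fun j => ?_)
    have : (-((j : ℤ) + 1)).natAbs = j + 1 := by lia
    rw [this]
    exact pow_le_pow_right_of_le_one' hr.le (by lia)
  refine ENNReal.add_ne_top.2 ⟨h1, ENNReal.mul_ne_top (ENNReal.mul_ne_top
    (ENNReal.mul_ne_top (by norm_num) (by simp)) (ENNReal.add_ne_top.2 ⟨h1, h2⟩)) h3⟩

variable [CompleteSpace E]

/-- The estimate for a sum of kernels at different scales. No cancellation of the integrals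
`∫ G(z, ·) dz` is needed, as their averages are orthogonal to each other. -/
theorem eLpNorm_sum_scale_le {γ : ℝ} (hγ : 0 < γ) (hγ1 : γ ≤ 1) (hn : 0 < n) {a : ℝ≥0∞}
    (S : Finset ℤ) {g : ℤ → (Fin n → ℝ) → E} {G : ℤ → (Fin n → ℝ) → (Fin n → ℝ) → E}
    (h : ∀ k, IsScaleKernel γ a k (g k) (G k))
    (horth : ∀ x, ∀ i ∈ S, ∀ j ∈ S, i ≠ j → inner ℝ (condAvg i (fun y => ∫ z, G i z y) x)
      (condAvg j (fun y => ∫ z, G j z y) x) = 0) :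
    eLpNorm (∑ k ∈ S, fun x => ∫ y, G k x y) 2 volume ^ 2
      ≤ (a * scaleConst n γ) ^ 2 * ∑ k ∈ S, eLpNorm (g k) 2 volume ^ 2 := by
  set r := ENNReal.ofReal (2 ^ (-(γ / 4))) with hr
  set Cm := 16 * n * (tail n γ + tail n (γ / 2)) with hCm
  set V : ℤ → (Fin n → ℝ) → E := fun k => condAvg k fun y => ∫ z, G k z y with hV
  set W : ℤ → (Fin n → ℝ) → E := fun k => (fun x => ∫ y, G k x y) - V k with hW
  have hVm : ∀ k, MemLp (V k) 2 := fun k => memLp_condAvg k ((h k).memLp_integral_left hγ)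
  have hWm : ∀ k, MemLp (W k) 2 := fun k => ((h k).memLp_integral_right hγ).sub (hVm k)
  have hsplit : (∑ k ∈ S, fun x => ∫ y, G k x y) = (∑ k ∈ S, V k) + ∑ k ∈ S, W k := by
    rw [← Finset.sum_add_distrib]
    exact Finset.sum_congr rfl fun k _ => by rw [hW]; simp
  set s := ∑ k ∈ S, eLpNorm (g k) 2 volume ^ 2 with hs
  have hVn : eLpNorm (∑ k ∈ S, V k) 2 volume ^ 2 ≤ (a * tail n γ) ^ 2 * s := by
    rw [eLpNorm_sum_sq_of_orthogonal S (fun k => (hVm k).1) horth, hs, Finset.mul_sum]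
    refine Finset.sum_le_sum fun k _ => ?_
    refine le_trans ?_ (h k).eLpNorm_integral_left_le
    exact pow_le_pow_left' (eLpNorm_condAvg_le k ((h k).memLp_integral_left hγ)) 2
  have hWs : MemLp (∑ k ∈ S, W k) 2 := memLp_finsetSum' S fun k _ => hWm k
  have hmd : ∀ l, eLpNorm (mdiff l (∑ k ∈ S, W k)) 2 volume
      ≤ ∑ k ∈ S, Cm * a * r ^ (l - k).natAbs * eLpNorm (g k) 2 volume := by
    intro l
    have e : mdiff l (∑ k ∈ S, W k) = ∑ k ∈ S, mdiff l (W k) := by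
      classical
      have : ∀ (l' : ℤ) (S' : Finset ℤ), condAvg l' (∑ k ∈ S', W k)
          = ∑ k ∈ S', condAvg l' (W k) := by
        intro l' S'
        induction S' using Finset.induction_on with
        | empty =>
          funext x
          simp [condAvg]
        | insert k S' hk ih =>
          rw [Finset.sum_insert hk, Finset.sum_insert hk, condAvg_add _ (hWm k)
            (memLp_finsetSum' S' fun k _ => hWm k), ih]
      have hm : ∀ f : (Fin n → ℝ) → E, mdiff l f = condAvg l f - condAvg (l - 1) f :=
        fun _ => rfl
      rw [hm, this, this, ← Finset.sum_sub_distrib]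
      rfl
    rw [e]
    refine (eLpNorm_sum_le (fun k _ => (memLp_mdiff l (hWm k)).1) (by norm_num)).trans ?_
    refine Finset.sum_le_sum fun k _ => ((h k).eLpNorm_mdiff_le hγ hγ1 hn l).trans (le_of_eq ?_)
    rw [← hr, ← hCm]
    ring
  have hWn : eLpNorm (∑ k ∈ S, W k) 2 volume ^ 2
      ≤ (a * (Cm * ∑' j : ℤ, r ^ j.natAbs)) ^ 2 * s := by
    refine (eLpNorm_sq_le_tsum_mdiff hn hWs).trans ?_
    refine (ENNReal.tsum_le_tsum fun l => pow_le_pow_left' (hmd l) 2).trans ?_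
    refine (tsum_sum_mul_sq_le (fun j => Cm * a * r ^ j.natAbs) S _).trans (le_of_eq ?_)
    rw [ENNReal.tsum_mul_left]
    ring
  have hroot : ∀ {p c : ℝ≥0∞}, p ^ 2 ≤ c ^ 2 * s → p ≤ c * s ^ (1 / 2 : ℝ) := by
    intro p c hp
    refine (ENNReal.pow_le_pow_left_iff two_ne_zero).1 (hp.trans (le_of_eq ?_))
    rw [mul_pow, ← ENNReal.rpow_natCast (s ^ (1 / 2 : ℝ)), ← ENNReal.rpow_mul]
    norm_num
  rw [hsplit]
  have hfin : eLpNorm ((∑ k ∈ S, V k) + ∑ k ∈ S, W k) 2 volume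
      ≤ a * scaleConst n γ * s ^ (1 / 2 : ℝ) := by
    refine (eLpNorm_add_le (memLp_finsetSum' S fun k _ => hVm k).1 hWs.1 (by norm_num)).trans ?_
    refine (add_le_add (hroot hVn) (hroot hWn)).trans (le_of_eq ?_)
    rw [scaleConst, ← hr, ← hCm]
    ring
  refine (pow_le_pow_left' hfin 2).trans (le_of_eq ?_)
  rw [mul_pow _ (s ^ (1 / 2 : ℝ)), ← ENNReal.rpow_natCast (s ^ (1 / 2 : ℝ)), ← ENNReal.rpow_mul]
  norm_num

end LittlewoodPaley

/-! ### Multiplication operators on `L₂(N, τ)` -/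

section Multiplication

variable {H : Type u} [NormedAddCommGroup H] [InnerProductSpace ℂ H] [CompleteSpace H]

namespace NSFTrace

variable {N : VonNeumannAlgebra H} (τ : NSFTrace N)

lemma sq_add_sq_sub {x y : H →L[ℂ] H} (hx : x ∈ N) (hy : y ∈ N) :
    τ.sq (x + y) + τ.sq (x - y) = (τ.sq x + τ.sq x) + (τ.sq y + τ.sq y) := by
  have h := fun {z w : H →L[ℂ] H} (hz : z ∈ N) (hw : w ∈ N) =>
    τ.map_add _ (star_mul_self_mem hz) _ (star_mul_self_mem hw) (star_mul_self_nonneg z)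
      (star_mul_self_nonneg w)
  simp only [sq]
  rw [← h (add_mem hx hy) (sub_mem hx hy), ← h hx hx, ← h hy hy,
    ← τ.map_add _ (add_mem (star_mul_self_mem hx) (star_mul_self_mem hx)) _
      (add_mem (star_mul_self_mem hy) (star_mul_self_mem hy))
      (add_nonneg (star_mul_self_nonneg x) (star_mul_self_nonneg x))
      (add_nonneg (star_mul_self_nonneg y) (star_mul_self_nonneg y))]
  congr 1
  simp only [star_add, star_sub]
  noncomm_ring

lemma S2.norm_mul_self (x : τ.S2) : ‖x‖ * ‖x‖ = (τ.sq (S2.val x)).toReal := by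
  rw [← _root_.sq, norm_def, norm2_sq]

/-- The parallelogram identity: `L₂(N, τ)` is a Hilbert space. -/
lemma parallelogram_identity (ξ η : τ.L2) :
    ‖ξ + η‖ * ‖ξ + η‖ + ‖ξ - η‖ * ‖ξ - η‖ = 2 * (‖ξ‖ * ‖ξ‖ + ‖η‖ * ‖η‖) := by
  induction ξ, η using UniformSpace.Completion.induction_on₂ with
  | hp => exact isClosed_eq (by fun_prop) (by fun_prop)
  | ih x y =>
    rw [← UniformSpace.Completion.coe_add, ← UniformSpace.Completion.coe_sub]
    simp only [UniformSpace.Completion.norm_coe, S2.norm_mul_self, _root_.map_add, _root_.map_sub]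
    have h := congrArg ENNReal.toReal (τ.sq_add_sq_sub x.mem y.mem)
    have hx := x.sq_lt_top.ne
    have hy := y.sq_lt_top.ne
    have h1 := (x + y).sq_lt_top.ne
    have h2 := (x - y).sq_lt_top.ne
    rw [_root_.map_add] at h1
    rw [_root_.map_sub] at h2
    rw [ENNReal.toReal_add h1 h2, ENNReal.toReal_add (ENNReal.add_ne_top.2 ⟨hx, hx⟩)
      (ENNReal.add_ne_top.2 ⟨hy, hy⟩), ENNReal.toReal_add hx hx, ENNReal.toReal_add hy hy] at h
    rw [h]
    ring

lemma S2.val_lmulS2 (a : N) (x : τ.S2) : S2.val (τ.lmulS2 a x) = a * S2.val x := rfl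

lemma denseRange_toComplL :
    DenseRange (UniformSpace.Completion.toComplL (𝕜 := ℂ) (E := τ.S2)) :=
  UniformSpace.Completion.denseRange_coe

lemma lmul_coe (a : N) (x : τ.S2) : τ.lmul a (x : τ.L2) = (τ.lmulS2 a x : τ.S2) :=
  ContinuousLinearMap.extend_eq _ τ.denseRange_toComplL
    (UniformSpace.Completion.isUniformInducing_coe _) x

lemma rmul_coe (a : N) (x : τ.S2) : τ.rmul a (x : τ.L2) = (τ.rmulS2 a x : τ.S2) :=
  ContinuousLinearMap.extend_eq _ τ.denseRange_toComplL
    (UniformSpace.Completion.isUniformInducing_coe _) x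

lemma norm_lmul_le (a : N) (ξ : τ.L2) : ‖τ.lmul a ξ‖ ≤ ‖(a : H →L[ℂ] H)‖ * ‖ξ‖ := by
  induction ξ using UniformSpace.Completion.induction_on with
  | hp => exact isClosed_le (by fun_prop) (by fun_prop)
  | ih x =>
    rw [lmul_coe, UniformSpace.Completion.norm_coe, UniformSpace.Completion.norm_coe]
    exact τ.norm2_le_of_sq_le (c := ‖(a : H →L[ℂ] H)‖₊) (τ.sq_left_mul_le a.2 x.mem)

lemma norm_rmul_le (a : N) (ξ : τ.L2) : ‖τ.rmul a ξ‖ ≤ ‖(a : H →L[ℂ] H)‖ * ‖ξ‖ := by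
  induction ξ using UniformSpace.Completion.induction_on with
  | hp => exact isClosed_le (by fun_prop) (by fun_prop)
  | ih x =>
    rw [rmul_coe, UniformSpace.Completion.norm_coe, UniformSpace.Completion.norm_coe]
    exact τ.norm2_le_of_sq_le (c := ‖(a : H →L[ℂ] H)‖₊) (τ.sq_right_mul_le a.2 x.mem)

/-- If the projections `P_j` increase strongly to `Q`, then `‖(Q - P_j) y‖₂` tends to zero, by the
normality of the trace. -/
lemma tendsto_sq_sub_mul {P : ℕ → N} {Q : N} (hP : ∀ j, IsStarProjection (P j : H →L[ℂ] H))
    (hQ : IsStarProjection (Q : H →L[ℂ] H))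
    (hmono : ∀ i j, i ≤ j → (P i : H →L[ℂ] H) * P j = P i)
    (hPQ : ∀ j, (P j : H →L[ℂ] H) * Q = P j)
    (hlim : ∀ v, Filter.Tendsto (fun j => (P j : H →L[ℂ] H) v) Filter.atTop
      (nhds ((Q : H →L[ℂ] H) v)))
    {y : H →L[ℂ] H} (hy : y ∈ N) (hyt : τ.sq y < ∞) :
    Filter.Tendsto (fun j => τ.sq (((Q - P j : N) : H →L[ℂ] H) * y)) Filter.atTop (nhds 0) := by
  have hD : ∀ j, IsStarProjection ((Q : H →L[ℂ] H) - P j) := fun j =>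
    (hP j).sub_of_mul_eq_left hQ (hPQ j)
  have hconj : ∀ {e : H →L[ℂ] H}, IsStarProjection e →
      star (e * y) * (e * y) = star y * e * y := by
    intro e he
    rw [star_mul, he.isSelfAdjoint.star_eq]
    simp only [mul_assoc]
    rw [← mul_assoc e e y, he.isIdempotentElem.eq]
  have hle : ∀ {e f : H →L[ℂ] H}, e ≤ f → star y * e * y ≤ star y * f * y := fun h =>
    star_left_conjugate_le_conjugate h y
  have hPle : ∀ i j, i ≤ j → (P i : H →L[ℂ] H) ≤ P j := fun i j hij =>
    sub_nonneg.1 ((hP i).sub_of_mul_eq_left (hP j) (hmono i j hij)).nonneg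
  have hPQle : ∀ j, (P j : H →L[ℂ] H) ≤ Q := fun j => sub_nonneg.1 (hD j).nonneg
  have hmem : ∀ a : N, star y * (a : H →L[ℂ] H) * y ∈ N := fun a =>
    mul_mem (mul_mem (star_mem hy) a.2) hy
  set S : Set (H →L[ℂ] H) := Set.range fun j => star y * (P j : H →L[ℂ] H) * y with hS
  have hlub : IsLUB S (star y * (Q : H →L[ℂ] H) * y) := by
    refine ⟨?_, fun b hb => ?_⟩
    · rintro _ ⟨j, rfl⟩
      exact hle (hPQle j)
    · rw [ContinuousLinearMap.le_def, ContinuousLinearMap.isPositive_iff_complex]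
      intro v
      have hb' : ∀ j, ∀ v, ((RCLike.re (inner ℂ ((b - star y * (P j : H →L[ℂ] H) * y) v) v) : ℝ)
            : ℂ) = inner ℂ ((b - star y * (P j : H →L[ℂ] H) * y) v) v ∧
          0 ≤ RCLike.re (inner ℂ ((b - star y * (P j : H →L[ℂ] H) * y) v) v) := fun j =>
        (ContinuousLinearMap.isPositive_iff_complex _).1
          ((ContinuousLinearMap.le_def _ _).1 (hb ⟨j, rfl⟩))
      have ht : Filter.Tendsto (fun j => inner ℂ ((b - star y * (P j : H →L[ℂ] H) * y) v) v)
          Filter.atTop (nhds (inner ℂ ((b - star y * (Q : H →L[ℂ] H) * y) v) v)) := by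
        refine Filter.Tendsto.inner ?_ tendsto_const_nhds
        exact tendsto_const_nhds.sub (((star y).continuous.tendsto _).comp (hlim (y v)))
      have hre := (Complex.continuous_re.tendsto _).comp ht
      refine ⟨?_, ge_of_tendsto' hre fun j => (hb' j v).2⟩
      refine tendsto_nhds_unique (((Complex.continuous_ofReal.tendsto _).comp hre).congr ?_) ht
      exact fun j => (hb' j v).1
  have hnorm := τ.normal S _ ⟨_, ⟨0, rfl⟩⟩ (by
    rintro _ ⟨i, rfl⟩ _ ⟨j, rfl⟩
    exact ⟨_, ⟨max i j, rfl⟩, hle (hPle _ _ (le_max_left _ _)), hle (hPle _ _ (le_max_right _ _))⟩)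
    (by
      rintro _ ⟨j, rfl⟩
      exact ⟨hmem _, star_left_conjugate_nonneg (hP j).nonneg y⟩) (hmem Q) hlub
  rw [hS, iSup_range] at hnorm
  have hmonoτ : Monotone fun j => τ.toFun (star y * (P j : H →L[ℂ] H) * y) := fun i j hij =>
    τ.mono (hmem _) (hmem _) (star_left_conjugate_nonneg (hP i).nonneg y) (hle (hPle i j hij))
  have htend := tendsto_atTop_iSup hmonoτ
  rw [← hnorm] at htend
  have hfin : τ.toFun (star y * (Q : H →L[ℂ] H) * y) ≠ ∞ := by
    rw [← hconj hQ]
    refine ((τ.sq_left_mul_le Q.2 hy).trans_lt (ENNReal.mul_lt_top ENNReal.coe_lt_top hyt)).ne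
  have hsub := ENNReal.Tendsto.sub (tendsto_const_nhds
    (x := τ.toFun (star y * (Q : H →L[ℂ] H) * y))) htend (Or.inl hfin)
  rw [tsub_self] at hsub
  refine hsub.congr fun j => ?_
  have hadd := τ.map_add _ (hmem (P j)) _ (hmem (Q - P j))
    (star_left_conjugate_nonneg (hP j).nonneg y) (star_left_conjugate_nonneg (hD j).nonneg y)
  have he : star y * (P j : H →L[ℂ] H) * y + star y * ((Q - P j : N) : H →L[ℂ] H) * y
      = star y * (Q : H →L[ℂ] H) * y := by
    rw [← add_mul, ← mul_add]
    congr 2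
    exact add_sub_cancel _ _
  rw [he] at hadd
  have hPfin : τ.toFun (star y * (P j : H →L[ℂ] H) * y) ≠ ∞ :=
    ne_top_of_le_ne_top hfin (hadd ▸ le_self_add)
  rw [hadd, ENNReal.add_sub_cancel_left hPfin, NSFTrace.sq]
  exact congrArg τ.toFun (hconj (hD j)).symm

end NSFTrace

/-- The properties which left and right multiplication on `L₂(N, τ)` by the elements of `N` have in
common. Multiplicativity is required only for commuting factors. -/
structure IsSideAction {M N : VonNeumannAlgebra H} (τ : NSFTrace N) (hMN : M ≤ N)
    (L : N → τ.L2 →L[ℂ] τ.L2) : Prop where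
  one : ∀ ξ, L 1 ξ = ξ
  sub : ∀ a b ξ, L (a - b) ξ = L a ξ - L b ξ
  mul : ∀ a b c, a * b = c → b * a = c → ∀ ξ, L a (L b ξ) = L c ξ
  norm_le : ∀ a ξ, ‖L a ξ‖ ≤ ‖(a : H →L[ℂ] H)‖ * ‖ξ‖
  commute : ∀ (a : M) (b : N), (b : H →L[ℂ] H) ∈ M.commutant → ∀ ξ,
    L (incl hMN a) (τ.lmul b ξ) = τ.lmul b (L (incl hMN a) ξ)
  mem_L2sub : ∀ (a : M) (ξ), ξ ∈ τ.L2sub M → L (incl hMN a) ξ ∈ τ.L2sub M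
  tendsto : ∀ (P : ℕ → N) (Q : N), (∀ j, IsStarProjection (P j : H →L[ℂ] H)) →
    IsStarProjection (Q : H →L[ℂ] H) → (∀ i j, i ≤ j → (P i : H →L[ℂ] H) * P j = P i) →
    (∀ j, (P j : H →L[ℂ] H) * Q = P j) →
    (∀ v, Filter.Tendsto (fun j => (P j : H →L[ℂ] H) v) Filter.atTop
      (nhds ((Q : H →L[ℂ] H) v))) →
    ∀ ξ, Filter.Tendsto (fun j => L (Q - P j) ξ) Filter.atTop (nhds 0)

namespace NSFTrace

variable {M N : VonNeumannAlgebra H} (τ : NSFTrace N) (hMN : M ≤ N)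

lemma tendsto_zero_of_coe {D : ℕ → τ.L2 →L[ℂ] τ.L2} (hD : ∀ j ξ, ‖D j ξ‖ ≤ ‖ξ‖)
    (h : ∀ x : τ.S2, Filter.Tendsto (fun j => ‖D j (x : τ.L2)‖) Filter.atTop (nhds 0)) (ξ : τ.L2) :
    Filter.Tendsto (fun j => D j ξ) Filter.atTop (nhds 0) := by
  rw [Metric.tendsto_atTop]
  intro ε hε
  obtain ⟨x, hx⟩ := (UniformSpace.Completion.denseRange_coe (α := τ.S2)).exists_dist_lt ξ
    (half_pos hε)
  obtain ⟨J, hJ⟩ := (Metric.tendsto_atTop.1 (h x)) (ε / 2) (half_pos hε)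
  refine ⟨J, fun j hj => ?_⟩
  have h1 := hJ j hj
  rw [dist_zero_right, norm_norm] at h1
  have h2 := hD j (ξ - x)
  rw [dist_eq_norm] at hx
  rw [dist_zero_right]
  have h3 : D j ξ = D j (ξ - x) + D j x := by rw [← _root_.map_add, sub_add_cancel]
  rw [h3]
  linarith [norm_add_le (D j (ξ - x)) (D j x)]

lemma tendsto_norm_zero_of_sq {x : ℕ → τ.S2}
    (h : Filter.Tendsto (fun j => τ.sq (S2.val (x j))) Filter.atTop (nhds 0)) :
    Filter.Tendsto (fun j => ‖((x j : τ.S2) : τ.L2)‖) Filter.atTop (nhds 0) := by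
  have h1 := (ENNReal.tendsto_toReal ENNReal.zero_ne_top).comp h
  have h2 := (Real.continuous_sqrt.tendsto _).comp h1
  simp only [ENNReal.toReal_zero, Real.sqrt_zero] at h2
  exact h2.congr fun j => (UniformSpace.Completion.norm_coe _).symm

lemma coe_mem_L2sub {x : τ.S2} (hx : S2.val x ∈ M) : (x : τ.L2) ∈ τ.L2sub M :=
  Submodule.le_topologicalClosure _ ⟨x, hx, rfl⟩

/-- A continuous linear map that preserves the elements of `M` preserves `L₂(M)`. -/
lemma mem_L2sub_of_coe {D : τ.L2 →L[ℂ] τ.L2}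
    (h : ∀ x : τ.S2, S2.val x ∈ M → D (x : τ.L2) ∈ τ.L2sub M) {ξ : τ.L2} (hξ : ξ ∈ τ.L2sub M) :
    D ξ ∈ τ.L2sub M := by
  have h1 : (((Subalgebra.toSubmodule M.toStarSubalgebra.toSubalgebra).comap S2.val).map
      (UniformSpace.Completion.toComplL (𝕜 := ℂ) (E := τ.S2)).toLinearMap)
      ≤ (τ.L2sub M).comap (D : τ.L2 →ₗ[ℂ] τ.L2) := by
    rintro _ ⟨x, hx, rfl⟩
    exact h x hx
  have hc : IsClosed ((τ.L2sub M : Submodule ℂ τ.L2) : Set τ.L2) :=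
    Submodule.isClosed_topologicalClosure _
  exact Submodule.topologicalClosure_minimal _ h1 (hc.preimage D.continuous) hξ

lemma isSideAction_lmul : IsSideAction τ hMN τ.lmul where
  one ξ := by
    induction ξ using UniformSpace.Completion.induction_on with
    | hp => exact isClosed_eq (by fun_prop) (by fun_prop)
    | ih x =>
      rw [lmul_coe]
      congr 1
  sub a b ξ := by
    induction ξ using UniformSpace.Completion.induction_on with
    | hp => exact isClosed_eq (by fun_prop) (by fun_prop)
    | ih x =>
      rw [lmul_coe, lmul_coe, lmul_coe, ← UniformSpace.Completion.coe_sub]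
      congr 1
  mul a b c hab _ ξ := by
    induction ξ using UniformSpace.Completion.induction_on with
    | hp => exact isClosed_eq (by fun_prop) (by fun_prop)
    | ih x =>
      rw [lmul_coe, lmul_coe, lmul_coe, ← hab]
      congr 1
  norm_le := τ.norm_lmul_le
  commute a b hb ξ := by
    induction ξ using UniformSpace.Completion.induction_on with
    | hp => exact isClosed_eq (by fun_prop) (by fun_prop)
    | ih x =>
      rw [lmul_coe, lmul_coe, lmul_coe, lmul_coe]
      congr 1
      refine S2.val_injective ?_
      simp only [S2.val_lmulS2, ← mul_assoc]
      congr 1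
      exact VonNeumannAlgebra.mem_commutant_iff.1 hb a a.2
  mem_L2sub a ξ hξ := by
    refine τ.mem_L2sub_of_coe (fun x hx => ?_) hξ
    rw [lmul_coe]
    exact τ.coe_mem_L2sub (mul_mem a.2 hx)
  tendsto P Q hP hQ hmono hPQ hlim ξ := by
    refine τ.tendsto_zero_of_coe (fun j ξ => ?_) (fun x => ?_) ξ
    · refine (τ.norm_lmul_le _ _).trans (mul_le_of_le_one_left (norm_nonneg _) ?_)
      exact IsStarProjection.norm_le _ ((hP j).sub_of_mul_eq_left hQ (hPQ j))
    · simp only [lmul_coe]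
      exact τ.tendsto_norm_zero_of_sq
        (τ.tendsto_sq_sub_mul hP hQ hmono hPQ hlim x.mem x.sq_lt_top)

lemma isSideAction_rmul : IsSideAction τ hMN τ.rmul where
  one ξ := by
    induction ξ using UniformSpace.Completion.induction_on with
    | hp => exact isClosed_eq (by fun_prop) (by fun_prop)
    | ih x =>
      rw [rmul_coe]
      congr 1
  sub a b ξ := by
    induction ξ using UniformSpace.Completion.induction_on with
    | hp => exact isClosed_eq (by fun_prop) (by fun_prop)
    | ih x =>
      rw [rmul_coe, rmul_coe, rmul_coe, ← UniformSpace.Completion.coe_sub]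
      congr 1
      exact S2.val_injective (mul_sub _ _ _)
  mul a b c _ hba ξ := by
    induction ξ using UniformSpace.Completion.induction_on with
    | hp => exact isClosed_eq (by fun_prop) (by fun_prop)
    | ih x =>
      rw [rmul_coe, rmul_coe, rmul_coe, ← hba]
      congr 1
  norm_le := τ.norm_rmul_le
  commute a b _ ξ := by
    induction ξ using UniformSpace.Completion.induction_on with
    | hp => exact isClosed_eq (by fun_prop) (by fun_prop)
    | ih x =>
      rw [rmul_coe, lmul_coe, lmul_coe, rmul_coe]
      congr 1
  mem_L2sub a ξ hξ := by
    refine τ.mem_L2sub_of_coe (fun x hx => ?_) hξ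
    rw [rmul_coe]
    exact τ.coe_mem_L2sub (mul_mem hx a.2)
  tendsto P Q hP hQ hmono hPQ hlim ξ := by
    refine τ.tendsto_zero_of_coe (fun j ξ => ?_) (fun x => ?_) ξ
    · refine (τ.norm_rmul_le _ _).trans (mul_le_of_le_one_left (norm_nonneg _) ?_)
      exact IsStarProjection.norm_le _ ((hP j).sub_of_mul_eq_left hQ (hPQ j))
    · simp only [rmul_coe]
      refine τ.tendsto_norm_zero_of_sq ?_
      have hx : τ.sq (star (S2.val x)) < ∞ := by rw [τ.sq_star x.mem]; exact x.sq_lt_top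
      refine (τ.tendsto_sq_sub_mul hP hQ hmono hPQ hlim (star_mem x.mem) hx).congr fun j => ?_
      -- Taking adjoints turns the right multiplication into a left one.
      rw [← τ.sq_star (mul_mem (Q - P j).2 (star_mem x.mem)), star_mul, star_star]
      have : star ((Q - P j : N) : H →L[ℂ] H) = ((Q - P j : N) : H →L[ℂ] H) :=
        ((hP j).sub_of_mul_eq_left hQ (hPQ j)).isSelfAdjoint.star_eq
      rw [this]
      rfl

end NSFTrace

end Multiplication

/-! ### The truncated kernels -/

section TruncatedKernel

variable {n : ℕ}

lemma mem_dilate_iff {d : ℕ} (hd : 0 < d) {k : ℤ} {m : Fin n → ℤ} {x : Fin n → ℝ} :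
    x ∈ dilate d k m ↔ ∀ i, (2 : ℝ) ^ (-k) * (m i + 1 / 2 - d / 2) ≤ x i ∧
      x i < 2 ^ (-k) * (m i + 1 / 2 + d / 2) := by
  have hd' : (0 : ℝ) < d := by exact_mod_cast hd
  have hk : (0 : ℝ) < 2 ^ (-k) := by positivity
  constructor
  · rintro ⟨y, hy, rfl⟩ i
    have h := hy i
    simp only [center, Pi.add_apply, Pi.smul_apply, Pi.sub_apply, smul_eq_mul]
    constructor
    · nlinarith [mul_le_mul_of_nonneg_left h.1 hd'.le]
    · nlinarith [mul_lt_mul_of_pos_left h.2 hd']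
  · intro h
    refine ⟨center k m + (d : ℝ)⁻¹ • (x - center k m), fun i => ?_, ?_⟩
    · have hi := h i
      simp only [center, Pi.add_apply, Pi.smul_apply, Pi.sub_apply, smul_eq_mul]
      constructor
      · have : (d : ℝ)⁻¹ * (-(d / 2) * 2 ^ (-k)) ≤ (d : ℝ)⁻¹ * (x i - 2 ^ (-k) * (m i + 1 / 2)) :=
          mul_le_mul_of_nonneg_left (by linarith [hi.1]) (by positivity)
        have e : (d : ℝ)⁻¹ * (-(d / 2) * 2 ^ (-k)) = -(1 / 2) * 2 ^ (-k) := by field_simp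
        linarith
      · have : (d : ℝ)⁻¹ * (x i - 2 ^ (-k) * (m i + 1 / 2)) < (d : ℝ)⁻¹ * ((d / 2) * 2 ^ (-k)) :=
          mul_lt_mul_of_pos_left (by linarith [hi.2]) (by positivity)
        have e : (d : ℝ)⁻¹ * ((d / 2) * 2 ^ (-k)) = (1 / 2) * 2 ^ (-k) := by field_simp
        linarith
    · simp [smul_smul, hd'.ne']

/-- The double of a cube is a union of cubes of half its edge length. -/
lemma mem_dilate_two_iff {k : ℤ} {m : Fin n → ℤ} {x : Fin n → ℝ} :
    x ∈ dilate 2 k m ↔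
      ∀ i, 2 * m i - 1 ≤ cubeIndex (k + 1) x i ∧ cubeIndex (k + 1) x i < 2 * m i + 3 := by
  rw [mem_dilate_iff two_pos]
  refine forall_congr' fun i => ?_
  have hk : (0 : ℝ) < 2 ^ k := by positivity
  have e : (2 : ℝ) ^ (-k) = (2 ^ k)⁻¹ := zpow_neg _ _
  have e1 : (2 : ℝ) ^ (k + 1) = 2 * 2 ^ k := by rw [zpow_add_one₀ two_ne_zero, mul_comm]
  rw [cubeIndex, Int.le_floor, Int.floor_lt, e, inv_mul_le_iff₀ hk, lt_inv_mul_iff₀ hk, e1]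
  push_cast
  constructor <;> rintro ⟨h1, h2⟩ <;> constructor <;> linarith

lemma mem_dilate_five_iff {k : ℤ} {m : Fin n → ℤ} {x : Fin n → ℝ} :
    x ∈ dilate 5 k m ↔ ∀ i, m i - 2 ≤ cubeIndex k x i ∧ cubeIndex k x i < m i + 3 := by
  rw [mem_dilate_iff (by norm_num)]
  refine forall_congr' fun i => ?_
  have hk : (0 : ℝ) < 2 ^ k := by positivity
  have e : (2 : ℝ) ^ (-k) = (2 ^ k)⁻¹ := zpow_neg _ _
  rw [cubeIndex, Int.le_floor, Int.floor_lt, e, inv_mul_le_iff₀ hk, lt_inv_mul_iff₀ hk]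
  push_cast
  constructor <;> rintro ⟨h1, h2⟩ <;> constructor <;> linarith

lemma center_mem_cube (k : ℤ) (m : Fin n → ℤ) : center k m ∈ cube k m := by
  have hk : (0 : ℝ) < 2 ^ (-k) := by positivity
  intro i
  simp only [center]
  constructor <;> nlinarith

lemma norm_sub_center_le (k : ℤ) (y : Fin n → ℝ) :
    ‖y - center k (cubeIndex k y)‖ ≤ 2 ^ (-k) / 2 := by
  have hk : (0 : ℝ) < 2 ^ (-k) := by positivity
  refine (pi_norm_le_iff_of_nonneg (by positivity)).2 fun i => ?_
  have h := mem_cube_cubeIndex k y i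
  rw [Pi.sub_apply, Real.norm_eq_abs, abs_le, center]
  constructor <;> nlinarith [h.1, h.2]

lemma exists_of_notMem_dilate_two {k : ℤ} {m : Fin n → ℤ} {x : Fin n → ℝ}
    (h : x ∉ dilate 2 k m) :
    ∃ i, x i < 2 ^ (-k) * m i - 2 ^ (-k) / 2 ∨ 2 ^ (-k) * (m i + 1) + 2 ^ (-k) / 2 ≤ x i := by
  rw [mem_dilate_iff two_pos] at h
  push Not at h
  obtain ⟨i, hi⟩ := h
  refine ⟨i, ?_⟩
  by_cases hc : (2 : ℝ) ^ (-k) * (m i + 1 / 2 - (2 : ℕ) / 2) ≤ x i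
  · right
    refine le_trans (le_of_eq ?_) (hi hc)
    push_cast
    ring
  · left
    refine lt_of_lt_of_eq (not_le.1 hc) ?_
    push_cast
    ring

lemma le_norm_sub_of_notMem_dilate_two {k : ℤ} {x y : Fin n → ℝ}
    (h : x ∉ dilate 2 k (cubeIndex k y)) : 2 ^ (-k) / 2 ≤ ‖x - y‖ := by
  obtain ⟨i, hi⟩ := exists_of_notMem_dilate_two h
  have hy := mem_cube_cubeIndex k y i
  refine le_trans ?_ (norm_le_pi_norm (x - y) i)
  rw [Pi.sub_apply, Real.norm_eq_abs, le_abs]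
  rcases hi with hi | hi
  · right; linarith [hy.1]
  · left; linarith [hy.2]

lemma le_norm_sub_center {k : ℤ} (t : ℕ) {x y : Fin n → ℝ}
    (h : x ∉ dilate 2 k (cubeIndex k y)) :
    2 ^ (-k) / 2 + 2 ^ (-(k + t)) / 2 ≤ ‖x - center (k + t) (cubeIndex (k + t) y)‖ := by
  obtain ⟨i, hi⟩ := exists_of_notMem_dilate_two h
  set ρ : ℝ := 2 ^ (-(k + t : ℤ)) with hρ
  have hρ0 : 0 < ρ := by positivity
  have hk : (2 : ℝ) ^ (-k) = ρ * ((2 ^ t : ℕ) : ℤ) := by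
    rw [hρ, neg_add, zpow_add₀ two_ne_zero, mul_assoc, zpow_neg 2 (t : ℤ), zpow_natCast]
    push_cast
    rw [inv_mul_cancel₀ (by positivity), mul_one]
  have hdiv := cubeIndex_of_le (show k ≤ k + t by lia) y i
  rw [show (k + t - k).toNat = t by lia] at hdiv
  set m := cubeIndex k y i
  set m' := cubeIndex (k + t) y i
  set q : ℤ := ((2 ^ t : ℕ) : ℤ) with hq
  have hq0 : 0 < q := by positivity
  have h1 : q * m ≤ m' := by rw [hdiv]; exact Int.mul_ediv_self_le hq0.ne'
  have h2 : m' + 1 ≤ q * (m + 1) := by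
    have := Int.lt_mul_ediv_self_add (x := m') hq0
    rw [← hdiv] at this
    linarith
  have h1' : (q : ℝ) * m ≤ m' := by exact_mod_cast h1
  have h2' : (m' : ℝ) + 1 ≤ q * (m + 1) := by exact_mod_cast h2
  have h3 : 2 ^ (-k) * (m : ℝ) ≤ ρ * m' := by rw [hk]; nlinarith
  have h4 : ρ * (m' + 1) ≤ 2 ^ (-k) * ((m : ℝ) + 1) := by rw [hk]; nlinarith
  refine le_trans ?_ (norm_le_pi_norm _ i)
  rw [Pi.sub_apply, Real.norm_eq_abs, le_abs, center]
  rcases hi with hi | hi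
  · right; linarith
  · left; linarith

variable {V : Type*} [NormedAddCommGroup V]

open Classical in
/-- The kernel `K(x, y) - K(x, c(y))`, where `c(y)` is the centre of the cube of edge length
`2^{-k-t}` that contains `y`, cut off to the points `x` outside the double of the cube of edge length
`2^{-k}` that contains `y`. -/
noncomputable def truncKer (K : (Fin n → ℝ) → (Fin n → ℝ) → V) (t : ℕ) (k : ℤ)
    (x y : Fin n → ℝ) : V :=
  if x ∈ dilate 2 k (cubeIndex k y) then 0
  else K x y - K x (center (k + t) (cubeIndex (k + t) y))

lemma rpow_div_rpow_le_ker {γ : ℝ} {ρ d h : ℝ} (hρ : 0 ≤ ρ) (hd : 0 < d) (hh : 0 < h) (hγ : 0 < γ)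
    {u : Fin n → ℝ} (hu : h + ‖u‖ ≤ 4 * d) :
    ρ ^ γ / d ^ ((n : ℝ) + γ)
      ≤ 4 ^ ((n : ℝ) + γ) * (ρ / h) ^ γ * (h ^ γ / (h + ‖u‖) ^ ((n : ℝ) + γ)) := by
  have h0 : 0 < h + ‖u‖ := by positivity
  rw [Real.div_rpow hρ hh.le]
  have h1 : (h + ‖u‖) ^ ((n : ℝ) + γ) ≤ 4 ^ ((n : ℝ) + γ) * d ^ ((n : ℝ) + γ) := by
    rw [← Real.mul_rpow (by norm_num) hd.le]
    exact Real.rpow_le_rpow h0.le hu (by positivity)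
  have hhγ : 0 < h ^ γ := Real.rpow_pos_of_pos hh γ
  have e : 4 ^ ((n : ℝ) + γ) * (ρ ^ γ / h ^ γ) * (h ^ γ / (h + ‖u‖) ^ ((n : ℝ) + γ))
      = 4 ^ ((n : ℝ) + γ) * ρ ^ γ / (h + ‖u‖) ^ ((n : ℝ) + γ) := by field_simp
  rw [e, div_le_div_iff₀ (Real.rpow_pos_of_pos hd _) (Real.rpow_pos_of_pos h0 _)]
  have := Real.rpow_nonneg hρ γ
  calc ρ ^ γ * (h + ‖u‖) ^ ((n : ℝ) + γ)
      ≤ ρ ^ γ * (4 ^ ((n : ℝ) + γ) * d ^ ((n : ℝ) + γ)) := by gcongr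
    _ = _ := by ring

section Bounds

variable {γ : ℝ} (hγ : 0 < γ) {K : (Fin n → ℝ) → (Fin n → ℝ) → V}
include hγ

lemma norm_truncKer_le (h2 : ∀ x y z, ‖x - z‖ ≤ 1 / 2 * ‖y - z‖ →
      ‖K y x - K y z‖ ≤ ‖x - z‖ ^ γ / ‖y - z‖ ^ ((n : ℝ) + γ)) (t : ℕ) (k : ℤ)
    (x y : Fin n → ℝ) :
    ‖truncKer K t k x y‖ ≤ 4 ^ ((n : ℝ) + γ) * (2 ^ (-(t : ℤ))) ^ γ
      * ((2 ^ (-k)) ^ γ / (2 ^ (-k) + ‖x - y‖) ^ ((n : ℝ) + γ)) := by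
  rw [truncKer]
  split_ifs with hx
  · rw [norm_zero]
    positivity
  set c := center (k + t) (cubeIndex (k + t) y) with hc
  have hh : (0 : ℝ) < 2 ^ (-k) := by positivity
  have hρ : (0 : ℝ) < 2 ^ (-(k + t : ℤ)) := by positivity
  have hyc : ‖y - c‖ ≤ 2 ^ (-(k + t : ℤ)) / 2 := norm_sub_center_le (k + t) y
  have hxc := le_norm_sub_center t hx
  rw [← hc] at hxc
  have hρh : (2 : ℝ) ^ (-(k + t : ℤ)) ≤ 2 ^ (-k) := zpow_le_zpow_right₀ one_le_two (by lia)
  have hhalf : ‖y - c‖ ≤ 1 / 2 * ‖x - c‖ := by linarith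
  refine (h2 y x c hhalf).trans ?_
  have hxy : ‖x - y‖ ≤ ‖x - c‖ + ‖y - c‖ := by
    rw [← norm_neg (y - c), neg_sub]
    refine (le_of_eq ?_).trans (norm_add_le _ _)
    congr 1
    abel
  have e : (2 : ℝ) ^ (-(t : ℤ)) = 2 ^ (-(k + t : ℤ)) / 2 ^ (-k) := by
    rw [← zpow_sub₀ two_ne_zero]
    congr 1
    ring
  rw [e]
  have hmono : ‖y - c‖ ^ γ ≤ (2 ^ (-(k + t : ℤ))) ^ γ :=
    Real.rpow_le_rpow (norm_nonneg _) (by linarith) hγ.le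
  refine le_trans ?_ (rpow_div_rpow_le_ker hρ.le (by linarith : 0 < ‖x - c‖) hh hγ (by linarith))
  gcongr

lemma norm_truncKer_sub_le (h1 : ∀ x y z, ‖x - z‖ ≤ 1 / 2 * ‖y - z‖ →
      ‖K x y - K z y‖ ≤ ‖x - z‖ ^ γ / ‖y - z‖ ^ ((n : ℝ) + γ)) (t : ℕ) (k : ℤ) {j : ℕ}
    (hj : 2 ≤ j) {x z : Fin n → ℝ} (y : Fin n → ℝ)
    (hzx : cubeIndex (k + j) z = cubeIndex (k + j) x) :
    ‖truncKer K t k z y - truncKer K t k x y‖ ≤ 2 * (4 ^ ((n : ℝ) + γ) * (2 ^ (-(j : ℤ))) ^ γ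
      * ((2 ^ (-k)) ^ γ / (2 ^ (-k) + ‖x - y‖) ^ ((n : ℝ) + γ))) := by
  have hiff : z ∈ dilate 2 k (cubeIndex k y) ↔ x ∈ dilate 2 k (cubeIndex k y) := by
    rw [mem_dilate_two_iff, mem_dilate_two_iff,
      cubeIndex_eq_of_le (show k + 1 ≤ k + j by lia) hzx]
  rw [truncKer, truncKer]
  by_cases hx : x ∈ dilate 2 k (cubeIndex k y)
  · rw [if_pos (hiff.2 hx), if_pos hx, sub_zero, norm_zero]
    positivity
  rw [if_neg (fun hc => hx (hiff.1 hc)), if_neg hx]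
  set c := center (k + t) (cubeIndex (k + t) y) with hc
  have hh : (0 : ℝ) < 2 ^ (-k) := by positivity
  have hδ : (0 : ℝ) < 2 ^ (-(k + j : ℤ)) := by positivity
  have hzxn : ‖z - x‖ ≤ 2 ^ (-(k + j : ℤ)) := norm_sub_le_of_cubeIndex_eq hzx
  have hδh : (2 : ℝ) ^ (-(k + j : ℤ)) ≤ 2 ^ (-k) / 4 := by
    have : (2 : ℝ) ^ (-(k + j : ℤ)) ≤ 2 ^ (-k - 2) := zpow_le_zpow_right₀ one_le_two (by lia)
    rw [zpow_sub₀ two_ne_zero] at this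
    norm_num at this ⊢
    exact this
  have e : (2 : ℝ) ^ (-(j : ℤ)) = 2 ^ (-(k + j : ℤ)) / 2 ^ (-k) := by
    rw [← zpow_sub₀ two_ne_zero]
    congr 1
    ring
  have hxy : 2 ^ (-k) / 2 ≤ ‖y - x‖ := by
    rw [norm_sub_rev]
    exact le_norm_sub_of_notMem_dilate_two hx
  have hxc : 2 ^ (-k) / 2 + 2 ^ (-(k + t : ℤ)) / 2 ≤ ‖c - x‖ := by
    rw [norm_sub_rev]
    exact le_norm_sub_center t hx
  have hyc : ‖y - c‖ ≤ 2 ^ (-(k + t : ℤ)) / 2 := norm_sub_center_le (k + t) y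
  have hρ : (0 : ℝ) < 2 ^ (-(k + t : ℤ)) := by positivity
  have hρh : (2 : ℝ) ^ (-(k + t : ℤ)) ≤ 2 ^ (-k) := zpow_le_zpow_right₀ one_le_two (by lia)
  have hmono : ‖z - x‖ ^ γ ≤ (2 ^ (-(k + j : ℤ))) ^ γ :=
    Real.rpow_le_rpow (norm_nonneg _) hzxn hγ.le
  have hB : ∀ w, 2 ^ (-k) / 2 ≤ ‖w - x‖ → 2 ^ (-k) + ‖x - y‖ ≤ 4 * ‖w - x‖ →
      ‖K z w - K x w‖ ≤ 4 ^ ((n : ℝ) + γ) * (2 ^ (-(j : ℤ))) ^ γ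
      * ((2 ^ (-k)) ^ γ / (2 ^ (-k) + ‖x - y‖) ^ ((n : ℝ) + γ)) := by
    intro w hw hw4
    refine (h1 z w x (by linarith)).trans ?_
    rw [e]
    refine le_trans ?_ (rpow_div_rpow_le_ker hδ.le (by linarith : 0 < ‖w - x‖) hh hγ hw4)
    gcongr
  have h3 : ‖x - y‖ ≤ ‖c - x‖ + ‖y - c‖ := by
    rw [norm_sub_rev]
    refine (le_of_eq ?_).trans ((norm_add_le _ _).trans_eq (add_comm _ _))
    congr 1
    abel
  have hBy := hB y hxy (by rw [norm_sub_rev x y]; linarith)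
  have hBc := hB c (by linarith) (by linarith)
  have e2 : K z y - K z c - (K x y - K x c) = (K z y - K x y) - (K z c - K x c) := by abel
  rw [e2, two_mul]
  exact (norm_sub_le _ _).trans (add_le_add hBy hBc)

/-- The constant in the bounds for the truncated kernels. -/
noncomputable def truncConst (n : ℕ) (γ : ℝ) (t : ℕ) : ℝ≥0∞ :=
  ENNReal.ofReal (2 * 8 ^ ((n : ℝ) + γ) * 2 ^ (-(γ * t / 2)))

lemma enorm_truncKer_le (h2 : ∀ x y z, ‖x - z‖ ≤ 1 / 2 * ‖y - z‖ →
      ‖K y x - K y z‖ ≤ ‖x - z‖ ^ γ / ‖y - z‖ ^ ((n : ℝ) + γ)) (t : ℕ) (k : ℤ)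
    (x y : Fin n → ℝ) :
    ‖truncKer K t k x y‖ₑ ≤ truncConst n γ t * ker γ (2 ^ (-k)) (x - y) := by
  rw [← ofReal_norm, truncConst, ker, ← ENNReal.ofReal_mul (by positivity)]
  refine ENNReal.ofReal_le_ofReal ((norm_truncKer_le hγ h2 t k x y).trans ?_)
  have h48 : (4 : ℝ) ^ ((n : ℝ) + γ) ≤ 2 * 8 ^ ((n : ℝ) + γ) := by
    have : (4 : ℝ) ^ ((n : ℝ) + γ) ≤ 8 ^ ((n : ℝ) + γ) :=
      Real.rpow_le_rpow (by norm_num) (by norm_num) (by positivity)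
    linarith [Real.rpow_nonneg (show (0 : ℝ) ≤ 4 by norm_num) ((n : ℝ) + γ)]
  have hexp : ((2 : ℝ) ^ (-(t : ℤ))) ^ γ ≤ 2 ^ (-(γ * t / 2)) := by
    rw [← Real.rpow_intCast, ← Real.rpow_mul zero_le_two]
    refine Real.rpow_le_rpow_of_exponent_le one_le_two ?_
    push_cast
    nlinarith [mul_nonneg hγ.le (Nat.cast_nonneg (α := ℝ) t)]
  gcongr

lemma enorm_truncKer_sub_le (h1 : ∀ x y z, ‖x - z‖ ≤ 1 / 2 * ‖y - z‖ →
      ‖K x y - K z y‖ ≤ ‖x - z‖ ^ γ / ‖y - z‖ ^ ((n : ℝ) + γ))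
    (h2 : ∀ x y z, ‖x - z‖ ≤ 1 / 2 * ‖y - z‖ →
      ‖K y x - K y z‖ ≤ ‖x - z‖ ^ γ / ‖y - z‖ ^ ((n : ℝ) + γ)) (t : ℕ) (k : ℤ) {j : ℕ}
    (hj : 2 ≤ j) {x z : Fin n → ℝ} (y : Fin n → ℝ)
    (hzx : cubeIndex (k + j) z = cubeIndex (k + j) x) :
    ‖truncKer K t k z y - truncKer K t k x y‖ₑ ≤ truncConst n γ t
      * ENNReal.ofReal (2 ^ (-(γ / 4))) ^ (j + 1) * ker γ (2 ^ (-k)) (x - y) := by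
  rw [← ofReal_norm, truncConst, ker, ← ENNReal.ofReal_pow (by positivity),
    ← ENNReal.ofReal_mul (by positivity), ← ENNReal.ofReal_mul (by positivity)]
  refine ENNReal.ofReal_le_ofReal ?_
  have hh : (0 : ℝ) < 2 ^ (-k) := by positivity
  set Φ := (2 ^ (-k)) ^ γ / (2 ^ (-k) + ‖x - y‖) ^ ((n : ℝ) + γ) with hΦ
  have hΦ0 : 0 ≤ Φ := by positivity
  set A : ℝ := 2 * 8 ^ ((n : ℝ) + γ) with hA
  have h48 : (4 : ℝ) ^ ((n : ℝ) + γ) ≤ 8 ^ ((n : ℝ) + γ) :=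
    Real.rpow_le_rpow (by norm_num) (by norm_num) (by positivity)
  have h4p : (0 : ℝ) ≤ 4 ^ ((n : ℝ) + γ) := by positivity
  -- The smoothness in `x`.
  have hα := norm_truncKer_sub_le hγ h1 t k hj y hzx
  rw [← hΦ] at hα
  have hα' : ‖truncKer K t k z y - truncKer K t k x y‖ ≤ A * (2 ^ (-(j : ℤ))) ^ γ * Φ := by
    refine hα.trans ?_
    rw [hA]
    calc _ = 2 * 4 ^ ((n : ℝ) + γ) * (2 ^ (-(j : ℤ))) ^ γ * Φ := by ring
      _ ≤ _ := by gcongr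
  -- The smoothness in `y`.
  have hzxn : ‖z - x‖ ≤ 2 ^ (-k) :=
    (norm_sub_le_of_cubeIndex_eq hzx).trans (zpow_le_zpow_right₀ one_le_two (by lia))
  have hΦz : (2 ^ (-k)) ^ γ / (2 ^ (-k) + ‖z - y‖) ^ ((n : ℝ) + γ) ≤ 2 ^ ((n : ℝ) + γ) * Φ := by
    have h0 : (0 : ℝ) < 2 ^ (-k) + ‖z - y‖ := by positivity
    have h0' : (0 : ℝ) < 2 ^ (-k) + ‖x - y‖ := by positivity
    have htri : ‖x - y‖ ≤ ‖z - x‖ + ‖z - y‖ := by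
      rw [norm_sub_rev z x]
      refine (le_of_eq ?_).trans (norm_add_le _ _)
      congr 1
      abel
    have hle : (2 ^ (-k) + ‖x - y‖) ^ ((n : ℝ) + γ)
        ≤ 2 ^ ((n : ℝ) + γ) * (2 ^ (-k) + ‖z - y‖) ^ ((n : ℝ) + γ) := by
      rw [← Real.mul_rpow zero_le_two h0.le]
      exact Real.rpow_le_rpow h0'.le (by linarith [norm_nonneg (z - y)]) (by positivity)
    rw [hΦ, ← mul_div_assoc, div_le_div_iff₀ (Real.rpow_pos_of_pos h0 _)
      (Real.rpow_pos_of_pos h0' _)]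
    have : 0 ≤ ((2 : ℝ) ^ (-k)) ^ γ := by positivity
    nlinarith
  have hβ' : ‖truncKer K t k z y - truncKer K t k x y‖ ≤ A * (2 ^ (-(t : ℤ))) ^ γ * Φ := by
    refine (norm_sub_le _ _).trans ((add_le_add (norm_truncKer_le hγ h2 t k z y)
      (norm_truncKer_le hγ h2 t k x y)).trans ?_)
    rw [← hΦ]
    have e8 : (8 : ℝ) ^ ((n : ℝ) + γ) = 4 ^ ((n : ℝ) + γ) * 2 ^ ((n : ℝ) + γ) := by
      rw [← Real.mul_rpow (by norm_num) (by norm_num)]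
      norm_num
    have hτ : 0 ≤ ((2 : ℝ) ^ (-(t : ℤ))) ^ γ := by positivity
    calc _ ≤ 4 ^ ((n : ℝ) + γ) * (2 ^ (-(t : ℤ))) ^ γ * (2 ^ ((n : ℝ) + γ) * Φ)
          + 8 ^ ((n : ℝ) + γ) * (2 ^ (-(t : ℤ))) ^ γ * Φ := by gcongr
      _ = _ := by rw [hA, e8]; ring
  -- The geometric mean of the two bounds.
  have hej : ((2 : ℝ) ^ (-(j : ℤ))) ^ γ = (2 ^ (-(γ * j / 2))) ^ 2 := by
    rw [← Real.rpow_intCast, ← Real.rpow_mul zero_le_two, ← Real.rpow_natCast,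
      ← Real.rpow_mul zero_le_two]
    congr 1
    push_cast
    ring
  have het : ((2 : ℝ) ^ (-(t : ℤ))) ^ γ = (2 ^ (-(γ * t / 2))) ^ 2 := by
    rw [← Real.rpow_intCast, ← Real.rpow_mul zero_le_two, ← Real.rpow_natCast,
      ← Real.rpow_mul zero_le_two]
    congr 1
    push_cast
    ring
  rw [hej] at hα'
  rw [het] at hβ'
  set p : ℝ := 2 ^ (-(γ * j / 2)) with hp
  set q : ℝ := 2 ^ (-(γ * t / 2)) with hq
  have hp0 : 0 < p := by positivity
  have hq0 : 0 < q := by positivity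
  have hA0 : 0 ≤ A := by positivity
  have hmin : ‖truncKer K t k z y - truncKer K t k x y‖ ≤ A * q * p * Φ := by
    rcases le_total p q with hpq | hpq
    · refine hα'.trans ?_
      rw [_root_.sq]
      calc A * (p * p) * Φ ≤ A * (q * p) * Φ := by gcongr
        _ = _ := by ring
    · refine hβ'.trans ?_
      rw [_root_.sq]
      calc A * (q * q) * Φ ≤ A * (q * p) * Φ := by gcongr
        _ = _ := by ring
  refine hmin.trans ?_
  have hpr : p ≤ (2 ^ (-(γ / 4))) ^ (j + 1) := by
    rw [hp, ← Real.rpow_natCast, ← Real.rpow_mul zero_le_two]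
    refine Real.rpow_le_rpow_of_exponent_le one_le_two ?_
    have hj1 : (2 : ℝ) ≤ j := by exact_mod_cast hj
    push_cast
    nlinarith
  gcongr

end Bounds

end TruncatedKernel

section TruncatedKernelOperator

variable {n : ℕ} {V : Type*} [NormedAddCommGroup V]

/-- A kernel with the smoothness of a Calderón-Zygmund kernel is continuous off the diagonal. -/
lemma continuousAt_kernel {γ : ℝ} (hγ : 0 < γ) {K : (Fin n → ℝ) → (Fin n → ℝ) → V}
    (h1 : ∀ x y z, ‖x - z‖ ≤ 1 / 2 * ‖y - z‖ →
      ‖K x y - K z y‖ ≤ ‖x - z‖ ^ γ / ‖y - z‖ ^ ((n : ℝ) + γ))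
    (h2 : ∀ x y z, ‖x - z‖ ≤ 1 / 2 * ‖y - z‖ →
      ‖K y x - K y z‖ ≤ ‖x - z‖ ^ γ / ‖y - z‖ ^ ((n : ℝ) + γ))
    {p : (Fin n → ℝ) × (Fin n → ℝ)} (hp : p.1 ≠ p.2) :
    ContinuousAt (Function.uncurry K) p := by
  obtain ⟨x₀, y₀⟩ := p
  have hne : 0 < ‖x₀ - y₀‖ := norm_pos_iff.2 (sub_ne_zero.2 hp)
  rw [ContinuousAt, tendsto_iff_norm_sub_tendsto_zero]
  have hlim : Filter.Tendsto (fun q : (Fin n → ℝ) × (Fin n → ℝ) =>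
      ‖q.1 - x₀‖ ^ γ / ‖q.2 - x₀‖ ^ ((n : ℝ) + γ) + ‖q.2 - y₀‖ ^ γ / ‖x₀ - y₀‖ ^ ((n : ℝ) + γ))
      (nhds (x₀, y₀)) (nhds 0) := by
    have hc1 : Filter.Tendsto (fun q : (Fin n → ℝ) × (Fin n → ℝ) => ‖q.1 - x₀‖ ^ γ)
        (nhds (x₀, y₀)) (nhds 0) := by
      have : ContinuousAt (fun q : (Fin n → ℝ) × (Fin n → ℝ) => ‖q.1 - x₀‖ ^ γ) (x₀, y₀) :=
        ContinuousAt.rpow_const (by fun_prop) (Or.inr hγ.le)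
      simpa [ContinuousAt, Real.zero_rpow hγ.ne'] using this
    have hc2 : Filter.Tendsto (fun q : (Fin n → ℝ) × (Fin n → ℝ) => ‖q.2 - y₀‖ ^ γ)
        (nhds (x₀, y₀)) (nhds 0) := by
      have : ContinuousAt (fun q : (Fin n → ℝ) × (Fin n → ℝ) => ‖q.2 - y₀‖ ^ γ) (x₀, y₀) :=
        ContinuousAt.rpow_const (by fun_prop) (Or.inr hγ.le)
      simpa [ContinuousAt, Real.zero_rpow hγ.ne'] using this
    have hc3 : Filter.Tendsto (fun q : (Fin n → ℝ) × (Fin n → ℝ) => ‖q.2 - x₀‖ ^ ((n : ℝ) + γ))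
        (nhds (x₀, y₀)) (nhds (‖y₀ - x₀‖ ^ ((n : ℝ) + γ))) :=
      ContinuousAt.rpow_const (by fun_prop) (Or.inr (by positivity))
    have hne' : ‖y₀ - x₀‖ ^ ((n : ℝ) + γ) ≠ 0 := by
      rw [norm_sub_rev]
      exact (Real.rpow_pos_of_pos hne _).ne'
    have := (hc1.div hc3 hne').add (hc2.div_const (‖x₀ - y₀‖ ^ ((n : ℝ) + γ)))
    simpa using this
  have e1 : ∀ᶠ q : (Fin n → ℝ) × (Fin n → ℝ) in nhds (x₀, y₀),
      ‖q.1 - x₀‖ < 1 / 2 * ‖q.2 - x₀‖ := by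
    refine ContinuousAt.eventually_lt (by fun_prop) (by fun_prop) ?_
    rw [sub_self, norm_zero, norm_sub_rev]
    positivity
  have e2 : ∀ᶠ q : (Fin n → ℝ) × (Fin n → ℝ) in nhds (x₀, y₀),
      ‖q.2 - y₀‖ < 1 / 2 * ‖x₀ - y₀‖ := by
    refine ContinuousAt.eventually_lt (by fun_prop) (by fun_prop) ?_
    rw [sub_self, norm_zero]
    positivity
  refine squeeze_zero' (Filter.Eventually.of_forall fun _ => norm_nonneg _) ?_ hlim
  filter_upwards [e1, e2] with q hq1 hq2
  calc ‖K q.1 q.2 - K x₀ y₀‖ = ‖(K q.1 q.2 - K x₀ q.2) + (K x₀ q.2 - K x₀ y₀)‖ := by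
        rw [sub_add_sub_cancel]
    _ ≤ _ := (norm_add_le _ _).trans (add_le_add (h1 _ _ _ hq1.le) (h2 _ _ _ hq2.le))

lemma stronglyMeasurable_truncKer {γ : ℝ} (hγ : 0 < γ) {K : (Fin n → ℝ) → (Fin n → ℝ) → V}
    (h1 : ∀ x y z, ‖x - z‖ ≤ 1 / 2 * ‖y - z‖ →
      ‖K x y - K z y‖ ≤ ‖x - z‖ ^ γ / ‖y - z‖ ^ ((n : ℝ) + γ))
    (h2 : ∀ x y z, ‖x - z‖ ≤ 1 / 2 * ‖y - z‖ →
      ‖K y x - K y z‖ ≤ ‖x - z‖ ^ γ / ‖y - z‖ ^ ((n : ℝ) + γ)) (t : ℕ) (k : ℤ) :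
    StronglyMeasurable (Function.uncurry (truncKer K t k)) := by
  -- Off the diagonal `K` agrees with a strongly measurable function `K'`.
  obtain ⟨K', hK', hKK'⟩ : ∃ K' : (Fin n → ℝ) × (Fin n → ℝ) → V, StronglyMeasurable K' ∧
      ∀ p : (Fin n → ℝ) × (Fin n → ℝ), p.1 ≠ p.2 → K' p = K p.1 p.2 := by
    set D : Set ((Fin n → ℝ) × (Fin n → ℝ)) := {p | p.1 ≠ p.2} with hD
    have hDm : MeasurableSet D := (isOpen_ne_fun continuous_fst continuous_snd).measurableSet
    have hc : Continuous fun p : D => Function.uncurry K p := by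
      refine continuous_iff_continuousAt.2 fun p => ?_
      exact (continuousAt_kernel hγ h1 h2 p.2).comp continuous_subtype_val.continuousAt
    obtain ⟨K', hK', he⟩ := (MeasurableEmbedding.subtype_coe hDm).exists_stronglyMeasurable_extend
      hc.stronglyMeasurable fun _ => ⟨0⟩
    exact ⟨K', hK', fun p hp => congrFun he ⟨p, hp⟩⟩
  set S : Set ((Fin n → ℝ) × (Fin n → ℝ)) := {p | p.1 ∉ dilate 2 k (cubeIndex k p.2)} with hS
  have hSm : MeasurableSet S := by
    have hm : Measurable fun p : (Fin n → ℝ) × (Fin n → ℝ) =>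
        (cubeIndex (k + 1) p.1, cubeIndex k p.2) :=
      ((measurable_cubeIndex _).comp measurable_fst).prodMk
        ((measurable_cubeIndex _).comp measurable_snd)
    have : S = (fun p : (Fin n → ℝ) × (Fin n → ℝ) => (cubeIndex (k + 1) p.1, cubeIndex k p.2)) ⁻¹'
        {q | ¬ ∀ i, 2 * q.2 i - 1 ≤ q.1 i ∧ q.1 i < 2 * q.2 i + 3} := by
      ext p
      simp only [hS, mem_dilate_two_iff, Set.mem_preimage, Set.mem_ofPred_eq]
    rw [this]
    exact hm (Set.to_countable _).measurableSet
  have hcm : Measurable fun p : (Fin n → ℝ) × (Fin n → ℝ) =>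
      (p.1, center (k + t) (cubeIndex (k + t) p.2)) :=
    measurable_fst.prodMk ((stronglyMeasurable_comp_cubeIndex (k + t)
      (center (k + t))).measurable.comp measurable_snd)
  have hmain := (hK'.sub (hK'.comp_measurable hcm)).indicator hSm
  convert! hmain using 1
  funext p
  obtain ⟨x, y⟩ := p
  simp only [Function.uncurry_apply_pair, truncKer]
  have hh : (0 : ℝ) < 2 ^ (-k) := by positivity
  have hρ : (0 : ℝ) < 2 ^ (-(k + t : ℤ)) := by positivity
  by_cases hx : x ∈ dilate 2 k (cubeIndex k y)
  · rw [if_pos hx, Set.indicator_of_notMem (by simpa [hS] using hx)]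
  · rw [if_neg hx, Set.indicator_of_mem (show (x, y) ∈ S from hx)]
    have hxy := le_norm_sub_of_notMem_dilate_two hx
    have hxc := le_norm_sub_center t hx
    simp only [Pi.sub_apply, Function.comp]
    rw [hKK' (x, y), hKK']
    · intro hc
      simp only at hc
      rw [← hc, sub_self, norm_zero] at hxc
      linarith
    · intro hc
      simp only at hc
      rw [hc, sub_self, norm_zero] at hxy
      linarith

variable {E : Type*} [NormedAddCommGroup E] [NormedSpace ℂ E]

lemma truncConst_ne_top (γ : ℝ) (t : ℕ) : truncConst n γ t ≠ ∞ := ENNReal.ofReal_ne_top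

lemma StronglyMeasurable.clm_apply {α : Type*} [MeasurableSpace α] {F : Type*}
    [NormedAddCommGroup F] [NormedSpace ℂ F] {φ : α → E →L[ℂ] F} {g : α → E}
    (hφ : StronglyMeasurable φ) (hg : StronglyMeasurable g) :
    StronglyMeasurable fun x => φ x (g x) :=
  (isBoundedBilinearMap_apply (𝕜 := ℂ) (E := E) (F := F)).continuous.comp_stronglyMeasurable
    (hφ.prodMk hg)

lemma isScaleKernel_truncKer {γ : ℝ} (hγ : 0 < γ) {K : (Fin n → ℝ) → (Fin n → ℝ) → E →L[ℂ] E}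
    (h1 : ∀ x y z, ‖x - z‖ ≤ 1 / 2 * ‖y - z‖ →
      ‖K x y - K z y‖ ≤ ‖x - z‖ ^ γ / ‖y - z‖ ^ ((n : ℝ) + γ))
    (h2 : ∀ x y z, ‖x - z‖ ≤ 1 / 2 * ‖y - z‖ →
      ‖K y x - K y z‖ ≤ ‖x - z‖ ^ γ / ‖y - z‖ ^ ((n : ℝ) + γ)) (t : ℕ) (k : ℤ)
    {g : (Fin n → ℝ) → E} (hg : StronglyMeasurable g) (hg2 : MemLp g 2) :
    IsScaleKernel γ (truncConst n γ t) k g fun x y => truncKer K t k x y (g y) where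
  stronglyMeasurable := StronglyMeasurable.clm_apply (stronglyMeasurable_truncKer hγ h1 h2 t k)
    (hg.comp_measurable measurable_snd)
  stronglyMeasurable_right := hg
  memLp := hg2
  ne_top := truncConst_ne_top γ t
  size x y := by
    refine (ContinuousLinearMap.le_opENorm _ _).trans ?_
    rw [← mul_assoc]
    exact mul_le_mul_left (enorm_truncKer_le hγ h2 t k x y) _
  smooth j x z y hj hzx := by
    rw [← _root_.sub_apply]
    refine (ContinuousLinearMap.le_opENorm _ _).trans ?_
    rw [← mul_assoc]
    exact mul_le_mul_left (enorm_truncKer_sub_le hγ h1 h2 t k hj y hzx) _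

/-- The centres of the small cubes do not contribute to the integral of a function whose integral
over each small cube vanishes. -/
lemma integral_kernel_eq_truncKer [CompleteSpace E] {γ : ℝ} (hγ : 0 < γ)
    {K : (Fin n → ℝ) → (Fin n → ℝ) → E →L[ℂ] E} (h0 : ∀ x y, x ≠ y → ‖K x y‖ ≤ 1 / ‖x - y‖ ^ n)
    (h1 : ∀ x y z, ‖x - z‖ ≤ 1 / 2 * ‖y - z‖ →
      ‖K x y - K z y‖ ≤ ‖x - z‖ ^ γ / ‖y - z‖ ^ ((n : ℝ) + γ))
    (h2 : ∀ x y z, ‖x - z‖ ≤ 1 / 2 * ‖y - z‖ →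
      ‖K y x - K y z‖ ≤ ‖x - z‖ ^ γ / ‖y - z‖ ^ ((n : ℝ) + γ)) (t : ℕ) (k : ℤ) (m : Fin n → ℤ)
    {g : (Fin n → ℝ) → E} (hg : StronglyMeasurable g) (hg2 : MemLp g 2)
    (hgm : ∀ y, y ∉ cube k m → g y = 0)
    (hmean : ∀ m', ∫ y in cube (k + t) m', g y = 0) {x : Fin n → ℝ} (hx : x ∉ dilate 2 k m) :
    ∫ y, K x y (g y) = ∫ y, truncKer K t k x y (g y) := by
  have hh : (0 : ℝ) < 2 ^ (-k) := by positivity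
  have hker := isScaleKernel_truncKer hγ h1 h2 t k hg hg2
  have hgi : Integrable g := by
    rw [← integrableOn_iff_integrable_of_support_subset (s := cube k m)]
    · exact integrableOn_cube hg2 k m
    · intro y hy
      by_contra hc
      exact hy (hgm y hc)
  set c : (Fin n → ℝ) → Fin n → ℝ := fun y => center (k + t) (cubeIndex (k + t) y) with hc
  have hxc : ∀ y ∈ cube k m, 2 ^ (-k) / 2 ≤ ‖x - c y‖ := fun y hy => by
    have hρ : (0 : ℝ) < 2 ^ (-(k + t : ℤ)) := by positivity
    have := le_norm_sub_center t (x := x) (y := y) (by rwa [mem_cube_iff.1 hy])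
    rw [hc]
    linarith
  have hKcm : StronglyMeasurable fun y => K x (c y) :=
    stronglyMeasurable_comp_cubeIndex (k + t) fun m => K x (center (k + t) m)
  have hint : Integrable fun y => K x (c y) (g y) := by
    refine Integrable.mono' (hgi.norm.const_mul (1 / (2 ^ (-k) / 2) ^ n))
      (StronglyMeasurable.clm_apply hKcm hg).aestronglyMeasurable
      (Filter.Eventually.of_forall fun y => ?_)
    by_cases hy : y ∈ cube k m
    · refine (ContinuousLinearMap.le_opNorm _ _).trans ?_
      have hd := hxc y hy
      have hne : x ≠ c y := fun hc => by
        rw [← hc, sub_self, norm_zero] at hd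
        linarith
      gcongr
      refine (h0 x _ hne).trans ?_
      gcongr
    · simp [hgm y hy]
  have hzero : ∫ y, K x (c y) (g y) = 0 := by
    rw [← setIntegral_univ]
    refine setIntegral_eq_zero_of_cube (k + t) MeasurableSet.univ (fun _ _ _ _ => Set.mem_univ _)
      hint.integrableOn fun y _ => ?_
    have : ∀ z ∈ cube (k + t) (cubeIndex (k + t) y), K x (c z) (g z) = K x (c y) (g z) :=
      fun z hz => by simp only [hc, mem_cube_iff.1 hz]
    rw [setIntegral_congr_fun (measurableSet_cube _ _) this,
      ContinuousLinearMap.integral_comp_comm _ hgi.integrableOn, hmean, _root_.map_zero]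
  have hsplit : ∀ y, K x y (g y) = truncKer K t k x y (g y) + K x (c y) (g y) := by
    intro y
    by_cases hy : y ∈ cube k m
    · have hx' : x ∉ dilate 2 k (cubeIndex k y) := by rwa [mem_cube_iff.1 hy]
      rw [truncKer, if_neg hx', _root_.sub_apply, sub_add_cancel]
    · simp [hgm y hy]
  rw [integral_congr_ae (Filter.Eventually.of_forall hsplit),
    integral_add (hker.integrable_right hγ x) hint, hzero, add_zero]

end TruncatedKernelOperator

/-! ### Transfer from the truncated kernels to the operator -/

section Transfer

attribute [local instance] InnerProductSpace.complexToReal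

section Fixed

variable {E : Type*} [NormedAddCommGroup E] [InnerProductSpace ℂ E]

/-- For a contraction, its fixed vectors are orthogonal to its kernel. -/
lemma inner_eq_zero_of_contraction {P : E →L[ℂ] E} (hP : ∀ ξ, ‖P ξ‖ ≤ ‖ξ‖) {ξ η : E}
    (hξ : P ξ = ξ) (hη : P η = 0) : inner ℝ ξ η = 0 := by
  -- `‖ξ‖ = ‖P (ξ + r η)‖ ≤ ‖ξ + r η‖` for every real `r`.
  have h : ∀ r : ℝ, 0 ≤ 2 * r * inner ℝ ξ η + r ^ 2 * ‖η‖ ^ 2 := by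
    intro r
    have h1 := hP (ξ + r • η)
    have h2 : P (ξ + r • η) = ξ := by
      rw [_root_.map_add, hξ, ← Complex.coe_smul, _root_.map_smul, hη, smul_zero, add_zero]
    rw [h2] at h1
    have h3 := norm_add_sq_real ξ (r • η)
    rw [inner_smul_right, norm_smul, mul_pow, Real.norm_eq_abs, sq_abs] at h3
    have h4 : ‖ξ‖ ^ 2 ≤ ‖ξ + r • η‖ ^ 2 := pow_le_pow_left₀ (norm_nonneg _) h1 2
    linarith
  by_contra hc
  set c := inner ℝ ξ η with hcdef
  have hpos : 0 < 1 + ‖η‖ ^ 2 := by positivity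
  have h1 := h (-(c / (1 + ‖η‖ ^ 2)))
  have hc2 : 0 < c ^ 2 := by positivity
  have h2 : 2 * -(c / (1 + ‖η‖ ^ 2)) * c + (-(c / (1 + ‖η‖ ^ 2))) ^ 2 * ‖η‖ ^ 2
      = -(c ^ 2 * (2 + ‖η‖ ^ 2) / (1 + ‖η‖ ^ 2) ^ 2) := by
    field_simp
    ring
  rw [h2] at h1
  have h3 : 0 < c ^ 2 * (2 + ‖η‖ ^ 2) / (1 + ‖η‖ ^ 2) ^ 2 := by positivity
  linarith

variable [CompleteSpace E]

/-- The integral of a function with values in the fixed space of `P` is fixed by `P`. If the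
function is not integrable, this holds because its integral is zero by convention. -/
lemma map_integral_eq_of_fixed {α : Type*} [MeasurableSpace α] {μ : Measure α} {P : E →L[ℂ] E}
    {h : α → E} (hh : ∀ᵐ z ∂μ, P (h z) = h z) : P (∫ z, h z ∂μ) = ∫ z, h z ∂μ := by
  by_cases hi : Integrable h μ
  · rw [← P.integral_comp_comm hi]
    exact integral_congr_ae hh
  · rw [integral_undef hi, _root_.map_zero]

lemma map_condAvg_eq_of_fixed {n : ℕ} {P : E →L[ℂ] E} (k : ℤ) {h : (Fin n → ℝ) → E}
    (x : Fin n → ℝ) (hh : ∀ z, cubeIndex k z = cubeIndex k x → P (h z) = h z) :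
    P (condAvg k h x) = condAvg k h x := by
  rw [condAvg, setAverage_eq, ← Complex.coe_smul, _root_.map_smul, map_integral_eq_of_fixed]
  filter_upwards [ae_restrict_mem (measurableSet_cube _ _)] with z hz using hh z (mem_cube_iff.1 hz)

end Fixed

section Main

variable {n : ℕ} {E : Type*} [NormedAddCommGroup E] [InnerProductSpace ℂ E] [CompleteSpace E]
  {F : Submodule ℂ E}

omit [CompleteSpace E] in
lemma exists_Lp_of_memLp {g : (Fin n → ℝ) → E} (hg : MemLp g 2) (hF : ∀ y, g y ∈ F) :
    ∃ φ : Lp F 2 (volume : Measure (Fin n → ℝ)), ∀ᵐ y, (φ y : E) = g y := by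
  have hm : MemLp (fun y => (⟨g y, hF y⟩ : F)) 2 (volume : Measure (Fin n → ℝ)) := by
    refine ⟨(Topology.IsEmbedding.subtypeVal.aestronglyMeasurable_comp_iff
      (f := fun y => (⟨g y, hF y⟩ : F))).1 hg.1, ?_⟩
    exact hg.2
  refine ⟨hm.toLp _, ?_⟩
  filter_upwards [hm.coeFn_toLp] with y hy
  rw [hy]

omit [CompleteSpace E] in
lemma Lp_coe_injective {φ ψ : Lp F 2 (volume : Measure (Fin n → ℝ))}
    (h : ∀ᵐ y, (φ y : E) = ψ y) : φ = ψ :=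
  Lp.ext (h.mono fun _ hy => Subtype.ext hy)

/-- For a function `g` that lives on one cube, `T g` is, after the projections `p` are applied, given
by the truncated kernel: near the cube both sides vanish, because `p` annihilates the range of `D`,
and away from the cube `T` is given by its kernel. -/
lemma ae_apply_eq_truncKer {γ : ℝ} (hγ : 0 < γ) {K : (Fin n → ℝ) → (Fin n → ℝ) → E →L[ℂ] E}
    (h0 : ∀ x y, x ≠ y → ‖K x y‖ ≤ 1 / ‖x - y‖ ^ n)
    (h1 : ∀ x y z, ‖x - z‖ ≤ 1 / 2 * ‖y - z‖ →
      ‖K x y - K z y‖ ≤ ‖x - z‖ ^ γ / ‖y - z‖ ^ ((n : ℝ) + γ))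
    (h2 : ∀ x y z, ‖x - z‖ ≤ 1 / 2 * ‖y - z‖ →
      ‖K y x - K y z‖ ≤ ‖x - z‖ ^ γ / ‖y - z‖ ^ ((n : ℝ) + γ))
    {T : Lp F 2 (volume : Measure (Fin n → ℝ)) →L[ℂ] Lp E 2 (volume : Measure (Fin n → ℝ))}
    (hT : ∀ (S : Set (Fin n → ℝ)) (f : Lp F 2 (volume : Measure (Fin n → ℝ))),
      IsCompact S → (∀ᵐ y, y ∉ S → f y = 0) → ∀ᵐ x, x ∉ S → T f x = ∫ y, K x y (f y : E))
    (t : ℕ) (k : ℤ) (m : Fin n → ℤ) {D : E →L[ℂ] E}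
    (hmod : ∀ f g : Lp F 2 (volume : Measure (Fin n → ℝ)), (∀ᵐ x, (g x : E) = D (f x)) →
      ∀ᵐ x, T g x = D (T f x))
    {p : (Fin n → ℝ) → E →L[ℂ] E} (hp : ∀ x ∈ dilate 2 k m, ∀ ξ, p x (D ξ) = 0)
    {g : (Fin n → ℝ) → E} (hg : StronglyMeasurable g) (hg2 : MemLp g 2)
    (hgm : ∀ y, y ∉ cube k m → g y = 0) (hD : ∀ y, D (g y) = g y)
    (hmean : ∀ m', ∫ y in cube (k + t) m', g y = 0)
    {φ : Lp F 2 (volume : Measure (Fin n → ℝ))} (hφ : ∀ᵐ y, (φ y : E) = g y) :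
    ∀ᵐ x, p x (T φ x) = p x (∫ y, truncKer K t k x y (g y)) := by
  set S : Set (Fin n → ℝ) :=
    Set.Icc (fun i => (2 : ℝ) ^ (-k) * m i) fun i => (2 : ℝ) ^ (-k) * (m i + 1) with hS
  have hSd : S ⊆ dilate 2 k m := by
    intro x hx
    rw [mem_dilate_iff two_pos]
    intro i
    have hk : (0 : ℝ) < 2 ^ (-k) := by positivity
    have hx1 : (2 : ℝ) ^ (-k) * m i ≤ x i := hx.1 i
    have hx2 : x i ≤ (2 : ℝ) ^ (-k) * (m i + 1) := hx.2 i
    push_cast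
    constructor <;> nlinarith
  have hcS : cube k m ⊆ S := fun x hx => ⟨fun i => (hx i).1, fun i => (hx i).2.le⟩
  have hker := hT S φ isCompact_Icc (hφ.mono fun y hy hyS => by
    have : (φ y : E) = 0 := by rw [hy, hgm y fun hc => hyS (hcS hc)]
    exact_mod_cast this)
  have hfix := hmod φ φ (hφ.mono fun y hy => by rw [hy, hD])
  filter_upwards [hker, hfix] with x hx1 hx2
  by_cases hx : x ∈ dilate 2 k m
  · have e1 : ∀ y, truncKer K t k x y (g y) = 0 := by
      intro y
      by_cases hy : y ∈ cube k m
      · rw [truncKer, if_pos (by rwa [mem_cube_iff.1 hy]), _root_.zero_apply]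
      · rw [hgm y hy, _root_.map_zero]
    simp only [e1, integral_zero]
    rw [hx2, hp x hx, _root_.map_zero]
  · rw [hx1 fun hc => hx (hSd hc), ← integral_kernel_eq_truncKer hγ h0 h1 h2 t k m hg hg2 hgm
      hmean hx]
    congr 1
    refine integral_congr_ae (hφ.mono fun y hy => ?_)
    simp only [hy]

/-- The estimate for a function which is a finite sum of pieces `g k`, where `g k` lies in the range
of the projections `D k`, has mean zero on the cubes of level `k + t`, and vanishes outside finitely
many cubes of level `k`. -/
theorem eLpNorm_apply_le_of_sum (hn : 0 < n) {γ : ℝ} (hγ : 0 < γ) (hγ1 : γ ≤ 1)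
    {K : (Fin n → ℝ) → (Fin n → ℝ) → E →L[ℂ] E}
    (h0 : ∀ x y, x ≠ y → ‖K x y‖ ≤ 1 / ‖x - y‖ ^ n)
    (h1 : ∀ x y z, ‖x - z‖ ≤ 1 / 2 * ‖y - z‖ →
      ‖K x y - K z y‖ ≤ ‖x - z‖ ^ γ / ‖y - z‖ ^ ((n : ℝ) + γ))
    (h2 : ∀ x y z, ‖x - z‖ ≤ 1 / 2 * ‖y - z‖ →
      ‖K y x - K y z‖ ≤ ‖x - z‖ ^ γ / ‖y - z‖ ^ ((n : ℝ) + γ))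
    {T : Lp F 2 (volume : Measure (Fin n → ℝ)) →L[ℂ] Lp E 2 (volume : Measure (Fin n → ℝ))}
    (hT : ∀ (S : Set (Fin n → ℝ)) (f : Lp F 2 (volume : Measure (Fin n → ℝ))),
      IsCompact S → (∀ᵐ y, y ∉ S → f y = 0) → ∀ᵐ x, x ∉ S → T f x = ∫ y, K x y (f y : E))
    (t : ℕ) (S : Finset ℤ) {D : ℤ → (Fin n → ℤ) → E →L[ℂ] E}
    (hmod : ∀ k m, ∀ f g : Lp F 2 (volume : Measure (Fin n → ℝ)),
      (∀ᵐ x, (g x : E) = D k m (f x)) → ∀ᵐ x, T g x = D k m (T f x))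
    (hDK : ∀ k m x y ξ, D k m (K x y ξ) = K x y (D k m ξ))
    (hDle : ∀ k m ξ, ‖D k m ξ‖ ≤ ‖ξ‖)
    (hDD : ∀ i ∈ S, ∀ j ∈ S, i ≠ j → ∀ x ξ, D i (cubeIndex i x) (D j (cubeIndex j x) ξ) = 0)
    {p : (Fin n → ℝ) → E →L[ℂ] E} (hple : ∀ x ξ, ‖p x ξ‖ ≤ ‖ξ‖)
    (hp : ∀ k ∈ S, ∀ m, ∀ x ∈ dilate 2 k m, ∀ ξ, p x (D k m ξ) = 0)
    {g : ℤ → (Fin n → ℝ) → E} (hg : ∀ k, StronglyMeasurable (g k)) (hg2 : ∀ k, MemLp (g k) 2)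
    (hgF : ∀ k y, g k y ∈ F) (R : ℤ → Finset (Fin n → ℤ))
    (hgR : ∀ k y, cubeIndex k y ∉ R k → g k y = 0)
    (hgD : ∀ k y, D k (cubeIndex k y) (g k y) = g k y)
    (hmean : ∀ k ∈ S, ∀ m, ∫ y in cube (k + t) m, g k y = 0)
    {f : Lp F 2 (volume : Measure (Fin n → ℝ))} (hf : ∀ᵐ y, (f y : E) = ∑ k ∈ S, g k y) :
    eLpNorm (fun x => p x (T f x)) 2 volume
      ≤ truncConst n γ t * scaleConst n γ * eLpNorm f 2 volume := by
  have hcub : ∀ k m, StronglyMeasurable ((cube k m).indicator (g k)) := fun k m =>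
    (hg k).indicator (measurableSet_cube k m)
  have hcub2 : ∀ k m, MemLp ((cube k m).indicator (g k)) 2 := fun k m =>
    (hg2 k).indicator (measurableSet_cube k m)
  have hsk : ∀ k, IsScaleKernel γ (truncConst n γ t) k (g k)
      fun x y => truncKer K t k x y (g k y) := fun k =>
    isScaleKernel_truncKer hγ h1 h2 t k (hg k) (hg2 k)
  -- Decomposition into the parts of `g k` on single cubes.
  have hdec : ∀ k y, g k y = ∑ m ∈ R k, (cube k m).indicator (g k) y := by
    intro k y
    have hz : ∀ m, m ≠ cubeIndex k y → (cube k m).indicator (g k) y = 0 := fun m hm =>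
      Set.indicator_of_notMem (fun hc => hm (mem_cube_iff.1 hc).symm) _
    have h1 : (cube k (cubeIndex k y)).indicator (g k) y = g k y :=
      Set.indicator_of_mem (mem_cube_cubeIndex k y) _
    by_cases hy : cubeIndex k y ∈ R k
    · rw [Finset.sum_eq_single_of_mem _ hy fun m _ hm => hz m hm, h1]
    · rw [hgR k y hy, Finset.sum_eq_zero]
      exact fun m hm => hz m fun hc => hy (hc ▸ hm)
  have hex : ∀ k m, ∃ φ : Lp F 2 (volume : Measure (Fin n → ℝ)),
      ∀ᵐ y, (φ y : E) = (cube k m).indicator (g k) y := fun k m =>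
    exists_Lp_of_memLp (hcub2 k m) fun y => by
      by_cases hy : y ∈ cube k m
      · rw [Set.indicator_of_mem hy]
        exact hgF k y
      · rw [Set.indicator_of_notMem hy]
        exact F.zero_mem
  choose φ hφ using hex
  have hfsum : f = ∑ k ∈ S, ∑ m ∈ R k, φ k m := by
    refine Lp_coe_injective ?_
    have e1 : ∀ᵐ y, (∑ k ∈ S, ∑ m ∈ R k, φ k m : Lp F 2 (volume : Measure (Fin n → ℝ))) y
        = ∑ k ∈ S, (∑ m ∈ R k, φ k m : Lp F 2 (volume : Measure (Fin n → ℝ))) y := by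
      filter_upwards [Lp.coeFn_finsetSum S fun k => ∑ m ∈ R k, φ k m] with y hy
      rw [hy, Finset.sum_apply]
    have e2 : ∀ᵐ y, ∀ k, (∑ m ∈ R k, φ k m : Lp F 2 (volume : Measure (Fin n → ℝ))) y
        = ∑ m ∈ R k, φ k m y := by
      refine ae_all_iff.2 fun k => ?_
      filter_upwards [Lp.coeFn_finsetSum (R k) fun m => φ k m] with y hy
      rw [hy, Finset.sum_apply]
    filter_upwards [hf, e1, e2, ae_all_iff.2 fun k => ae_all_iff.2 (hφ k)] with y hy h1 h2 h3
    rw [hy, h1, Submodule.coe_sum]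
    refine Finset.sum_congr rfl fun k _ => ?_
    rw [h2 k, Submodule.coe_sum, hdec k y]
    exact Finset.sum_congr rfl fun m _ => (h3 k m).symm
  have hTsum : ∀ᵐ x, T f x = ∑ k ∈ S, ∑ m ∈ R k, T (φ k m) x := by
    rw [hfsum, map_sum]
    simp only [map_sum]
    have e1 : ∀ᵐ y, (∑ k ∈ S, ∑ m ∈ R k, T (φ k m) : Lp E 2 (volume : Measure (Fin n → ℝ))) y
        = ∑ k ∈ S, (∑ m ∈ R k, T (φ k m) : Lp E 2 (volume : Measure (Fin n → ℝ))) y := by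
      filter_upwards [Lp.coeFn_finsetSum S fun k => ∑ m ∈ R k, T (φ k m)] with y hy
      rw [hy, Finset.sum_apply]
    have e2 : ∀ᵐ y, ∀ k, (∑ m ∈ R k, T (φ k m) : Lp E 2 (volume : Measure (Fin n → ℝ))) y
        = ∑ m ∈ R k, T (φ k m) y := by
      refine ae_all_iff.2 fun k => ?_
      filter_upwards [Lp.coeFn_finsetSum (R k) fun m => T (φ k m)] with y hy
      rw [hy, Finset.sum_apply]
    filter_upwards [e1, e2] with y h1 h2
    rw [h1]
    exact Finset.sum_congr rfl fun k _ => h2 k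
  have hpT : ∀ᵐ x, ∀ k ∈ S, ∀ m, p x (T (φ k m) x)
      = p x (∫ y, truncKer K t k x y ((cube k m).indicator (g k) y)) := by
    refine ae_all_iff.2 fun k => ?_
    by_cases hk : k ∈ S
    · have := fun m => ae_apply_eq_truncKer hγ h0 h1 h2 hT t k m (hmod k m) (hp k hk m) (hcub k m)
        (hcub2 k m) (fun y hy => Set.indicator_of_notMem hy _) (fun y => by
          by_cases hy : y ∈ cube k m
          · rw [Set.indicator_of_mem hy, ← mem_cube_iff.1 hy]
            exact hgD k y
          · rw [Set.indicator_of_notMem hy, _root_.map_zero]) (fun m' => by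
          rw [setIntegral_indicator (measurableSet_cube k m)]
          by_cases hm : (cube (k + t) m' ∩ cube k m).Nonempty
          · obtain ⟨z, hz, hz'⟩ := hm
            rw [Set.inter_eq_left.2, hmean k hk]
            intro y hy
            rw [mem_cube_iff] at hy hz hz' ⊢
            rw [cubeIndex_eq_of_le (by lia) (hy.trans hz.symm), hz']
          · rw [Set.not_nonempty_iff_eq_empty.1 hm, setIntegral_empty]) (hφ k m)
      filter_upwards [ae_all_iff.2 this] with x hx _ m using hx m
    · exact Filter.Eventually.of_forall fun x hc => absurd hc hk
  set U : (Fin n → ℝ) → E := ∑ k ∈ S, fun x => ∫ y, truncKer K t k x y (g k y) with hU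
  have hpU : ∀ᵐ x, p x (T f x) = p x (U x) := by
    filter_upwards [hTsum, hpT] with x hx1 hx2
    rw [hx1, hU, Finset.sum_apply, map_sum, map_sum]
    refine Finset.sum_congr rfl fun k hk => ?_
    have e : ∫ y, truncKer K t k x y (g k y)
        = ∑ m ∈ R k, ∫ y, truncKer K t k x y ((cube k m).indicator (g k) y) := by
      rw [← integral_finsetSum _ fun m _ => (isScaleKernel_truncKer hγ h1 h2 t k (hcub k m)
        (hcub2 k m)).integrable_right hγ x]
      refine integral_congr_ae (Filter.Eventually.of_forall fun y => ?_)
      simp only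
      rw [← map_sum, ← hdec k y]
    rw [map_sum, e, map_sum]
    exact Finset.sum_congr rfl fun m _ => hx2 k hk m
  have hle : eLpNorm (fun x => p x (T f x)) 2 volume ≤ eLpNorm U 2 volume := by
    refine eLpNorm_mono_ae ?_
    filter_upwards [hpU] with x hx
    rw [hx]
    exact hple x _
  have hDorth : ∀ x, ∀ i ∈ S, ∀ j ∈ S, i ≠ j → ∀ ξ η : E, D i (cubeIndex i x) ξ = ξ →
      D j (cubeIndex j x) η = η → inner ℝ ξ η = 0 := by
    intro x i hi j hj hij ξ η hξ hη
    refine inner_eq_zero_of_contraction (hDle i (cubeIndex i x)) hξ ?_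
    rw [← hη]
    exact hDD i hi j hj hij x η
  have hfix : ∀ k z y, D k (cubeIndex k y) (truncKer K t k z y (g k y))
      = truncKer K t k z y (g k y) := by
    intro k z y
    simp only [truncKer]
    split_ifs
    · simp
    · simp only [_root_.sub_apply, _root_.map_sub, hDK, hgD]
  have hmain := eLpNorm_sum_scale_le hγ hγ1 hn S hsk fun x i hi j hj hij => by
    refine hDorth x i hi j hj hij _ _ ?_ ?_
    all_goals
      refine map_condAvg_eq_of_fixed _ x fun y hy => map_integral_eq_of_fixed
        (Filter.Eventually.of_forall fun z => ?_)
      rw [← hy]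
      exact hfix _ z y
  rw [← eLpNorm_sum_sq_of_orthogonal S (fun k => (hg k).aestronglyMeasurable)
    fun x i hi j hj hij => hDorth x i hi j hj hij _ _ (hgD i x) (hgD j x)] at hmain
  have hfn : eLpNorm (∑ k ∈ S, g k) 2 volume = eLpNorm f 2 volume := by
    refine eLpNorm_congr_norm_ae ?_
    filter_upwards [hf] with y hy
    rw [Finset.sum_apply, ← hy]
    rfl
  rw [hfn, ← mul_pow] at hmain
  exact hle.trans ((ENNReal.pow_right_strictMono two_ne_zero).le_iff_le.1 hmain)

end Main

end Transfer

/-! ### Approximation by finitely many levels -/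

section Levels

variable {n : ℕ} {E : Type*} [NormedAddCommGroup E] [InnerProductSpace ℂ E]

/-- A linear map that annihilates the martingale differences of the levels between `a + t` and
`k + t` annihilates their sum. -/
lemma map_condAvg_sub_eq_zero {P : E →L[ℂ] E} {f : (Fin n → ℝ) → E} {x : Fin n → ℝ} {a k : ℤ}
    (h : a ≤ k) (t : ℤ) (hP : ∀ j, a ≤ j → j < k → P (mdiff (j + t + 1) f x) = 0) :
    P (condAvg (k + t) f x - condAvg (a + t) f x) = 0 := by
  induction k, h using Int.leInduction with
  | base => simp
  | succ k hk ih =>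
    have h1 := ih fun j hj hjk => hP j hj (by lia)
    have h2 := hP k hk (by lia)
    have e : condAvg (k + 1 + t) f x - condAvg (a + t) f x
        = mdiff (k + t + 1) f x + (condAvg (k + t) f x - condAvg (a + t) f x) := by
      rw [mdiff, add_sub_cancel_right, show k + 1 + t = k + t + 1 by ring, sub_add_sub_cancel]
    rw [e, _root_.map_add, h1, h2, add_zero]

lemma finite_cubeIndex_image {B : Set (Fin n → ℝ)} {r : ℝ} (hB : ∀ x ∈ B, ∀ i, |x i| ≤ r) (k : ℤ) :
    (cubeIndex k '' B).Finite := by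
  refine (Set.finite_Icc (fun _ : Fin n => ⌊(2 : ℝ) ^ k * (-r)⌋)
    fun _ => ⌊(2 : ℝ) ^ k * r⌋).subset ?_
  rintro _ ⟨x, hx, rfl⟩
  have hk : (0 : ℝ) ≤ 2 ^ k := by positivity
  refine ⟨fun i => Int.floor_mono ?_, fun i => Int.floor_mono ?_⟩
  · exact mul_le_mul_of_nonneg_left (neg_le_of_abs_le (hB x hx i)) hk
  · exact mul_le_mul_of_nonneg_left (le_of_abs_le (hB x hx i)) hk

/-- The cube `[-2^J, 2^J)ⁿ`, the union of the `2ⁿ` dyadic cubes of edge length `2^J` at the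
origin. -/
def bigCube (n J : ℕ) : Set (Fin n → ℝ) :=
  {x | ∀ i, -1 ≤ cubeIndex (-(J : ℤ)) x i ∧ cubeIndex (-(J : ℤ)) x i < 1}

lemma mem_bigCube_iff {J : ℕ} {x : Fin n → ℝ} :
    x ∈ bigCube n J ↔ ∀ i, -(2 : ℝ) ^ J ≤ x i ∧ x i < 2 ^ J := by
  refine forall_congr' fun i => ?_
  have hJ : (0 : ℝ) < 2 ^ J := by positivity
  rw [cubeIndex, Int.le_floor, Int.floor_lt, zpow_neg, zpow_natCast, le_inv_mul_iff₀ hJ,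
    inv_mul_lt_iff₀ hJ]
  push_cast
  rw [mul_neg_one, mul_one]

lemma measurableSet_bigCube (n J : ℕ) : MeasurableSet (bigCube n J) :=
  measurable_cubeIndex (-(J : ℤ))
    (Set.to_countable {m : Fin n → ℤ | ∀ i, -1 ≤ m i ∧ m i < 1}).measurableSet

lemma mem_bigCube_congr {J : ℕ} {k : ℤ} (hk : -(J : ℤ) ≤ k) {x y : Fin n → ℝ}
    (h : cubeIndex k x = cubeIndex k y) : x ∈ bigCube n J ↔ y ∈ bigCube n J := by
  simp only [bigCube, Set.mem_ofPred_eq, cubeIndex_eq_of_le hk h]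

variable [CompleteSpace E] {F : Submodule ℂ E} [CompleteSpace F]

lemma condAvg_coe_mem (k : ℤ) (f : (Fin n → ℝ) → F) (x : Fin n → ℝ) :
    condAvg k (fun y => (f y : E)) x ∈ F := by
  have h : ∫ y in cube k (cubeIndex k x), (f y : E)
      = ((∫ y in cube k (cubeIndex k x), f y : F) : E) :=
    F.subtypeₗᵢ.integral_comp_comm f
  rw [condAvg, setAverage_eq, h, ← Complex.coe_smul]
  exact F.smul_mem _ (Submodule.coe_mem _)

/-- The part of `f` between the levels `-J + t` and `J + t`, restricted to a large cube. -/
noncomputable def levelPart (J t : ℕ) (f : (Fin n → ℝ) → E) : (Fin n → ℝ) → E :=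
  (bigCube n J).indicator (condAvg (J + t) f - condAvg (-J + t) f)

omit [CompleteSpace E] in
lemma stronglyMeasurable_levelPart (J t : ℕ) (f : (Fin n → ℝ) → E) :
    StronglyMeasurable (levelPart J t f) :=
  ((stronglyMeasurable_condAvg _ _).sub (stronglyMeasurable_condAvg _ _)).indicator
    (measurableSet_bigCube n J)

attribute [local instance] InnerProductSpace.complexToReal in
lemma memLp_levelPart (J t : ℕ) {f : (Fin n → ℝ) → E} (hf : MemLp f 2) :
    MemLp (levelPart J t f) 2 :=
  ((memLp_condAvg _ hf).sub (memLp_condAvg _ hf)).indicator (measurableSet_bigCube n J)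

lemma levelPart_coe_mem (J t : ℕ) (f : (Fin n → ℝ) → F) (x : Fin n → ℝ) :
    levelPart J t (fun y => (f y : E)) x ∈ F := by
  by_cases hx : x ∈ bigCube n J
  · rw [levelPart, Set.indicator_of_mem hx]
    exact F.sub_mem (condAvg_coe_mem _ _ _) (condAvg_coe_mem _ _ _)
  · rw [levelPart, Set.indicator_of_notMem hx]
    exact F.zero_mem

attribute [local instance] InnerProductSpace.complexToReal in
lemma setIntegral_levelPart {J t : ℕ} {f : (Fin n → ℝ) → E} (hf : MemLp f 2) {k : ℤ}
    (hk : -(J : ℤ) ≤ k) (hkJ : k ≤ J) {z : Fin n → ℝ} (hz : z ∈ bigCube n J) :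
    ∫ y in cube (k + t) (cubeIndex (k + t) z), levelPart J t f y
      = volume.real (cube (k + t) (cubeIndex (k + t) z)) •
        (condAvg (k + t) f z - condAvg (-J + t) f z) := by
  have h1 : condAvg (k + t) (condAvg (J + t) f - condAvg (-J + t) f)
      = condAvg (k + t) f - condAvg (-J + t) f := by
    rw [condAvg_sub _ (memLp_condAvg _ hf) (memLp_condAvg _ hf), condAvg_condAvg (by lia) hf,
      condAvg_condAvg' (by lia)]
  rw [← Pi.sub_apply, ← h1, condAvg, setAverage_eq, smul_smul,
    mul_inv_cancel₀ (measureReal_cube_pos _ _).ne', one_smul]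
  refine setIntegral_congr_fun (measurableSet_cube _ _) fun y hy => ?_
  rw [mem_cube_iff] at hy
  exact Set.indicator_of_mem ((mem_bigCube_congr (by lia) hy).2 hz) _

attribute [local instance] InnerProductSpace.complexToReal in
lemma tendsto_levelPart (hn : 0 < n) {f : (Fin n → ℝ) → E} (hf : MemLp f 2) (t : ℕ) :
    Filter.Tendsto (fun J : ℕ => eLpNorm (levelPart J t f - f) 2 volume) Filter.atTop (nhds 0) := by
  have h1 := tendsto_condAvg hf t
  have h2 := tendsto_condAvg_neg hn hf t
  have h3 : Filter.Tendsto (fun J : ℕ => eLpNorm ((bigCube n J)ᶜ.indicator f) 2 volume)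
      Filter.atTop (nhds 0) := by
    have hsq : Filter.Tendsto (fun J : ℕ => ∫⁻ x, ‖(bigCube n J)ᶜ.indicator f x‖ₑ ^ 2)
        Filter.atTop (nhds (∫⁻ _ : Fin n → ℝ, 0)) := by
      refine tendsto_lintegral_of_dominated_convergence' (fun x => ‖f x‖ₑ ^ 2)
        (fun J => (hf.1.indicator (measurableSet_bigCube n J).compl).enorm.pow_const 2)
        (fun J => Filter.Eventually.of_forall fun x => ?_) ?_
        (Filter.Eventually.of_forall fun x => ?_)
      · exact pow_le_pow_left' (enorm_indicator_le_enorm_self _ _) 2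
      · rw [← eLpNorm_two_sq]
        exact (ENNReal.pow_lt_top hf.2).ne
      · obtain ⟨J₀, hJ₀⟩ := pow_unbounded_of_one_lt ‖x‖ one_lt_two
        refine tendsto_const_nhds.congr' ?_
        filter_upwards [Filter.eventually_ge_atTop J₀] with J hJ
        have hx : x ∈ bigCube n J := by
          refine mem_bigCube_iff.2 fun i => ?_
          have h4 : |x i| < 2 ^ J :=
            ((norm_le_pi_norm x i).trans_lt hJ₀).trans_le (pow_le_pow_right₀ one_le_two hJ)
          exact ⟨(abs_lt.1 h4).1.le, (abs_lt.1 h4).2⟩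
        rw [Set.indicator_of_notMem (by simpa using hx)]
        simp
    rw [lintegral_zero] at hsq
    simp only [← eLpNorm_two_sq] at hsq
    have := (ENNReal.continuous_rpow_const (y := 1 / 2)).tendsto 0 |>.comp hsq
    rw [ENNReal.zero_rpow_of_pos (by norm_num)] at this
    refine this.congr fun J => ?_
    rw [Function.comp_apply, ← ENNReal.rpow_natCast, ← ENNReal.rpow_mul]
    norm_num
  have hsum := (h1.add h2).add h3
  rw [add_zero, add_zero] at hsum
  refine tendsto_of_tendsto_of_tendsto_of_le_of_le tendsto_const_nhds hsum (fun _ => zero_le)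
    fun J => ?_
  have hB := measurableSet_bigCube n J
  have m1 : AEStronglyMeasurable (condAvg (t + J) f - f) volume :=
    ((stronglyMeasurable_condAvg _ f).aestronglyMeasurable).sub hf.1
  have m2 : AEStronglyMeasurable (condAvg (t - J) f) volume :=
    (stronglyMeasurable_condAvg _ f).aestronglyMeasurable
  have e : levelPart J t f - f = (bigCube n J).indicator (condAvg (t + J) f - f)
      - (bigCube n J).indicator (condAvg (t - J) f) - (bigCube n J)ᶜ.indicator f := by
    funext x
    simp only [levelPart, Pi.sub_apply, add_comm (J : ℤ), neg_add_eq_sub]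
    by_cases hx : x ∈ bigCube n J
    · simp only [Set.indicator_of_mem hx, Pi.sub_apply,
        Set.indicator_of_notMem (show x ∉ (bigCube n J)ᶜ from fun hc => hc hx)]
      abel
    · simp only [Set.indicator_of_notMem hx, Set.indicator_of_mem (show x ∈ (bigCube n J)ᶜ from hx)]
      abel
  rw [e]
  refine (eLpNorm_sub_le ((m1.indicator hB).sub (m2.indicator hB)) (hf.1.indicator hB.compl)
    (by norm_num)).trans ?_
  refine add_le_add ?_ le_rfl
  refine (eLpNorm_sub_le (m1.indicator hB) (m2.indicator hB) (by norm_num)).trans ?_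
  exact add_le_add (eLpNorm_indicator_le _) (eLpNorm_indicator_le _)

/-- The estimate for `levelPart J t f`, decomposed along projections `D k`, `-J ≤ k < J`, that
resolve the martingale differences of `f`: `D k` annihilates the differences of the levels up to
`k + t`, so that the pieces have mean zero on the cubes of level `k + t`. -/
theorem eLpNorm_apply_levelPart_le (hn : 0 < n) {γ : ℝ} (hγ : 0 < γ) (hγ1 : γ ≤ 1)
    {K : (Fin n → ℝ) → (Fin n → ℝ) → E →L[ℂ] E}
    (h0 : ∀ x y, x ≠ y → ‖K x y‖ ≤ 1 / ‖x - y‖ ^ n)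
    (h1 : ∀ x y z, ‖x - z‖ ≤ 1 / 2 * ‖y - z‖ →
      ‖K x y - K z y‖ ≤ ‖x - z‖ ^ γ / ‖y - z‖ ^ ((n : ℝ) + γ))
    (h2 : ∀ x y z, ‖x - z‖ ≤ 1 / 2 * ‖y - z‖ →
      ‖K y x - K y z‖ ≤ ‖x - z‖ ^ γ / ‖y - z‖ ^ ((n : ℝ) + γ))
    {T : Lp F 2 (volume : Measure (Fin n → ℝ)) →L[ℂ] Lp E 2 (volume : Measure (Fin n → ℝ))}
    (hT : ∀ (S : Set (Fin n → ℝ)) (f : Lp F 2 (volume : Measure (Fin n → ℝ))),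
      IsCompact S → (∀ᵐ y, y ∉ S → f y = 0) → ∀ᵐ x, x ∉ S → T f x = ∫ y, K x y (f y : E))
    (J t : ℕ) {D : ℤ → (Fin n → ℤ) → E →L[ℂ] E}
    (hmod : ∀ k m, ∀ f g : Lp F 2 (volume : Measure (Fin n → ℝ)),
      (∀ᵐ x, (g x : E) = D k m (f x)) → ∀ᵐ x, T g x = D k m (T f x))
    (hDK : ∀ k m x y ξ, D k m (K x y ξ) = K x y (D k m ξ))
    (hDF : ∀ k m, ∀ ξ ∈ F, D k m ξ ∈ F)
    (hDle : ∀ k m ξ, ‖D k m ξ‖ ≤ ‖ξ‖)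
    (hDid : ∀ k m ξ, D k m (D k m ξ) = D k m ξ)
    (hDD : ∀ i ∈ Finset.Ico (-(J : ℤ)) J, ∀ j ∈ Finset.Ico (-(J : ℤ)) J, i ≠ j → ∀ x ξ,
      D i (cubeIndex i x) (D j (cubeIndex j x) ξ) = 0)
    {p : (Fin n → ℝ) → E →L[ℂ] E} (hple : ∀ x ξ, ‖p x ξ‖ ≤ ‖ξ‖)
    (hp : ∀ k ∈ Finset.Ico (-(J : ℤ)) J, ∀ m, ∀ x ∈ dilate 2 k m, ∀ ξ, p x (D k m ξ) = 0)
    {f : Lp F 2 (volume : Measure (Fin n → ℝ))}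
    (hD0 : ∀ j k : ℤ, -(J : ℤ) ≤ j → j < k → k < J → ∀ x,
      D k (cubeIndex k x) (mdiff (j + t + 1) (fun y => (f y : E)) x) = 0)
    (hDsum : ∀ j : ℤ, -(J : ℤ) ≤ j → j < J → ∀ x, ∑ k ∈ Finset.Ico (-(J : ℤ)) J,
      D k (cubeIndex k x) (mdiff (j + t + 1) (fun y => (f y : E)) x)
        = mdiff (j + t + 1) (fun y => (f y : E)) x)
    {φ : Lp F 2 (volume : Measure (Fin n → ℝ))}
    (hφ : ∀ᵐ y, (φ y : E) = levelPart J t (fun y => (f y : E)) y) :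
    eLpNorm (fun x => p x (T φ x)) 2 volume
      ≤ truncConst n γ t * scaleConst n γ * eLpNorm φ 2 volume := by
  set f' : (Fin n → ℝ) → E := fun y => (f y : E) with hf'
  have hf2 : MemLp f' 2 := (F.subtypeL.comp_memLp' (Lp.memLp f))
  set h := levelPart J t f' with hh
  have hBr : ∀ x ∈ bigCube n J, ∀ i, |x i| ≤ (2 : ℝ) ^ J := fun x hx i =>
    abs_le.2 ⟨(mem_bigCube_iff.1 hx i).1, (mem_bigCube_iff.1 hx i).2.le⟩
  have hgm : ∀ k, StronglyMeasurable fun y => D k (cubeIndex k y) (h y) := fun k =>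
    StronglyMeasurable.clm_apply (stronglyMeasurable_comp_cubeIndex k (D k))
      (stronglyMeasurable_levelPart J t f')
  refine eLpNorm_apply_le_of_sum hn hγ hγ1 h0 h1 h2 hT t (Finset.Ico (-(J : ℤ)) J) hmod hDK hDle hDD
    hple hp (g := fun k y => D k (cubeIndex k y) (h y)) hgm (fun k => ?_)
    (fun k y => hDF _ _ _ (levelPart_coe_mem J t _ y))
    (fun k => (finite_cubeIndex_image hBr k).toFinset) (fun k y hy => ?_)
    (fun k y => hDid _ _ _) (fun k hk m => ?_) ?_
  · exact (memLp_levelPart J t hf2).of_le (hgm k).aestronglyMeasurable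
      (Filter.Eventually.of_forall fun y => hDle _ _ _)
  · have hyB : y ∉ bigCube n J := fun hc => hy (by simpa using ⟨y, hc, rfl⟩)
    rw [hh, levelPart, Set.indicator_of_notMem hyB, _root_.map_zero]
  · rw [Finset.mem_Ico] at hk
    set z := center (k + t) m with hz
    have hzm : cubeIndex (k + t) z = m := mem_cube_iff.1 (center_mem_cube (k + t) m)
    have hc : ∀ y ∈ cube (k + t) m, D k (cubeIndex k y) (h y) = D k (cubeIndex k z) (h y) := by
      intro y hy
      rw [cubeIndex_eq_of_le (show k ≤ k + t by lia) ((mem_cube_iff.1 hy).trans hzm.symm)]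
    rw [setIntegral_congr_fun (measurableSet_cube _ _) hc,
      ContinuousLinearMap.integral_comp_comm _ (integrableOn_cube (memLp_levelPart J t hf2) _ _)]
    by_cases hzB : z ∈ bigCube n J
    · have e := setIntegral_levelPart (t := t) hf2 hk.1 hk.2.le hzB
      rw [hzm] at e
      rw [e, ← Complex.coe_smul, _root_.map_smul, map_condAvg_sub_eq_zero hk.1 t
        fun j hj hjk => hD0 j k hj hjk hk.2 z, smul_zero]
    · have e : ∀ y ∈ cube (k + t) m, h y = 0 := fun y hy => by
        rw [hh, levelPart, Set.indicator_of_notMem]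
        rwa [mem_bigCube_congr (show -(J : ℤ) ≤ k + t by lia) ((mem_cube_iff.1 hy).trans hzm.symm)]
      rw [setIntegral_congr_fun (measurableSet_cube _ _) e, integral_zero, _root_.map_zero]
  · filter_upwards [hφ] with y hy
    rw [hy]
    set P : E →L[ℂ] E := ContinuousLinearMap.id ℂ E
      - ∑ k ∈ Finset.Ico (-(J : ℤ)) J, D k (cubeIndex k y) with hP
    have hPap : ∀ ξ, P ξ = ξ - ∑ k ∈ Finset.Ico (-(J : ℤ)) J, D k (cubeIndex k y) ξ := fun ξ => by
      simp [hP]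
    suffices hs : P (h y) = 0 by
      rw [hPap, sub_eq_zero] at hs
      exact hs
    by_cases hyB : y ∈ bigCube n J
    · rw [hh, levelPart, Set.indicator_of_mem hyB]
      refine map_condAvg_sub_eq_zero (by lia) t fun j hj hjJ => ?_
      rw [hPap, hDsum j hj hjJ, sub_self]
    · rw [hh, levelPart, Set.indicator_of_notMem hyB, _root_.map_zero]

/-- A bound for the images of the functions `levelPart J t f` passes to the limit `f`. -/
lemma eLpNorm_apply_le_of_levelPart (hn : 0 < n) {c : ℝ≥0∞} (hc : c ≠ ∞) (t : ℕ)
    (T : Lp F 2 (volume : Measure (Fin n → ℝ)) →L[ℂ] Lp E 2 (volume : Measure (Fin n → ℝ)))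
    {p : (Fin n → ℝ) → E →L[ℂ] E} (hple : ∀ x ξ, ‖p x ξ‖ ≤ ‖ξ‖)
    (hpm : ∀ ψ : (Fin n → ℝ) → E, AEStronglyMeasurable ψ volume →
      AEStronglyMeasurable (fun x => p x (ψ x)) volume)
    {f : Lp F 2 (volume : Measure (Fin n → ℝ))}
    (h : ∀ (J : ℕ) (φ : Lp F 2 (volume : Measure (Fin n → ℝ))),
      (∀ᵐ y, (φ y : E) = levelPart J t (fun y => (f y : E)) y) →
      eLpNorm (fun x => p x (T φ x)) 2 volume ≤ c * eLpNorm φ 2 volume) :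
    eLpNorm (fun x => p x (T f x)) 2 volume ≤ c * eLpNorm f 2 volume := by
  have hf2 : MemLp (fun y => (f y : E)) 2 := F.subtypeL.comp_memLp' (Lp.memLp f)
  have hex : ∀ J, ∃ φ : Lp F 2 (volume : Measure (Fin n → ℝ)),
      ∀ᵐ y, (φ y : E) = levelPart J t (fun y => (f y : E)) y := fun J =>
    exists_Lp_of_memLp (memLp_levelPart J t hf2) (levelPart_coe_mem J t f)
  choose φ hφ using hex
  have hlim : Filter.Tendsto φ Filter.atTop (nhds f) := by
    rw [tendsto_iff_edist_tendsto_0]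
    refine (tendsto_levelPart hn hf2 t).congr fun J => ?_
    rw [Lp.edist_def]
    refine eLpNorm_congr_norm_ae ?_
    filter_upwards [hφ J] with y hy
    rw [Pi.sub_apply, Pi.sub_apply, ← hy, ← Submodule.coe_sub]
    rfl
  have hTlim : Filter.Tendsto (fun J => edist (T f) (T (φ J))) Filter.atTop (nhds 0) := by
    have := (T.continuous.tendsto f).comp hlim
    rw [tendsto_iff_edist_tendsto_0] at this
    simpa only [edist_comm, Function.comp_apply] using this
  have hnorm : Filter.Tendsto (fun J => eLpNorm (φ J) 2 volume) Filter.atTop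
      (nhds (eLpNorm f 2 volume)) := by
    have := (continuous_enorm.tendsto f).comp hlim
    simpa only [Function.comp_def, Lp.enorm_def] using this
  have hbound := (ENNReal.Tendsto.const_mul hnorm (Or.inr hc)).add hTlim
  rw [add_zero] at hbound
  refine ge_of_tendsto' hbound fun J => ?_
  have e : (fun x => p x (T f x)) = (fun x => p x (T (φ J) x))
      + fun x => p x ((⇑(T f) - ⇑(T (φ J))) x) := by
    funext x
    simp
  rw [e]
  refine (eLpNorm_add_le (hpm _ (Lp.aestronglyMeasurable _)) (hpm _
    ((Lp.aestronglyMeasurable _).sub (Lp.aestronglyMeasurable _))) (by norm_num)).trans ?_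
  refine add_le_add (h J _ (hφ J)) ?_
  rw [Lp.edist_def]
  exact eLpNorm_mono fun x => hple x _

end Levels

/-! ### The order of projections -/

section Projections

variable {H : Type u} [NormedAddCommGroup H] [InnerProductSpace ℂ H] [CompleteSpace H]
  {M : VonNeumannAlgebra H}

namespace Proj

/-- The Loewner order of projections. -/
noncomputable instance : PartialOrder (Proj M) :=
  PartialOrder.lift (fun P => P.1) Subtype.val_injective

lemma le_iff_mul_eq_left {P Q : Proj M} : P ≤ Q ↔ P.1 * Q.1 = P.1 :=
  IsStarProjection.le_iff_mul_eq_left P.2.2 Q.2.2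

lemma le_iff_mul_eq_right {P Q : Proj M} : P ≤ Q ↔ Q.1 * P.1 = P.1 :=
  IsStarProjection.le_iff_mul_eq_right P.2.2 Q.2.2

lemma isLUB_sup {ι : Type*} (P : ι → Proj M) : IsLUB (Set.range P) (sup P) := by
  refine ⟨?_, fun Q hQ => ?_⟩
  · rintro _ ⟨i, rfl⟩
    refine le_iff_mul_eq_right.2 (ContinuousLinearMap.ext fun v => ?_)
    exact Submodule.starProjection_eq_self_iff.2 (Submodule.le_topologicalClosure _
      (le_iSup (fun i => (P i).1.range) i ⟨v, rfl⟩))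
  · refine le_iff_mul_eq_right.2 (ContinuousLinearMap.ext fun v => ?_)
    have h1 : (⨆ i, (P i).1.range).topologicalClosure ≤ (Q.1 - 1).ker := by
      refine Submodule.topologicalClosure_minimal _ (iSup_le fun i => ?_)
        (ContinuousLinearMap.isClosed_ker _)
      rintro _ ⟨w, rfl⟩
      have h2 := DFunLike.congr_fun (le_iff_mul_eq_right.1 (hQ ⟨i, rfl⟩)) w
      rw [LinearMap.mem_ker]
      exact sub_eq_zero.2 h2
    have h3 := h1 (Submodule.starProjection_apply_mem
      (⨆ i, (P i).1.range).topologicalClosure v)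
    exact sub_eq_zero.1 h3

lemma le_sup {ι : Type*} (P : ι → Proj M) (i : ι) : P i ≤ sup P := (isLUB_sup P).1 ⟨i, rfl⟩

lemma sup_le {ι : Type*} {P : ι → Proj M} {Q : Proj M} (h : ∀ i, P i ≤ Q) : sup P ≤ Q :=
  (isLUB_sup P).2 (by rintro _ ⟨i, rfl⟩; exact h i)

/-- An increasing sequence of projections converges strongly to its supremum. -/
lemma tendsto_sup {P : ℕ → Proj M} (hP : Monotone P) (v : H) :
    Filter.Tendsto (fun j => (P j).1 v) Filter.atTop (nhds ((sup P).1 v)) := by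
  have hU : Monotone fun j => (P j).1.range := by
    rintro i j hij _ ⟨w, rfl⟩
    exact ⟨(P i).1 w, DFunLike.congr_fun (le_iff_mul_eq_right.1 (hP hij)) w⟩
  have hop : ∀ j, (P j).1.range.HasOrthogonalProjection := fun j =>
    (isStarProjection_iff_eq_starProjection_range.1 (P j).2.2).choose
  have h := Submodule.starProjection_tendsto_closure_iSup (fun j => (P j).1.range) hU v
  refine h.congr fun j => ?_
  have := (isStarProjection_iff_eq_starProjection_range.1 (P j).2.2).choose_spec
  exact DFunLike.congr_fun this.symm v

/-- A projection of `M` as an element of `M`. -/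
def toAlg (P : Proj M) : M := ⟨P.1, P.2.1⟩

end Proj

end Projections

/-! ### Dilated cubes -/

section Dilates

variable {n : ℕ}

lemma dilate_two_subset_dilate_five {k : ℤ} {m : Fin n → ℤ} : dilate 2 k m ⊆ dilate 5 k m := by
  intro x hx
  rw [mem_dilate_two_iff] at hx
  rw [mem_dilate_five_iff]
  intro i
  have h1 := cubeIndex_of_le (show k ≤ k + 1 by lia) x i
  have h2 := hx i
  norm_num at h1
  lia

lemma mem_dilate_five_of_mem_dilate_two {k : ℤ} {x y : Fin n → ℝ}
    (hx : x ∈ dilate 2 k (cubeIndex k y)) : x ∈ dilate 5 (k + 1) (cubeIndex (k + 1) y) := by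
  rw [mem_dilate_two_iff] at hx
  rw [mem_dilate_five_iff]
  intro i
  have h1 := cubeIndex_of_le (show k ≤ k + 1 by lia) y i
  have h2 := hx i
  norm_num at h1
  lia

lemma mem_dilate_two_of_le {j k : ℤ} (hjk : j ≤ k) {x y : Fin n → ℝ}
    (hx : x ∈ dilate 2 k (cubeIndex k y)) : x ∈ dilate 2 j (cubeIndex j y) := by
  rw [mem_dilate_two_iff] at hx ⊢
  intro i
  have h1 := cubeIndex_of_le hjk y i
  have h2 := cubeIndex_of_le (show j + 1 ≤ k + 1 by lia) x i
  have h3 := hx i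
  rw [show (k + 1 - (j + 1)).toNat = (k - j).toNat by congr 1; lia] at h2
  rw [h1, h2]
  set p : ℤ := ((2 ^ (k - j).toNat : ℕ) : ℤ) with hp
  have hp1 : 1 ≤ p := by
    rw [hp]
    exact_mod_cast Nat.one_le_two_pow
  set m := cubeIndex k y i
  set X := cubeIndex (k + 1) x i
  have h4 := Int.emod_add_mul_ediv m p
  have h5 := Int.emod_nonneg m (by lia : p ≠ 0)
  have h6 := Int.emod_lt_of_pos m (by lia : 0 < p)
  rw [Int.le_ediv_iff_mul_le (by lia), Int.ediv_lt_iff_lt_mul (by lia)]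
  constructor <;> nlinarith

end Dilates

/-! ### Increasing unions of the projections -/

section Increments

variable {H : Type u} [NormedAddCommGroup H] [InnerProductSpace ℂ H] [CompleteSpace H]
  {M : VonNeumannAlgebra H} {n : ℕ}

/-- The value at `x` of the supremum of the projections `B_j`, `a ≤ j ≤ k`. -/
noncomputable def cumSup (B : ℤ → (Fin n → ℤ) → Proj M) (a k : ℤ) (x : Fin n → ℝ) : Proj M :=
  Proj.sup fun j : Set.Icc a k => B j (cubeIndex j x)

/-- The increment of `cumSup` from level `k - 1` to level `k`, on the cube of level `k` and index
`m`. -/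
noncomputable def increment (B : ℤ → (Fin n → ℤ) → Proj M) (a k : ℤ) (m : Fin n → ℤ) : M :=
  (cumSup B a k (center k m)).toAlg - (cumSup B a (k - 1) (center k m)).toAlg

variable {B : ℤ → (Fin n → ℤ) → Proj M} {a : ℤ}

lemma cumSup_congr {j k : ℤ} (hjk : j ≤ k) {x y : Fin n → ℝ} (h : cubeIndex k x = cubeIndex k y) :
    cumSup B a j x = cumSup B a j y := by
  rw [cumSup, cumSup]
  congr 1
  funext i
  rw [cubeIndex_eq_of_le (i.2.2.trans hjk) h]

lemma cumSup_mono {j k : ℤ} (hjk : j ≤ k) (x : Fin n → ℝ) : cumSup B a j x ≤ cumSup B a k x :=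
  Proj.sup_le fun i => Proj.le_sup (fun j : Set.Icc a k => B j (cubeIndex j x))
    ⟨i.1, i.2.1, i.2.2.trans hjk⟩

lemma le_cumSup {j k : ℤ} (haj : a ≤ j) (hjk : j ≤ k) (x : Fin n → ℝ) :
    B j (cubeIndex j x) ≤ cumSup B a k x :=
  Proj.le_sup (fun j : Set.Icc a k => B j (cubeIndex j x)) ⟨j, haj, hjk⟩

lemma cumSup_of_lt {k : ℤ} (hk : k < a) (x : Fin n → ℝ) : (cumSup B a k x).toAlg = 0 := by
  refine Subtype.ext ?_
  have : IsEmpty (Set.Icc a k) := ⟨fun j => by have := j.2.1.trans j.2.2; lia⟩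
  have h1 : cumSup B a k x ≤ ⟨0, zero_mem M, .zero _⟩ := Proj.sup_le fun j => isEmptyElim j
  have h2 := Proj.le_iff_mul_eq_left.1 h1
  rw [mul_zero] at h2
  exact h2.symm

lemma increment_cubeIndex (k : ℤ) (x : Fin n → ℝ) :
    increment B a k (cubeIndex k x) = (cumSup B a k x).toAlg - (cumSup B a (k - 1) x).toAlg := by
  have h : cubeIndex k (center k (cubeIndex k x)) = cubeIndex k x :=
    mem_cube_iff.1 (center_mem_cube _ _)
  rw [increment, cumSup_congr le_rfl h, cumSup_congr (show k - 1 ≤ k by lia) h]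

lemma isStarProjection_increment (k : ℤ) (m : Fin n → ℤ) :
    IsStarProjection (increment B a k m : H →L[ℂ] H) :=
  (cumSup B a (k - 1) (center k m)).2.2.sub_of_mul_eq_left (cumSup B a k (center k m)).2.2
    (Proj.le_iff_mul_eq_left.1 (cumSup_mono (by lia) _))

/-- If `q` dominates each `B_k(m)` on the double of its cube, then it dominates the suprema of the
`B_j`, `j ≤ k`, on the double of a cube of level `k`. -/
lemma cumSup_center_le {q : (Fin n → ℝ) → Proj M}
    (hBq : ∀ k m, ∀ x ∈ dilate 2 k m, B k m ≤ q x) {j k : ℤ} (hjk : j ≤ k) {m : Fin n → ℤ}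
    {x : Fin n → ℝ} (hx : x ∈ dilate 2 k m) : cumSup B a j (center k m) ≤ q x := by
  refine Proj.sup_le fun i => hBq _ _ x (mem_dilate_two_of_le (i.2.2.trans hjk) ?_)
  rwa [mem_cube_iff.1 (center_mem_cube k m)]

lemma dilateProj_congr {d : ℕ} {k : ℤ} {A : (Fin n → ℤ) → Proj M} {x y : Fin n → ℝ}
    (h : ∀ m, x ∈ dilate d k m ↔ y ∈ dilate d k m) : dilateProj d k A x = dilateProj d k A y :=
  le_antisymm
    (Proj.sup_le fun m => Proj.le_sup (fun m : {m // y ∈ dilate d k m} => A m) ⟨m, (h m).1 m.2⟩)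
    (Proj.sup_le fun m => Proj.le_sup (fun m : {m // x ∈ dilate d k m} => A m) ⟨m, (h m).2 m.2⟩)

lemma le_bigProj {A : ℤ → (Fin n → ℤ) → Proj M} {k : ℤ} {m : Fin n → ℤ} {x : Fin n → ℝ}
    (hx : x ∈ dilate 5 k m) : A k m ≤ bigProj A x :=
  (Proj.le_sup (fun m : {m // x ∈ dilate 5 k m} => A k m) ⟨m, hx⟩).trans
    (Proj.le_sup (fun k => dilateProj 5 k (A k) x) k)

/-- The supremum of the `5A_k` over the finitely many levels `-J ≤ k ≤ J`. -/
noncomputable def finProj (A : ℤ → (Fin n → ℤ) → Proj M) (J : ℕ) (x : Fin n → ℝ) : Proj M :=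
  Proj.sup fun k : Set.Icc (-(J : ℤ)) J => dilateProj 5 k (A k) x

lemma finProj_congr {A : ℤ → (Fin n → ℤ) → Proj M} {J : ℕ} {x y : Fin n → ℝ}
    (h : cubeIndex J x = cubeIndex J y) : finProj A J x = finProj A J y := by
  rw [finProj, finProj]
  congr 1
  funext k
  refine dilateProj_congr fun m => ?_
  rw [mem_dilate_five_iff, mem_dilate_five_iff, cubeIndex_eq_of_le k.2.2 h]

lemma finProj_mono (A : ℤ → (Fin n → ℤ) → Proj M) (x : Fin n → ℝ) :
    Monotone fun J => finProj A J x := fun I J hIJ => by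
  have hIJ' : (I : ℤ) ≤ J := by exact_mod_cast hIJ
  exact Proj.sup_le fun k => Proj.le_sup (fun k : Set.Icc (-(J : ℤ)) J => dilateProj 5 k (A k) x)
    ⟨k.1, (neg_le_neg hIJ').trans k.2.1, k.2.2.trans hIJ'⟩

lemma sup_finProj (A : ℤ → (Fin n → ℤ) → Proj M) (x : Fin n → ℝ) :
    (Proj.sup fun J => finProj A J x) = bigProj A x := by
  refine le_antisymm (Proj.sup_le fun J => Proj.sup_le fun k =>
    Proj.le_sup (fun k => dilateProj 5 k (A k) x) k.1) (Proj.sup_le fun k => ?_)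
  have h1 : -(k.natAbs : ℤ) ≤ k ∧ k ≤ k.natAbs := by lia
  exact (Proj.le_sup (fun k' : Set.Icc (-(k.natAbs : ℤ)) k.natAbs => dilateProj 5 k' (A k') x)
    ⟨k, h1⟩).trans (Proj.le_sup (fun J => finProj A J x) k.natAbs)

end Increments

/-! ### The estimate for one-sided multiplication -/

section SideAction

variable {H : Type u} [NormedAddCommGroup H] [InnerProductSpace ℂ H] [CompleteSpace H]
  {M N : VonNeumannAlgebra H} {hMN : M ≤ N} {τ : NSFTrace N} {L : N → τ.L2 →L[ℂ] τ.L2} {n : ℕ}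

namespace IsSideAction

variable (hL : IsSideAction τ hMN L)
include hL

lemma apply_zero (ξ : τ.L2) : L 0 ξ = 0 := by
  simpa using hL.sub 0 0 ξ

lemma apply_perp (P : Proj M) (ξ : τ.L2) :
    L (incl hMN P.perp) ξ = ξ - L (incl hMN P.toAlg) ξ := by
  have e : incl hMN P.perp = 1 - incl hMN P.toAlg := Subtype.ext rfl
  rw [e, hL.sub, hL.one]

lemma apply_incl_sub (P Q : Proj M) (ξ : τ.L2) :
    L (incl hMN (Q.toAlg - P.toAlg)) ξ = L (incl hMN Q.toAlg) ξ - L (incl hMN P.toAlg) ξ := by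
  rw [← hL.sub]
  congr 1

lemma apply_left_of_le {P Q : Proj M} (h : P ≤ Q) (ξ : τ.L2) :
    L (incl hMN P.toAlg) (L (incl hMN Q.toAlg) ξ) = L (incl hMN P.toAlg) ξ :=
  hL.mul _ _ _ (Subtype.ext (Proj.le_iff_mul_eq_left.1 h))
    (Subtype.ext (Proj.le_iff_mul_eq_right.1 h)) ξ

lemma apply_right_of_le {P Q : Proj M} (h : P ≤ Q) (ξ : τ.L2) :
    L (incl hMN Q.toAlg) (L (incl hMN P.toAlg) ξ) = L (incl hMN P.toAlg) ξ :=
  hL.mul _ _ _ (Subtype.ext (Proj.le_iff_mul_eq_right.1 h))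
    (Subtype.ext (Proj.le_iff_mul_eq_left.1 h)) ξ

lemma norm_apply_incl_le {b : M} (hb : IsStarProjection (b : H →L[ℂ] H)) (ξ : τ.L2) :
    ‖L (incl hMN b) ξ‖ ≤ ‖ξ‖ :=
  (hL.norm_le _ ξ).trans (mul_le_of_le_one_left (norm_nonneg _) (IsStarProjection.norm_le _ hb))

/-- Multiplication by the complement of `⋁ 5A_k` preserves measurability: the suprema over finitely
many levels are constant on small cubes, and they converge strongly. -/
lemma aestronglyMeasurable_perp_bigProj (A : ℤ → (Fin n → ℤ) → Proj M) {ψ : (Fin n → ℝ) → τ.L2}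
    (hψ : AEStronglyMeasurable ψ volume) :
    AEStronglyMeasurable (fun x => L (incl hMN (bigProj A x).perp) (ψ x)) volume := by
  refine aestronglyMeasurable_of_tendsto_ae Filter.atTop
    (f := fun (J : ℕ) x => L (incl hMN (finProj A J x).perp) (ψ x)) (fun J => ?_)
    (Filter.Eventually.of_forall fun x => ?_)
  · have hm := stronglyMeasurable_comp_cubeIndex (n := n) J fun m =>
      L (incl hMN (finProj A J (center J m)).perp)
    have e : (fun x => L (incl hMN (finProj A J x).perp) (ψ x))
        = fun x => L (incl hMN (finProj A J (center J (cubeIndex J x))).perp) (ψ x) := by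
      funext x
      rw [finProj_congr (mem_cube_iff.1 (center_mem_cube J (cubeIndex J x))).symm]
    rw [e]
    exact (isBoundedBilinearMap_apply (𝕜 := ℂ) (E := τ.L2)
      (F := τ.L2)).continuous.comp_aestronglyMeasurable (hm.aestronglyMeasurable.prodMk hψ)
  · have hmono := finProj_mono A x
    have hle : ∀ J, finProj A J x ≤ bigProj A x := fun J => by
      rw [← sup_finProj]
      exact Proj.le_sup (fun J => finProj A J x) J
    have h := hL.tendsto (fun J => incl hMN (finProj A J x).toAlg) (incl hMN (bigProj A x).toAlg)
      (fun J => (finProj A J x).2.2) (bigProj A x).2.2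
      (fun I J hIJ => Proj.le_iff_mul_eq_left.1 (hmono hIJ))
      (fun J => Proj.le_iff_mul_eq_left.1 (hle J))
      (fun v => by
        have := Proj.tendsto_sup hmono v
        rwa [sup_finProj] at this) (ψ x)
    have h2 := h.add_const (L (incl hMN (bigProj A x).perp) (ψ x))
    rw [zero_add] at h2
    refine h2.congr fun J => ?_
    rw [hL.sub, hL.apply_perp, hL.apply_perp]
    abel

end IsSideAction

/-- The estimate for the part of `T f` outside projections `q` that dominate `B_k(m)` on the double
of the corresponding cube. -/
theorem eLpNorm_perp_le (hn : 0 < n) {γ : ℝ} (hγ : 0 < γ) (hγ1 : γ ≤ 1)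
    (hL : IsSideAction τ hMN L) {K : (Fin n → ℝ) → (Fin n → ℝ) → N}
    {T : Lp (τ.L2sub M) 2 (volume : Measure (Fin n → ℝ)) →L[ℂ]
      Lp τ.L2 2 (volume : Measure (Fin n → ℝ))}
    (hCZ : IsCalderonZygmund hMN τ γ K T)
    (hmod : ∀ (a : M) (f g : Lp (τ.L2sub M) 2 (volume : Measure (Fin n → ℝ))),
      (∀ᵐ x, (g x : τ.L2) = L (incl hMN a) (f x)) → ∀ᵐ x, T g x = L (incl hMN a) (T f x))
    (t : ℕ) {B : ℤ → (Fin n → ℤ) → Proj M} {q : (Fin n → ℝ) → Proj M}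
    (hBq : ∀ k m, ∀ x ∈ dilate 2 k m, B k m ≤ q x)
    (hqm : ∀ ψ : (Fin n → ℝ) → τ.L2, AEStronglyMeasurable ψ volume →
      AEStronglyMeasurable (fun x => L (incl hMN (q x).perp) (ψ x)) volume)
    (f : Lp (τ.L2sub M) 2 (volume : Measure (Fin n → ℝ)))
    (hf : ∀ (k : ℤ) (x : Fin n → ℝ), L (incl hMN (B k (cubeIndex k x)).perp)
      (mdiff (k + t + 1) (fun y => (f y : τ.L2)) x) = 0) :
    eLpNorm (fun x => L (incl hMN (q x).perp) (T f x)) 2 volume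
      ≤ truncConst n γ t * scaleConst n γ * eLpNorm f 2 volume := by
  let _ : InnerProductSpace ℂ τ.L2 := InnerProductSpace.ofNorm ℂ τ.parallelogram_identity
  have : CompleteSpace (τ.L2sub M) :=
    (Submodule.isClosed_topologicalClosure _).completeSpace_coe
  have hlip : ∀ b c : N, ‖τ.lmul b - τ.lmul c‖ ≤ ‖(b : H →L[ℂ] H) - c‖ := fun b c => by
    refine ContinuousLinearMap.opNorm_le_bound _ (norm_nonneg _) fun ξ => ?_
    rw [_root_.sub_apply, ← (τ.isSideAction_lmul hMN).sub]
    exact τ.norm_lmul_le _ _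
  have hpm : ∀ x ξ, ‖L (incl hMN (q x).perp) ξ‖ ≤ ‖ξ‖ := fun x ξ =>
    hL.norm_apply_incl_le (q x).2.2.one_sub ξ
  have hfB : ∀ k x, L (incl hMN (B k (cubeIndex k x)).toAlg)
      (mdiff (k + t + 1) (fun y => (f y : τ.L2)) x)
        = mdiff (k + t + 1) (fun y => (f y : τ.L2)) x := fun k x => by
    have := hf k x
    rw [hL.apply_perp, sub_eq_zero] at this
    exact this.symm
  refine eLpNorm_apply_le_of_levelPart hn
    (ENNReal.mul_ne_top (truncConst_ne_top γ t) (scaleConst_ne_top hγ)) t T hpm hqm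
    fun J φ hφ => ?_
  have hDx : ∀ k x ξ, L (incl hMN (increment B (-(J : ℤ)) k (cubeIndex k x))) ξ
      = L (incl hMN (cumSup B (-(J : ℤ)) k x).toAlg) ξ
        - L (incl hMN (cumSup B (-(J : ℤ)) (k - 1) x).toAlg) ξ := fun k x ξ => by
    rw [increment_cubeIndex, hL.apply_incl_sub]
  refine eLpNorm_apply_levelPart_le (K := fun x y => τ.lmul (K x y))
    (D := fun k m => L (incl hMN (increment B (-(J : ℤ)) k m))) hn hγ hγ1
    (fun x y hxy => ?_) (fun x y z h => ?_) (fun x y z h => ?_) hCZ.kernel J t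
    (fun k m => hmod _) (fun k m x y ξ => hL.commute _ _ (hCZ.commutes x y) ξ)
    (fun k m ξ => hL.mem_L2sub _ ξ)
    (fun k m => hL.norm_apply_incl_le (isStarProjection_increment k m))
    (fun k m ξ => ?_) (fun i hi j hj hij x ξ => ?_) hpm (fun k hk m x hx ξ => ?_)
    (fun j k hj hjk hk x => ?_) (fun j hj hjJ x => ?_) hφ
  · exact (ContinuousLinearMap.opNorm_le_bound _ (norm_nonneg _) (τ.norm_lmul_le _)).trans
      (hCZ.size x y hxy)
  · exact (hlip _ _).trans (hCZ.smooth_fst x y z h)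
  · exact (hlip _ _).trans (hCZ.smooth_snd x y z h)
  · have h : incl hMN (increment B (-(J : ℤ)) k m) * incl hMN (increment B (-(J : ℤ)) k m)
        = incl hMN (increment B (-(J : ℤ)) k m) :=
      Subtype.ext (isStarProjection_increment k m).isIdempotentElem
    exact hL.mul _ _ _ h h ξ
  · simp only [hDx, _root_.map_sub]
    rcases lt_or_gt_of_ne hij with h | h
    · have a1 := cumSup_mono (B := B) (a := -(J : ℤ)) h.le x
      have a2 := cumSup_mono (B := B) (a := -(J : ℤ)) (show i ≤ j - 1 by lia) x
      have a3 := cumSup_mono (B := B) (a := -(J : ℤ)) (show i - 1 ≤ j by lia) x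
      have a4 := cumSup_mono (B := B) (a := -(J : ℤ)) (show i - 1 ≤ j - 1 by lia) x
      rw [hL.apply_left_of_le a1, hL.apply_left_of_le a2, hL.apply_left_of_le a3,
        hL.apply_left_of_le a4]
      abel
    · have a1 := cumSup_mono (B := B) (a := -(J : ℤ)) h.le x
      have a2 := cumSup_mono (B := B) (a := -(J : ℤ)) (show j - 1 ≤ i by lia) x
      have a3 := cumSup_mono (B := B) (a := -(J : ℤ)) (show j ≤ i - 1 by lia) x
      have a4 := cumSup_mono (B := B) (a := -(J : ℤ)) (show j - 1 ≤ i - 1 by lia) x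
      rw [hL.apply_right_of_le a1, hL.apply_right_of_le a2, hL.apply_right_of_le a3,
        hL.apply_right_of_le a4]
      abel
  · have a1 := cumSup_center_le (a := -(J : ℤ)) hBq le_rfl hx
    have a2 := cumSup_center_le (a := -(J : ℤ)) hBq (show k - 1 ≤ k by lia) hx
    simp only [increment]
    rw [hL.apply_perp, hL.apply_incl_sub, _root_.map_sub, hL.apply_right_of_le a1,
      hL.apply_right_of_le a2, sub_self]
  · -- Below level `k` the projection `B_j` is contained in both suprema.
    rw [hDx, ← hfB j x, hL.apply_right_of_le (le_cumSup hj hjk.le x),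
      hL.apply_right_of_le (le_cumSup hj (by lia) x), sub_self]
  · -- The sum telescopes.
    simp only [hDx]
    have htel : ∀ (b : ℤ) (ξ : τ.L2), -(J : ℤ) ≤ b → ∑ k ∈ Finset.Ico (-(J : ℤ)) b,
        (L (incl hMN (cumSup B (-(J : ℤ)) k x).toAlg) ξ
          - L (incl hMN (cumSup B (-(J : ℤ)) (k - 1) x).toAlg) ξ)
        = L (incl hMN (cumSup B (-(J : ℤ)) (b - 1) x).toAlg) ξ := by
      intro b ξ hb
      induction b, hb using Int.leInduction with
      | base =>
        rw [Finset.Ico_self, Finset.sum_empty, cumSup_of_lt (by lia)]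
        exact (hL.apply_zero ξ).symm
      | succ b hb ih =>
        have e : Finset.Ico (-(J : ℤ)) (b + 1) = insert b (Finset.Ico (-(J : ℤ)) b) := by
          ext i
          simp only [Finset.mem_Ico, Finset.mem_insert]
          lia
        rw [e, Finset.sum_insert (by simp), ih, sub_add_cancel, add_sub_cancel_right]
    rw [htel J _ (by lia), ← hfB j x, hL.apply_right_of_le (le_cumSup hj (by lia) x)]

/-- The constant in front of `2^{-γ s / 2}`. The factor `2^{γ/2}` absorbs the difference between `s`
and the number `t` of levels by which the kernels are refined. -/
noncomputable def czConst (n : ℕ) (γ : ℝ) : ℝ :=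
  2 * 8 ^ ((n : ℝ) + γ) * 2 ^ (γ / 2) * (scaleConst n γ).toReal

lemma truncConst_mul_le {γ : ℝ} (hγ : 0 < γ) {s t : ℕ} (hst : s ≤ t + 1) {r : ℝ} :
    truncConst n γ t * scaleConst n γ * ENNReal.ofReal r
      ≤ ENNReal.ofReal (czConst n γ * 2 ^ (-(γ * s / 2)) * r) := by
  have hs : scaleConst n γ = ENNReal.ofReal (scaleConst n γ).toReal :=
    (ENNReal.ofReal_toReal (scaleConst_ne_top hγ)).symm
  have hst' : (s : ℝ) ≤ t + 1 := by exact_mod_cast hst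
  have hc : (0 : ℝ) ≤ czConst n γ * 2 ^ (-(γ * s / 2)) := by
    rw [czConst]
    positivity
  rw [ENNReal.ofReal_mul hc, truncConst, hs, ← ENNReal.ofReal_mul (by positivity)]
  refine mul_le_mul_left (ENNReal.ofReal_le_ofReal ?_) _
  rw [czConst]
  have h2 : (2 : ℝ) ^ (-(γ * t / 2)) ≤ 2 ^ (γ / 2) * 2 ^ (-(γ * s / 2)) := by
    rw [← Real.rpow_add two_pos]
    refine Real.rpow_le_rpow_of_exponent_le one_le_two ?_
    nlinarith
  calc 2 * 8 ^ ((n : ℝ) + γ) * 2 ^ (-(γ * t / 2)) * (scaleConst n γ).toReal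
      ≤ 2 * 8 ^ ((n : ℝ) + γ) * (2 ^ (γ / 2) * 2 ^ (-(γ * s / 2))) * (scaleConst n γ).toReal := by
        gcongr
    _ = _ := by ring

/-- The bound `2^{-γ s / 2}` for one-sided multiplication by the complement of `⋁ 5A_k`. -/
theorem memLp_perp_bigProj (hn : 0 < n) {γ : ℝ} (hγ : 0 < γ) (hγ1 : γ ≤ 1)
    (hL : IsSideAction τ hMN L) {K : (Fin n → ℝ) → (Fin n → ℝ) → N}
    {T : Lp (τ.L2sub M) 2 (volume : Measure (Fin n → ℝ)) →L[ℂ]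
      Lp τ.L2 2 (volume : Measure (Fin n → ℝ))}
    (hCZ : IsCalderonZygmund hMN τ γ K T)
    (hmod : ∀ (a : M) (f g : Lp (τ.L2sub M) 2 (volume : Measure (Fin n → ℝ))),
      (∀ᵐ x, (g x : τ.L2) = L (incl hMN a) (f x)) → ∀ᵐ x, T g x = L (incl hMN a) (T f x))
    (f : Lp (τ.L2sub M) 2 (volume : Measure (Fin n → ℝ))) (s : ℕ)
    (A : ℤ → (Fin n → ℤ) → Proj M)
    (hf : ∀ (k : ℤ) (x : Fin n → ℝ), L (incl hMN (A k (cubeIndex k x)).perp)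
      (mdiff (k + s) (fun y => (f y : τ.L2)) x) = 0) :
    MemLp (fun x => L (incl hMN (bigProj A x).perp) (T f x)) 2 volume ∧
      eLpNorm (fun x => L (incl hMN (bigProj A x).perp) (T f x)) 2 volume ≤
        ENNReal.ofReal (czConst n γ * (2 : ℝ) ^ (-(γ * s / 2)) * ‖f‖) := by
  have hfn : eLpNorm f 2 volume = ENNReal.ofReal ‖f‖ := by
    rw [Lp.norm_def, ENNReal.ofReal_toReal (Lp.eLpNorm_ne_top f)]
  have hqm := fun ψ => hL.aestronglyMeasurable_perp_bigProj (n := n) A (ψ := ψ)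
  suffices h : eLpNorm (fun x => L (incl hMN (bigProj A x).perp) (T f x)) 2 volume ≤
      ENNReal.ofReal (czConst n γ * (2 : ℝ) ^ (-(γ * s / 2)) * ‖f‖) from
    ⟨⟨hqm _ (Lp.aestronglyMeasurable _), h.trans_lt ENNReal.ofReal_lt_top⟩, h⟩
  cases s with
  | zero =>
    -- The projections of the cubes of the next level, joined over the children of a cube, satisfy
    -- the hypothesis for `s = 1`, and the double of a cube lies in the fivefolds of its children.
    set B : ℤ → (Fin n → ℤ) → Proj M := fun k m =>
      Proj.sup fun y : {y : Fin n → ℝ // cubeIndex k y = m} =>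
        A (k + 1) (cubeIndex (k + 1) y.1) with hB
    refine (eLpNorm_perp_le hn hγ hγ1 hL hCZ hmod 0 (B := B) (q := bigProj A)
      (fun k m x hx => Proj.sup_le fun y => le_bigProj (mem_dilate_five_of_mem_dilate_two ?_)) hqm f
      fun k x => ?_).trans ?_
    · rwa [y.2]
    · have h1 := hf (k + 1) x
      rw [hL.apply_perp, sub_eq_zero, Nat.cast_zero, add_zero] at h1
      have h2 : A (k + 1) (cubeIndex (k + 1) x) ≤ B k (cubeIndex k x) :=
        Proj.le_sup (fun y : {y : Fin n → ℝ // cubeIndex k y = cubeIndex k x} =>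
          A (k + 1) (cubeIndex (k + 1) y.1)) ⟨x, rfl⟩
      rw [Nat.cast_zero, add_zero, h1, hL.apply_perp, hL.apply_right_of_le h2, sub_self]
    · rw [hfn]
      exact truncConst_mul_le hγ (by lia)
  | succ t =>
    refine (eLpNorm_perp_le hn hγ hγ1 hL hCZ hmod t (B := A) (q := bigProj A)
      (fun k m x hx => le_bigProj (dilate_two_subset_dilate_five hx)) hqm f fun k x => ?_).trans ?_
    · have h1 := hf k x
      rwa [Nat.cast_succ, ← add_assoc] at h1
    · rw [hfn]
      exact truncConst_mul_le hγ le_rfl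

end SideAction

end NCInt

theorem mainTheorem2 (n : ℕ) (hn : 0 < n) (γ : ℝ) (hγ0 : 0 < γ) (hγ1 : γ ≤ 1) :
    ∃ C : ℝ, ∀ (H : Type u) [NormedAddCommGroup H] [InnerProductSpace ℂ H] [CompleteSpace H]
      (M N : VonNeumannAlgebra H) (hMN : M ≤ N) (τ : NCInt.NSFTrace N)
      (_ : NCInt.IsSemifiniteOn τ.toFun M)
      (K : (Fin n → ℝ) → (Fin n → ℝ) → N)
      (T : Lp (τ.L2sub M) 2 (volume : Measure (Fin n → ℝ)) →L[ℂ]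
        Lp τ.L2 2 (volume : Measure (Fin n → ℝ)))
      (_ : NCInt.IsCalderonZygmund hMN τ γ K T)
      (f : Lp (τ.L2sub M) 2 (volume : Measure (Fin n → ℝ))) (s : ℕ)
      (A B : ℤ → (Fin n → ℤ) → NCInt.Proj M),
      (∀ (k : ℤ) (x : Fin n → ℝ),
        τ.lmul (NCInt.incl hMN (A k (NCInt.cubeIndex k x)).perp)
          (NCInt.mdiff (k + s) (fun y => (f y : τ.L2)) x) = 0) →
      (∀ (k : ℤ) (x : Fin n → ℝ),
        τ.rmul (NCInt.incl hMN (B k (NCInt.cubeIndex k x)).perp)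
          (NCInt.mdiff (k + s) (fun y => (f y : τ.L2)) x) = 0) →
      (MemLp (fun x => τ.lmul (NCInt.incl hMN (NCInt.bigProj A x).perp) (T f x)) 2 volume ∧
        eLpNorm (fun x => τ.lmul (NCInt.incl hMN (NCInt.bigProj A x).perp) (T f x)) 2 volume ≤
          ENNReal.ofReal (C * (2 : ℝ) ^ (-(γ * s / 2)) * ‖f‖)) ∧
      (MemLp (fun x => τ.rmul (NCInt.incl hMN (NCInt.bigProj B x).perp) (T f x)) 2 volume ∧
        eLpNorm (fun x => τ.rmul (NCInt.incl hMN (NCInt.bigProj B x).perp) (T f x)) 2 volume ≤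
          ENNReal.ofReal (C * (2 : ℝ) ^ (-(γ * s / 2)) * ‖f‖)) := by
  refine ⟨NCInt.czConst n γ, fun H _ _ _ M N hMN τ _ K T hCZ f s A B hA hB => ⟨?_, ?_⟩⟩
  · exact NCInt.memLp_perp_bigProj hn hγ0 hγ1 (τ.isSideAction_lmul hMN) hCZ hCZ.left_modular f s A hA
  · exact NCInt.memLp_perp_bigProj hn hγ0 hγ1 (τ.isSideAction_rmul hMN) hCZ hCZ.right_modular f s B
      hB
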